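/- A \emph{pasting scheme} $\mathcal G$ is a finite plane acyclic directed graph with a source $s$ and a sink $t$ on its outer face, whose outer face is bounded by two directed paths $p,q\colon s\to t$ (upper and lower) and whose every inner face $F$ is bounded by two directed paths $\sigma_F,\tau_F\colon s_F\to t_F$ (upper and lower). Write $F\lhd G$ if $\tau_F$ and $\sigma_G$ share an edge. Let $\mathcal C_{\mathcal G}$ be the contractible groupoid (exactly one morphism between any two objects) whose objects are the linear orderings of the set of inner faces compatible with $\lhd$. A \emph{labelling} $\mathcal L$ of $\mathcal G$ in a Gray-category $\mathcal K$ assigns objects to vertices, 1-cells to edges and to each face $F$ a 2-cell $\alpha_F$ from the composite of $\sigma_F$ to the composite of $\tau_F$. It induces a functor $\mathcal L\colon\mathcal C_{\mathcal G}\to\mathcal K(S,T)[p,q]$, where $S,T$ are the labels of $s,t$: an ordering of the faces is sent to the vertical composite, in that order, of the whiskered 2-cells $\alpha_F$, and a morphism to the unique 3-cell between two such composites that is built from interchangers of $\mathcal K$. Let $F\lessdot G$, i.e. $F\lhd G$ and $F,G$ are adjacent, in this order, in some object of $\mathcal C_{\mathcal G}$. Then $F$ and $G$ glue to one face $F\#G$,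 with boundary paths $\sigma_{F\#G}=m_F\sigma_Fn_F$ and $\tau_{F\#G}=m_G\tau_Gn_G$ (paths written in the order of travel), where $m_F\tau_Fn_F=m_G\sigma_Gn_G$, one of $m_F,m_G$ is empty and one of $n_F,n_G$ is empty. Let $\mathcal G^{FG}$ be the pasting scheme obtained from $\mathcal G$ by replacing $F,G$ by $F\#G$, and let $S_{FG}\colon\mathcal C_{\mathcal G^{FG}}\to\mathcal C_{\mathcal G}$ be the functor sending an ordering $U(F\#G)W$ to $UFGW$. Let $\alpha_G.\alpha_F$ be the 2-cell from the composite of $\sigma_{F\#G}$ to that of $\tau_{F\#G}$ given by $\alpha_F$ whiskered by $m_F,n_F$ followed by $\alpha_G$ whiskered by $m_G,n_G$. For a 2-cell $\alpha'$ parallel to $\alpha_G.\alpha_F$ let $\mathcal L^{\alpha'}_{FG}$ be the labelling of $\mathcal G^{FG}$ with $\alpha'$ on $F\#G$ and agreeing with $\mathcal L$ elsewhere, and put $\mathcal L_{FG}=\mathcal L^{\alpha_G.\alpha_F}_{FG}$. For a 3-cell $\Pi\colon\alpha_G.\alpha_F\Rrightarrow\alpha'$ and an object $Y$ of $\mathcal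 C_{\mathcal G^{FG}}$ let $\Pi^*_Y\colon\mathcal L_{FG}(Y)\Rrightarrow\mathcal L^{\alpha'}_{FG}(Y)$ be the 3-cell obtained by whiskering $\Pi$ into the composite $\mathcal L_{FG}(Y)$ at the face $F\#G$. \textbf{Theorem.} Let $\mathcal L$ be a labelling of a pasting scheme $\mathcal G$ in a Gray-category $\mathcal K$ and let $F\lessdot G$ be faces of $\mathcal G$. Then $S_{FG}$ is an equivalence and $\mathcal L_{FG}=\mathcal L\circ S_{FG}$ as functors. Moreover, for every pseudo-inverse $J\colon\mathcal C_{\mathcal G}\to\mathcal C_{\mathcal G^{FG}}$ of $S_{FG}$ and every 3-cell $\Pi\colon\alpha_G.\alpha_F\Rrightarrow\alpha'$, the 3-cells \[ \overline{\Pi^*}_X\colon\ \mathcal L(X)\ \cong\ \mathcal L(S_{FG}JX)=\mathcal L_{FG}(JX)\ \xrightarrow{\ \Pi^*_{JX}\ }\ \mathcal L^{\alpha'}_{FG}(JX)\qquad(X\in\mathcal C_{\mathcal G}), \] in which the isomorphism is the image under $\mathcal L$ of the unique morphism $X\to S_{FG}JX$, are the components of a natural transformation $\overline{\Pi^*}\colon\mathcal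 L\Rightarrow\mathcal L^{\alpha'}_{FG}\circ J$. -/

import Mathlib

open CategoryTheory Bicategory

namespace GrayPasting

universe w₃ w₂ v u

set_option linter.checkUnivs false in
/-- A Gray-category, i.e. a category enriched in strict 2-categories with the (pseudo) Gray tensor
product, in unpacked form: hom 2-categories `X ⟶ Y`, composition with a 1-cell on either side as a
strict 2-functor (`wR`, `wL` on 2-cells, `wR₂`, `wL₂` on 3-cells), and an invertible interchange
3-cell `γ` for each pair of horizontally composable 2-cells.  Composition is written in
diagrammatic order.  Equations whose sides are parallel only up to a strict law are heterogeneous. -/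
class GrayCategory (K : Type u) extends Category.{v} K where
  [homBicategory : ∀ X Y : K, Bicategory.{w₃, w₂} (X ⟶ Y)]
  [homStrict : ∀ X Y : K, Bicategory.Strict (X ⟶ Y)]
  wR : ∀ {X Y Z : K} {f f' : X ⟶ Y}, (f ⟶ f') → ∀ g : Y ⟶ Z, (f ≫ g ⟶ f' ≫ g)
  wL : ∀ {X Y Z : K} (f : X ⟶ Y) {g g' : Y ⟶ Z}, (g ⟶ g') → (f ≫ g ⟶ f ≫ g')
  wR₂ : ∀ {X Y Z : K} {f f' : X ⟶ Y} {α α' : f ⟶ f'}, (α ⟶ α') → ∀ g : Y ⟶ Z, (wR α g ⟶ wR α' g)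
  wL₂ : ∀ {X Y Z : K} (f : X ⟶ Y) {g g' : Y ⟶ Z} {β β' : g ⟶ g'}, (β ⟶ β') → (wL f β ⟶ wL f β')
  -- strict 2-functor
  wR_id : ∀ {X Y Z : K} (f : X ⟶ Y) (g : Y ⟶ Z), wR (𝟙 f) g = 𝟙 (f ≫ g)
  wR_comp : ∀ {X Y Z : K} {f f' f'' : X ⟶ Y} (α : f ⟶ f') (α' : f' ⟶ f'') (g : Y ⟶ Z),
    wR (α ≫ α') g = wR α g ≫ wR α' g
  wR₂_id : ∀ {X Y Z : K} {f f' : X ⟶ Y} (α : f ⟶ f') (g : Y ⟶ Z), wR₂ (𝟙 α) g = 𝟙 (wR α g)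
  wR₂_comp : ∀ {X Y Z : K} {f f' : X ⟶ Y} {α α' α'' : f ⟶ f'} (Γ : α ⟶ α') (Γ' : α' ⟶ α'')
    (g : Y ⟶ Z), wR₂ (Γ ≫ Γ') g = wR₂ Γ g ≫ wR₂ Γ' g
  wR₂_whiskerLeft : ∀ {X Y Z : K} {f f' f'' : X ⟶ Y} (α : f ⟶ f') {β β' : f' ⟶ f''} (Γ : β ⟶ β')
    (g : Y ⟶ Z), wR₂ (α ◁ Γ) g ≍ wR α g ◁ wR₂ Γ g
  wR₂_whiskerRight : ∀ {X Y Z : K} {f f' f'' : X ⟶ Y} {α α' : f ⟶ f'} (Γ : α ⟶ α') (β : f' ⟶ f'')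
    (g : Y ⟶ Z), wR₂ (Γ ▷ β) g ≍ wR₂ Γ g ▷ wR β g
  wL_id : ∀ {X Y Z : K} (f : X ⟶ Y) (g : Y ⟶ Z), wL f (𝟙 g) = 𝟙 (f ≫ g)
  wL_comp : ∀ {X Y Z : K} (f : X ⟶ Y) {g g' g'' : Y ⟶ Z} (β : g ⟶ g') (β' : g' ⟶ g''),
    wL f (β ≫ β') = wL f β ≫ wL f β'
  wL₂_id : ∀ {X Y Z : K} (f : X ⟶ Y) {g g' : Y ⟶ Z} (β : g ⟶ g'), wL₂ f (𝟙 β) = 𝟙 (wL f β)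
  wL₂_comp : ∀ {X Y Z : K} (f : X ⟶ Y) {g g' : Y ⟶ Z} {β β' β'' : g ⟶ g'} (Θ : β ⟶ β')
    (Θ' : β' ⟶ β''), wL₂ f (Θ ≫ Θ') = wL₂ f Θ ≫ wL₂ f Θ'
  wL₂_whiskerLeft : ∀ {X Y Z : K} (f : X ⟶ Y) {g g' g'' : Y ⟶ Z} (β : g ⟶ g') {δ δ' : g' ⟶ g''}
    (Θ : δ ⟶ δ'), wL₂ f (β ◁ Θ) ≍ wL f β ◁ wL₂ f Θ
  wL₂_whiskerRight : ∀ {X Y Z : K} (f : X ⟶ Y) {g g' g'' : Y ⟶ Z} {β β' : g ⟶ g'} (Θ : β ⟶ β')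
    (δ : g' ⟶ g''), wL₂ f (Θ ▷ δ) ≍ wL₂ f Θ ▷ wL f δ
  -- unit and associativity laws
  wR_one : ∀ {X Y : K} {f f' : X ⟶ Y} (α : f ⟶ f'), wR α (𝟙 Y) ≍ α
  wR₂_one : ∀ {X Y : K} {f f' : X ⟶ Y} {α α' : f ⟶ f'} (Γ : α ⟶ α'), wR₂ Γ (𝟙 Y) ≍ Γ
  wL_one : ∀ {X Y : K} {g g' : X ⟶ Y} (β : g ⟶ g'), wL (𝟙 X) β ≍ β
  wL₂_one : ∀ {X Y : K} {g g' : X ⟶ Y} {β β' : g ⟶ g'} (Θ : β ⟶ β'), wL₂ (𝟙 X) Θ ≍ Θ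
  wR_assoc : ∀ {W X Y Z : K} {f f' : W ⟶ X} (α : f ⟶ f') (g : X ⟶ Y) (h : Y ⟶ Z),
    wR (wR α g) h ≍ wR α (g ≫ h)
  wR₂_assoc : ∀ {W X Y Z : K} {f f' : W ⟶ X} {α α' : f ⟶ f'} (Γ : α ⟶ α') (g : X ⟶ Y)
    (h : Y ⟶ Z), wR₂ (wR₂ Γ g) h ≍ wR₂ Γ (g ≫ h)
  wM_assoc : ∀ {W X Y Z : K} (f : W ⟶ X) {g g' : X ⟶ Y} (β : g ⟶ g') (h : Y ⟶ Z),
    wR (wL f β) h ≍ wL f (wR β h)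
  wM₂_assoc : ∀ {W X Y Z : K} (f : W ⟶ X) {g g' : X ⟶ Y} {β β' : g ⟶ g'} (Θ : β ⟶ β')
    (h : Y ⟶ Z), wR₂ (wL₂ f Θ) h ≍ wL₂ f (wR₂ Θ h)
  wL_assoc : ∀ {W X Y Z : K} (f : W ⟶ X) (g : X ⟶ Y) {h h' : Y ⟶ Z} (δ : h ⟶ h'),
    wL (f ≫ g) δ ≍ wL f (wL g δ)
  wL₂_assoc : ∀ {W X Y Z : K} (f : W ⟶ X) (g : X ⟶ Y) {h h' : Y ⟶ Z} {δ δ' : h ⟶ h'}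
    (Θ : δ ⟶ δ'), wL₂ (f ≫ g) Θ ≍ wL₂ f (wL₂ g Θ)
  -- interchange
  γ : ∀ {X Y Z : K} {f f' : X ⟶ Y} (α : f ⟶ f') {g g' : Y ⟶ Z} (β : g ⟶ g'),
    wR α g ≫ wL f' β ≅ wL f β ≫ wR α g'
  γ_naturality_left : ∀ {X Y Z : K} {f f' : X ⟶ Y} {α α' : f ⟶ f'} (Γ : α ⟶ α')
    {g g' : Y ⟶ Z} (β : g ⟶ g'),
    wR₂ Γ g ▷ wL f' β ≫ (γ α' β).hom = (γ α β).hom ≫ wL f β ◁ wR₂ Γ g'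
  γ_naturality_right : ∀ {X Y Z : K} {f f' : X ⟶ Y} (α : f ⟶ f')
    {g g' : Y ⟶ Z} {β β' : g ⟶ g'} (Θ : β ⟶ β'),
    wR α g ◁ wL₂ f' Θ ≫ (γ α β').hom = (γ α β).hom ≫ wL₂ f Θ ▷ wR α g'
  γ_id_left : ∀ {X Y Z : K} (f : X ⟶ Y) {g g' : Y ⟶ Z} (β : g ⟶ g'),
    (γ (𝟙 f) β).hom ≍ 𝟙 (wL f β)
  γ_id_right : ∀ {X Y Z : K} {f f' : X ⟶ Y} (α : f ⟶ f') (g : Y ⟶ Z),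
    (γ α (𝟙 g)).hom ≍ 𝟙 (wR α g)
  γ_comp_left : ∀ {X Y Z : K} {f f' f'' : X ⟶ Y} (α : f ⟶ f') (α' : f' ⟶ f'')
    {g g' : Y ⟶ Z} (β : g ⟶ g'),
    (γ (α ≫ α') β).hom ≍
      (α_ (wR α g) (wR α' g) (wL f'' β)).hom ≫ wR α g ◁ (γ α' β).hom ≫
        (α_ (wR α g) (wL f' β) (wR α' g')).inv ≫ (γ α β).hom ▷ wR α' g' ≫
          (α_ (wL f β) (wR α g') (wR α' g')).hom
  γ_comp_right : ∀ {X Y Z : K} {f f' : X ⟶ Y} (α : f ⟶ f')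
    {g g' g'' : Y ⟶ Z} (β : g ⟶ g') (β' : g' ⟶ g''),
    (γ α (β ≫ β')).hom ≍
      (α_ (wR α g) (wL f' β) (wL f' β')).inv ≫ (γ α β).hom ▷ wL f' β' ≫
        (α_ (wL f β) (wR α g') (wL f' β')).hom ≫ wL f β ◁ (γ α β').hom ≫
          (α_ (wL f β) (wL f β') (wR α g'')).inv
  γ_assoc_left : ∀ {W X Y Z : K} {f f' : W ⟶ X} (α : f ⟶ f') (g : X ⟶ Y)
    {h h' : Y ⟶ Z} (δ : h ⟶ h'), (γ (wR α g) δ).hom ≍ (γ α (wL g δ)).hom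
  γ_assoc_middle : ∀ {W X Y Z : K} (f : W ⟶ X) {g g' : X ⟶ Y} (β : g ⟶ g')
    {h h' : Y ⟶ Z} (δ : h ⟶ h'), (γ (wL f β) δ).hom ≍ wL₂ f (γ β δ).hom
  γ_assoc_right : ∀ {W X Y Z : K} {f f' : W ⟶ X} (α : f ⟶ f') {g g' : X ⟶ Y} (β : g ⟶ g')
    (h : Y ⟶ Z), (γ α (wR β h)).hom ≍ wR₂ (γ α β).hom h

attribute [reducible, instance] GrayCategory.homBicategory
attribute [instance] GrayCategory.homStrict

open GrayCategory

variable {K : Type u} [GrayCategory.{w₃, w₂, v} K]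

/-- Composition with a 1-cell, on invertible 3-cells. -/
def wLIso {X Y Z : K} (f : X ⟶ Y) {g g' : Y ⟶ Z} {β β' : g ⟶ g'} (Θ : β ≅ β') :
    wL f β ≅ wL f β' where
  hom := wL₂ f Θ.hom
  inv := wL₂ f Θ.inv
  hom_inv_id := by rw [← wL₂_comp, Θ.hom_inv_id, wL₂_id]
  inv_hom_id := by rw [← wL₂_comp, Θ.inv_hom_id, wL₂_id]

/-- The 2-cell `α` whiskered by 1-cells `A` and `B`, between 1-cells equal to `A ≫ a ≫ B` and
`A ≫ a' ≫ B`. -/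
def plug {W X Y Z : K} {f f' : W ⟶ Z} (A : W ⟶ X) {a a' : X ⟶ Y} (α : a ⟶ a') (B : Y ⟶ Z)
    (h : f = A ≫ a ≫ B) (h' : f' = A ≫ a' ≫ B) : f ⟶ f' :=
  eqToHom h ≫ wL A (wR α B) ≫ eqToHom h'.symm

theorem plug_rfl {W X Y Z : K} (A : W ⟶ X) {a a' : X ⟶ Y} (α : a ⟶ a') (B : Y ⟶ Z) :
    plug A α B rfl rfl = wL A (wR α B) := by
  simp [plug]

theorem plug_heq {W X Y Z : K} {f f' : W ⟶ Z} (A : W ⟶ X) {a a' : X ⟶ Y} (α : a ⟶ a') (B : Y ⟶ Z)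
    (h : f = A ≫ a ≫ B) (h' : f' = A ≫ a' ≫ B) : plug A α B h h' ≍ wL A (wR α B) := by
  subst h h'
  rw [plug_rfl]

theorem wL_heq {X Y Z : K} (f : X ⟶ Y) {g g' h h' : Y ⟶ Z} {β : g ⟶ g'} {δ : h ⟶ h'}
    (e : g = h) (e' : g' = h') (hb : β ≍ δ) : wL f β ≍ wL f δ := by
  subst e e'; cases hb; rfl

theorem wL₂_heq {X Y Z : K} (f : X ⟶ Y) {g g' h h' : Y ⟶ Z} {β β' : g ⟶ g'} {δ δ' : h ⟶ h'}
    (e : g = h) (e' : g' = h') (hb : β ≍ δ) (hb' : β' ≍ δ') {Γ : β ⟶ β'} {Θ : δ ⟶ δ'}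
    (hG : Γ ≍ Θ) : wL₂ f Γ ≍ wL₂ f Θ := by
  subst e e'; cases hb; cases hb'; cases hG; rfl

theorem γ_heq {X Y Z : K} {f f' : X ⟶ Y} (α : f ⟶ f') {g g' h h' : Y ⟶ Z} {β : g ⟶ g'} {δ : h ⟶ h'}
    (e : g = h) (e' : g' = h') (hb : β ≍ δ) : (γ α β).hom ≍ (γ α δ).hom := by
  subst e e'; cases hb; rfl


theorem plug_shift {W X Y Z T U : K} {f f' : W ⟶ U} (A : W ⟶ X) (a : X ⟶ Y)
    (B : Y ⟶ Z) {b b' : Z ⟶ T} (β : b ⟶ b') (C : T ⟶ U)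
    (h : f = (A ≫ a ≫ B) ≫ b ≫ C) (h' : f' = (A ≫ a ≫ B) ≫ b' ≫ C) :
    plug (A ≫ a ≫ B) β C h h' = eqToHom (by simp [h]) ≫ wL A (wL a (wL B (wR β C))) ≫
      eqToHom (show A ≫ a ≫ B ≫ b' ≫ C = f' by simp [h']) := by
  obtain rfl : f = A ≫ a ≫ B ≫ b ≫ C := by simpa using h
  obtain rfl : f' = A ≫ a ≫ B ≫ b' ≫ C := by simpa using h'
  simp only [eqToHom_refl, Category.id_comp, Category.comp_id]
  refine eq_of_heq ((plug_heq _ _ _ _ _).trans ((wL_assoc _ _ _).trans ?_))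
  exact wL_heq _ (by simp) (by simp) (wL_assoc _ _ _)

theorem plug_comp_plug {W X Y Z T U : K} {f₀₀ f₁₀ f₁₁ : W ⟶ U} (A : W ⟶ X) {a a' : X ⟶ Y}
    (α : a ⟶ a') (B : Y ⟶ Z) {b b' : Z ⟶ T} (β : b ⟶ b') (C : T ⟶ U)
    (h₀₀ : f₀₀ = A ≫ a ≫ B ≫ b ≫ C) (h₁₀ : f₁₀ = A ≫ a' ≫ B ≫ b ≫ C)
    (h₁₀' : f₁₀ = (A ≫ a' ≫ B) ≫ b ≫ C) (h₁₁ : f₁₁ = (A ≫ a' ≫ B) ≫ b' ≫ C) :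
    plug A α (B ≫ b ≫ C) h₀₀ h₁₀ ≫ plug (A ≫ a' ≫ B) β C h₁₀' h₁₁ =
      eqToHom h₀₀ ≫ wL A (wR α (B ≫ b ≫ C) ≫ wL a' (wL B (wR β C))) ≫
        eqToHom (by simp [h₁₁]) := by
  rw [plug_shift, plug, wL_comp]
  simp

theorem plug_comp_plug' {W X Y Z T U : K} {f₀₀ f₀₁ f₁₁ : W ⟶ U} (A : W ⟶ X) {a a' : X ⟶ Y}
    (α : a ⟶ a') (B : Y ⟶ Z) {b b' : Z ⟶ T} (β : b ⟶ b') (C : T ⟶ U)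
    (h₀₀ : f₀₀ = (A ≫ a ≫ B) ≫ b ≫ C) (h₀₁' : f₀₁ = (A ≫ a ≫ B) ≫ b' ≫ C)
    (h₀₁ : f₀₁ = A ≫ a ≫ B ≫ b' ≫ C) (h₁₁ : f₁₁ = A ≫ a' ≫ B ≫ b' ≫ C) :
    plug (A ≫ a ≫ B) β C h₀₀ h₀₁' ≫ plug A α (B ≫ b' ≫ C) h₀₁ h₁₁ =
      eqToHom (by simp [h₀₀]) ≫ wL A (wL a (wL B (wR β C)) ≫ wR α (B ≫ b' ≫ C)) ≫
        eqToHom h₁₁.symm := by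
  rw [plug_shift, plug, wL_comp]
  simp

/-- The interchange of `α` and `β`, which act at disjoint places of `A ≫ a ≫ B ≫ b ≫ C`. -/
def swapIso {W X Y Z T U : K} {f₀₀ f₁₀ f₀₁ f₁₁ : W ⟶ U} (A : W ⟶ X) {a a' : X ⟶ Y}
    (α : a ⟶ a') (B : Y ⟶ Z) {b b' : Z ⟶ T} (β : b ⟶ b') (C : T ⟶ U)
    (h₀₀ : f₀₀ = A ≫ a ≫ B ≫ b ≫ C) (h₁₀ : f₁₀ = A ≫ a' ≫ B ≫ b ≫ C)
    (h₁₀' : f₁₀ = (A ≫ a' ≫ B) ≫ b ≫ C) (h₁₁' : f₁₁ = (A ≫ a' ≫ B) ≫ b' ≫ C)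
    (h₀₀' : f₀₀ = (A ≫ a ≫ B) ≫ b ≫ C) (h₀₁' : f₀₁ = (A ≫ a ≫ B) ≫ b' ≫ C)
    (h₀₁ : f₀₁ = A ≫ a ≫ B ≫ b' ≫ C) (h₁₁ : f₁₁ = A ≫ a' ≫ B ≫ b' ≫ C) :
    plug A α (B ≫ b ≫ C) h₀₀ h₁₀ ≫ plug (A ≫ a' ≫ B) β C h₁₀' h₁₁' ≅
      plug (A ≫ a ≫ B) β C h₀₀' h₀₁' ≫ plug A α (B ≫ b' ≫ C) h₀₁ h₁₁ :=
  eqToIso (plug_comp_plug A α B β C h₀₀ h₁₀ h₁₀' h₁₁') ≪≫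
    whiskerLeftIso (eqToHom h₀₀)
      (whiskerRightIso (wLIso A (γ α (wL B (wR β C)))) (eqToHom h₁₁.symm)) ≪≫
    (eqToIso (plug_comp_plug' A α B β C h₀₀' h₀₁' h₀₁ h₁₁)).symm

theorem whisker_id_heq {B : Type*} [Bicategory B] [Bicategory.Strict B] {x y : B} {f g : x ⟶ y}
    (η : f ⟶ g) : 𝟙 x ◁ (η ▷ 𝟙 y) ≍ η := by
  simp only [whiskerRight_id, id_whiskerLeft, Bicategory.Strict.leftUnitor_eqToIso,
    Bicategory.Strict.rightUnitor_eqToIso, eqToIso.hom, eqToIso.inv, Category.assoc]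
  simp only [eqToHom_comp_heq_iff, eqToHom_trans, comp_eqToHom_heq_iff]
  rfl

theorem swapIso_heq {W X Y Z T U : K} {f₀₀ f₁₀ f₀₁ f₁₁ : W ⟶ U} (A : W ⟶ X) {a a' : X ⟶ Y}
    (α : a ⟶ a') (B : Y ⟶ Z) {b b' : Z ⟶ T} (β : b ⟶ b') (C : T ⟶ U)
    (h₀₀ : f₀₀ = A ≫ a ≫ B ≫ b ≫ C) (h₁₀ : f₁₀ = A ≫ a' ≫ B ≫ b ≫ C)
    (h₁₀' : f₁₀ = (A ≫ a' ≫ B) ≫ b ≫ C) (h₁₁' : f₁₁ = (A ≫ a' ≫ B) ≫ b' ≫ C)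
    (h₀₀' : f₀₀ = (A ≫ a ≫ B) ≫ b ≫ C) (h₀₁' : f₀₁ = (A ≫ a ≫ B) ≫ b' ≫ C)
    (h₀₁ : f₀₁ = A ≫ a ≫ B ≫ b' ≫ C) (h₁₁ : f₁₁ = A ≫ a' ≫ B ≫ b' ≫ C) :
    (swapIso A α B β C h₀₀ h₁₀ h₁₀' h₁₁' h₀₀' h₀₁' h₀₁ h₁₁).hom ≍
      wL₂ A (γ α (wL B (wR β C))).hom := by
  subst h₀₀ h₁₁ h₁₀ h₀₁
  simp only [swapIso, Iso.trans_hom, eqToIso.hom, Iso.symm_hom, eqToIso.inv, whiskerLeftIso_hom,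
    whiskerRightIso_hom, eqToHom_comp_heq_iff, comp_eqToHom_heq_iff]
  exact whisker_id_heq (wL₂ A (γ α (wL B (wR β C))).hom)

/-- The cube of interchangers of `α` with a 3-cell `ω`. -/
theorem cube {X Y Z : K} {a a' : X ⟶ Y} (α : a ⟶ a') {n₀ n₁ n₂ n₃ : Y ⟶ Z}
    (b : n₀ ⟶ n₁) (d' : n₁ ⟶ n₃) (d : n₀ ⟶ n₂) (b' : n₂ ⟶ n₃) (ω : b ≫ d' ⟶ d ≫ b')
    {ω₁ : wL a b ≫ wL a d' ⟶ wL a d ≫ wL a b'} (h₁ : ω₁ ≍ wL₂ a ω)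
    {ω₂ : wL a' b ≫ wL a' d' ⟶ wL a' d ≫ wL a' b'} (h₂ : ω₂ ≍ wL₂ a' ω) :
    (γ α b).hom ▷ wL a' d' ≫ (α_ _ _ _).hom ≫ wL a b ◁ (γ α d').hom ≫ (α_ _ _ _).inv ≫
      ω₁ ▷ wR α n₃ =
    (α_ _ _ _).hom ≫ wR α n₀ ◁ ω₂ ≫ (α_ _ _ _).inv ≫ (γ α d).hom ▷ wL a' b' ≫ (α_ _ _ _).hom ≫
      wL a d ◁ (γ α b').hom ≫ (α_ _ _ _).inv := by
  have N := γ_naturality_right α ω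
  have g₁ := γ_comp_right α b d'
  have g₂ := γ_comp_right α d b'
  have e₁ := wL_comp a b d'
  have e₂ := wL_comp a d b'
  have e₃ := wL_comp a' b d'
  have e₄ := wL_comp a' d b'
  generalize wL₂ a ω = x at *
  generalize wL₂ a' ω = y at *
  generalize (γ α (b ≫ d')).hom = z at *
  generalize (γ α (d ≫ b')).hom = w at *
  generalize wL a (b ≫ d') = i₁ at *
  generalize wL a (d ≫ b') = i₂ at *
  generalize wL a' (b ≫ d') = i₃ at *
  generalize wL a' (d ≫ b') = i₄ at *
  subst e₁ e₂ e₃ e₄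
  cases h₁; cases h₂; cases g₁; cases g₂
  simp only [Category.assoc] at N
  rw [← cancel_epi (α_ _ _ _).inv, N.symm]
  simp

theorem cube' {X Y Z : K} {a a' : X ⟶ Y} (α : a ⟶ a') {n₀ n₁ n₂ n₃ : Y ⟶ Z}
    (b : n₀ ⟶ n₁) (d' : n₁ ⟶ n₃) (d : n₀ ⟶ n₂) (b' : n₂ ⟶ n₃) (ω : b ≫ d' ⟶ d ≫ b')
    {f₀₀₀ f₁₀₀ f₀₁₀ f₁₁₀ f₀₀₁ f₁₀₁ f₀₁₁ f₁₁₁ : X ⟶ Z}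
    (e₀₀₀ : f₀₀₀ = a ≫ n₀) (e₁₀₀ : f₁₀₀ = a' ≫ n₀) (e₀₁₀ : f₀₁₀ = a ≫ n₁)
    (e₁₁₀ : f₁₁₀ = a' ≫ n₁) (e₀₀₁ : f₀₀₁ = a ≫ n₂) (e₁₀₁ : f₁₀₁ = a' ≫ n₂)
    (e₀₁₁ : f₀₁₁ = a ≫ n₃) (e₁₁₁ : f₁₁₁ = a' ≫ n₃)
    {x₀₀ : f₀₀₀ ⟶ f₁₀₀} {x₁₀ : f₀₁₀ ⟶ f₁₁₀} {x₀₁ : f₀₀₁ ⟶ f₁₀₁} {x₁₁ : f₀₁₁ ⟶ f₁₁₁}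
    {y₀₀ : f₀₀₀ ⟶ f₀₁₀} {y₁₀ : f₁₀₀ ⟶ f₁₁₀} {y₀₁ : f₀₀₁ ⟶ f₀₁₁} {y₁₁ : f₁₀₁ ⟶ f₁₁₁}
    {z₀₀ : f₀₀₀ ⟶ f₀₀₁} {z₁₀ : f₁₀₀ ⟶ f₁₀₁} {z₀₁ : f₀₁₀ ⟶ f₀₁₁} {z₁₁ : f₁₁₀ ⟶ f₁₁₁}
    (hx₀₀ : x₀₀ ≍ wR α n₀) (hx₁₀ : x₁₀ ≍ wR α n₁) (hx₀₁ : x₀₁ ≍ wR α n₂) (hx₁₁ : x₁₁ ≍ wR α n₃)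
    (hy₀₀ : y₀₀ ≍ wL a b) (hy₁₀ : y₁₀ ≍ wL a' b) (hy₀₁ : y₀₁ ≍ wL a b') (hy₁₁ : y₁₁ ≍ wL a' b')
    (hz₀₀ : z₀₀ ≍ wL a d) (hz₁₀ : z₁₀ ≍ wL a' d) (hz₀₁ : z₀₁ ≍ wL a d') (hz₁₁ : z₁₁ ≍ wL a' d')
    {xy₀ : x₀₀ ≫ y₁₀ ⟶ y₀₀ ≫ x₁₀} {xy₁ : x₀₁ ≫ y₁₁ ⟶ y₀₁ ≫ x₁₁}
    {xz₀ : x₀₀ ≫ z₁₀ ⟶ z₀₀ ≫ x₀₁} {xz₁ : x₁₀ ≫ z₁₁ ⟶ z₀₁ ≫ x₁₁}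
    {yz₀ : y₀₀ ≫ z₀₁ ⟶ z₀₀ ≫ y₀₁} {yz₁ : y₁₀ ≫ z₁₁ ⟶ z₁₀ ≫ y₁₁}
    (hxy₀ : xy₀ ≍ (γ α b).hom) (hxy₁ : xy₁ ≍ (γ α b').hom)
    (hxz₀ : xz₀ ≍ (γ α d).hom) (hxz₁ : xz₁ ≍ (γ α d').hom)
    (hyz₀ : yz₀ ≍ wL₂ a ω) (hyz₁ : yz₁ ≍ wL₂ a' ω) :
    xy₀ ▷ z₁₁ ≫ (α_ _ _ _).hom ≫ y₀₀ ◁ xz₁ ≫ (α_ _ _ _).inv ≫ yz₀ ▷ x₁₁ =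
      (α_ _ _ _).hom ≫ x₀₀ ◁ yz₁ ≫ (α_ _ _ _).inv ≫ xz₀ ▷ y₁₁ ≫ (α_ _ _ _).hom ≫
        z₀₀ ◁ xy₁ ≫ (α_ _ _ _).inv := by
  subst e₀₀₀ e₁₀₀ e₀₁₀ e₁₁₀ e₀₀₁ e₁₀₁ e₀₁₁ e₁₁₁
  cases hx₀₀; cases hx₁₀; cases hx₀₁; cases hx₁₁
  cases hy₀₀; cases hy₁₀; cases hy₀₁; cases hy₁₁
  cases hz₀₀; cases hz₁₀; cases hz₀₁; cases hz₁₁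
  cases hxy₀; cases hxy₁; cases hxz₀; cases hxz₁
  exact cube α b d' d b' ω hyz₀ hyz₁

end GrayPasting

namespace GrayPasting
universe w₃ w₂ v u u' v' w
section Paths

open Quiver

variable {V : Type u} [Quiver.{v} V]

/-- The edges of a directed graph. -/
abbrev Edge (V : Type u) [Quiver.{v} V] := Σ (a : V) (b : V), a ⟶ b

/-- The list of edges of a directed path. -/
def edges {a : V} : {b : V} → Path a b → List (Edge V)
  | _, .nil => []
  | _, .cons P e => edges P ++ [⟨_, _, e⟩]

/-- The list of vertices of a directed path other than its two ends. -/
def innerVertices {a b : V} (P : Path a b) : List V := ((edges P).map fun e => e.1).tail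

theorem edges_comp {a b c : V} (P : Path a b) (Q : Path b c) :
    edges (P.comp Q) = edges P ++ edges Q := by
  induction Q with
  | nil => simp [edges]
  | cons Q e ih => simp [edges, ih]

theorem length_edges {a b : V} (P : Path a b) : (edges P).length = P.length := by
  induction P with
  | nil => rfl
  | cons P e ih => simp [edges, ih]

theorem exists_split_of_mem {a b : V} (P : Path a b) {e : Edge V} (he : e ∈ edges P) :
    ∃ (A : Path a e.1) (B : Path e.2.1 b), P = (A.cons e.2.2).comp B := by
  induction P with
  | nil => simp [edges] at he
  | cons P f ih =>
    simp only [edges, List.mem_append, List.mem_singleton] at he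
    rcases he with he | rfl
    · obtain ⟨A, B, rfl⟩ := ih he
      exact ⟨A, B.cons f, rfl⟩
    · exact ⟨P, .nil, rfl⟩

/-- There are no directed cycles. -/
def Acyclic (V : Type u) [Quiver.{v} V] : Prop := ∀ (a : V) (P : Path a a), P = .nil

theorem Acyclic.contra (hV : Acyclic V) {a b : V} (P : Path a b) (e : b ⟶ a) : False := by
  have := hV _ (P.cons e)
  cases this

theorem exists_comp_of_subset (hV : Acyclic V) {a b c d : V} (P : Path a d) (Q : Path b c)
    (hQ : Q.length ≠ 0) (h : ∀ e ∈ edges Q, e ∈ edges P) :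
    ∃ (A : Path a b) (B : Path c d), P = A.comp (Q.comp B) := by
  induction Q with
  | nil => simp at hQ
  | @cons x y Q e ih =>
    have he : (⟨x, y, e⟩ : Edge V) ∈ edges P := h _ (by simp [edges])
    rcases Nat.eq_zero_or_pos Q.length with h0 | h0
    · obtain rfl := Path.eq_of_length_zero Q h0
      obtain rfl := Path.eq_nil_of_length_zero Q h0
      obtain ⟨A, B, hP⟩ := exists_split_of_mem P he
      exact ⟨A, B, by rw [hP]; simp [← Path.comp_toPath_eq_cons]⟩
    · obtain ⟨A, B, rfl⟩ := ih h0.ne' (fun f hf => h _ (by simp [edges, hf]))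
      simp only [edges_comp, List.mem_append] at he
      rcases he with he | he | he
      · obtain ⟨A₁, A₂, rfl⟩ := exists_split_of_mem A he
        exact (hV.contra (A₂.comp Q) e).elim
      · obtain ⟨A₁, A₂, rfl⟩ := exists_split_of_mem Q he
        exact (hV.contra A₂ e).elim
      · obtain ⟨B₁, B₂, rfl⟩ := exists_split_of_mem B he
        obtain rfl := hV _ B₁
        exact ⟨A, B₂, by simp [← Path.comp_toPath_eq_cons]⟩

theorem comp_eq_comp {a b b' c : V} {A : Path a b} {R : Path b c} {A' : Path a b'}
    {R' : Path b' c} (h : A.comp R = A'.comp R') :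
    (∃ m : Path b b', A' = A.comp m ∧ R = m.comp R') ∨
      (∃ m : Path b' b, A = A'.comp m ∧ R' = m.comp R) := by
  induction R with
  | nil => exact .inr ⟨R', h, rfl⟩
  | cons R e ih =>
    cases R' with
    | nil => exact .inl ⟨R.cons e, h.symm, rfl⟩
    | cons R' e' =>
      simp only [Path.comp_cons, Path.cons.injEq] at h
      obtain ⟨rfl, h₁, h₂⟩ := h
      obtain rfl := eq_of_heq h₂
      rcases ih (eq_of_heq h₁) with ⟨m, rfl, rfl⟩ | ⟨m, rfl, rfl⟩
      · exact .inl ⟨m, rfl, rfl⟩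
      · exact .inr ⟨m, rfl, rfl⟩

theorem comp_cancel (hV : Acyclic V) {a b c : V} {A A' : Path a b} {R R' : Path b c}
    (h : A.comp R = A'.comp R') : A = A' ∧ R = R' := by
  rcases comp_eq_comp h with ⟨m, rfl, rfl⟩ | ⟨m, rfl, rfl⟩ <;> obtain rfl := hV _ m <;> simp

theorem eq_comp_of_disjoint {a b c d t : V} {Q₁ : Path a b} {Q₂ : Path c d} (h₁ : Q₁.length ≠ 0)
    (h₂ : Q₂.length ≠ 0) (hd : ∀ e ∈ edges Q₁, e ∉ edges Q₂) {m : Path a c} {B : Path b t}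
    {B' : Path d t} (h : Q₁.comp B = m.comp (Q₂.comp B')) :
    ∃ k : Path b c, m = Q₁.comp k ∧ B = k.comp (Q₂.comp B') := by
  rcases comp_eq_comp h with ⟨k, hk, hB⟩ | ⟨k, hk, hB⟩
  · exact ⟨k, hk, hB⟩
  cases k with
  | nil => exact ⟨.nil, by simpa using hk.symm, by simpa using hB.symm⟩
  | cons k e =>
    have he : (⟨_, _, e⟩ : Edge V) ∈ edges Q₁ := by rw [hk]; simp [edges_comp, edges]
    rcases comp_eq_comp hB with ⟨l, hl, -⟩ | ⟨l, hl, -⟩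
    · obtain ⟨x, f, Q, rfl, -⟩ := (Path.length_ne_zero_iff_eq_comp _).1 h₂
      exact (hd ⟨_, _, f⟩ (by rw [hk, hl]; simp [edges_comp, edges, Hom.toPath])
        (by simp [edges_comp, edges, Hom.toPath])).elim
    · exact (hd _ he (by rw [hl]; simp [edges_comp, edges])).elim

end Paths

/-- Boundary data of a plane directed graph drawn in an ambient directed graph `V`: a source `s`,
a sink `t`, the upper and lower boundaries `p` and `q` of the whole graph, and for each bounded
face `F` a source, a sink, an upper boundary `σ F` and a lower boundary `τ F`.  The vertices and
edges of the plane graph are those lying on these paths. -/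
structure PlaneData (V : Type u) [Quiver.{v} V] where
  s : V
  t : V
  p : Quiver.Path s t
  q : Quiver.Path s t
  Face : Type w
  [fintypeFace : Fintype Face]
  fs : Face → V
  ft : Face → V
  σ : ∀ F, Quiver.Path (fs F) (ft F)
  τ : ∀ F, Quiver.Path (fs F) (ft F)

attribute [instance] PlaneData.fintypeFace

namespace PlaneData

variable {V : Type u} [Quiver.{v} V] (𝒟 : PlaneData.{v, u, w} V)

open Classical in
/-- The number of regions lying directly above `e` (inner faces, and the outer face along `p`). -/
noncomputable def edgeAbove (e : Edge V) : ℕ :=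
  (edges 𝒟.p).count e + ∑ F, (edges (𝒟.τ F)).count e

open Classical in
/-- The number of regions lying directly below `e` (inner faces, and the outer face along `q`). -/
noncomputable def edgeBelow (e : Edge V) : ℕ :=
  (edges 𝒟.q).count e + ∑ F, (edges (𝒟.σ F)).count e

open Classical in
/-- The number of regions above `x`, i.e. having `x` in the interior of their lower boundary. -/
noncomputable def vertexAbove (x : V) : ℕ :=
  (innerVertices 𝒟.p).count x + ∑ F, (innerVertices (𝒟.τ F)).count x

open Classical in
/-- The number of regions below `x`, i.e. having `x` in the interior of their upper boundary. -/
noncomputable def vertexBelow (x : V) : ℕ :=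
  (innerVertices 𝒟.q).count x + ∑ F, (innerVertices (𝒟.σ F)).count x

/-- `F ⊲ G`: the lower boundary of `F` and the upper boundary of `G` share an edge. -/
def Before (F G : 𝒟.Face) : Prop := ∃ e, e ∈ edges (𝒟.τ F) ∧ e ∈ edges (𝒟.σ G)

end PlaneData

/-- A (two-dimensional) pasting scheme: a plane acyclic directed graph with a source and a sink, in
which every edge has exactly one region on each side, every vertex other than the source and
the sink has exactly one region above and one region below it, and `⊲` has no cycles. -/
structure PastingScheme (V : Type u) [Quiver.{v} V] extends PlaneData.{v, u, w} V where
  acyclic : Acyclic V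
  s_ne_t : s ≠ t
  fs_ne_ft : ∀ F, fs F ≠ ft F
  edge_balanced : ∀ e, toPlaneData.edgeAbove e = toPlaneData.edgeBelow e
  edge_le_one : ∀ e, toPlaneData.edgeAbove e ≤ 1
  vertex_balanced : ∀ x, toPlaneData.vertexAbove x = toPlaneData.vertexBelow x
  vertex_le_one : ∀ x, toPlaneData.vertexAbove x ≤ 1
  before_acyclic : ∀ F, ¬ Relation.TransGen toPlaneData.Before F F

namespace PastingScheme

variable {V : Type u} [Quiver.{v} V] (𝒢 : PastingScheme.{v, u, w} V)

/-- The objects of `𝒞_𝒢`: lists of all the faces, each occurring once, compatible with `⊲`. -/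
structure LinearExtension where
  list : List 𝒢.Face
  nodup : list.Nodup
  mem : ∀ F, F ∈ list
  pairwise : list.Pairwise fun F G => ¬ 𝒢.Before G F

/-- `P'` is obtained from `P` by pushing it down across the face `F`. -/
def Step (F : 𝒢.Face) (P P' : Quiver.Path 𝒢.s 𝒢.t) : Prop :=
  ∃ (A : Quiver.Path 𝒢.s (𝒢.fs F)) (B : Quiver.Path (𝒢.ft F) 𝒢.t),
    P = A.comp ((𝒢.σ F).comp B) ∧ P' = A.comp ((𝒢.τ F).comp B)

/-- A way of moving a path down to `q` by crossing one face at a time. -/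
inductive Order : Quiver.Path 𝒢.s 𝒢.t → Type (max u v w)
  | nil : Order 𝒢.q
  | cons (F : 𝒢.Face) {P P' : Quiver.Path 𝒢.s 𝒢.t} (h : 𝒢.Step F P P') (d : Order P') : Order P

/-- The faces crossed, in order. -/
def Order.list : {P : Quiver.Path 𝒢.s 𝒢.t} → 𝒢.Order P → List 𝒢.Face
  | _, .nil => []
  | _, .cons F _ d => F :: d.list

variable {𝒢}

theorem σ_length (F : 𝒢.Face) : (𝒢.σ F).length ≠ 0 := fun h =>
  𝒢.fs_ne_ft F (Quiver.Path.eq_of_length_zero _ h)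

theorem τ_length (F : 𝒢.Face) : (𝒢.τ F).length ≠ 0 := fun h =>
  𝒢.fs_ne_ft F (Quiver.Path.eq_of_length_zero _ h)

theorem σ_disjoint {F G : 𝒢.Face} {e : Edge V} (hF : e ∈ edges (𝒢.σ F)) (hG : e ∈ edges (𝒢.σ G)) :
    F = G := by
  classical
  by_contra hne
  have h := 𝒢.edge_le_one e
  rw [𝒢.edge_balanced, PlaneData.edgeBelow] at h
  have h2 := Finset.sum_le_univ_sum_of_nonneg (s := {F, G})
    (f := fun F => (edges (𝒢.σ F)).count e) (fun _ => Nat.zero_le _)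
  rw [Finset.sum_pair hne] at h2
  have := List.count_pos_iff.2 hF
  have := List.count_pos_iff.2 hG
  omega

theorem τ_disjoint {F G : 𝒢.Face} {e : Edge V} (hF : e ∈ edges (𝒢.τ F)) (hG : e ∈ edges (𝒢.τ G)) :
    F = G := by
  classical
  by_contra hne
  have h := 𝒢.edge_le_one e
  rw [PlaneData.edgeAbove] at h
  have h2 := Finset.sum_le_univ_sum_of_nonneg (s := {F, G})
    (f := fun F => (edges (𝒢.τ F)).count e) (fun _ => Nat.zero_le _)
  rw [Finset.sum_pair hne] at h2
  have := List.count_pos_iff.2 hF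
  have := List.count_pos_iff.2 hG
  omega

theorem step_unique {F : 𝒢.Face} {P P₁ P₂ : Quiver.Path 𝒢.s 𝒢.t} (h₁ : 𝒢.Step F P P₁)
    (h₂ : 𝒢.Step F P P₂) : P₁ = P₂ := by
  obtain ⟨A, B, rfl, rfl⟩ := h₁
  obtain ⟨A', B', h, rfl⟩ := h₂
  obtain ⟨rfl, h'⟩ := comp_cancel 𝒢.acyclic h
  obtain ⟨_, rfl⟩ := comp_cancel 𝒢.acyclic h'
  rfl

/-- Along `P` the upper boundary of `F` comes before that of `G`. -/
def Left (F G : 𝒢.Face) (P : Quiver.Path 𝒢.s 𝒢.t) : Prop :=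
  ∃ (A : Quiver.Path 𝒢.s (𝒢.fs F)) (B : Quiver.Path (𝒢.ft F) (𝒢.fs G))
    (C : Quiver.Path (𝒢.ft G) 𝒢.t), P = A.comp ((𝒢.σ F).comp (B.comp ((𝒢.σ G).comp C)))

theorem left_or_left {F G : 𝒢.Face} (hFG : F ≠ G) {P P₁ P₂ : Quiver.Path 𝒢.s 𝒢.t}
    (h₁ : 𝒢.Step F P P₁) (h₂ : 𝒢.Step G P P₂) : Left F G P ∨ Left G F P := by
  obtain ⟨A, B, hP, -⟩ := h₁
  obtain ⟨A', B', hP', -⟩ := h₂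
  rcases comp_eq_comp (hP.symm.trans hP') with ⟨m, hm, h⟩ | ⟨m, hm, h⟩
  · obtain ⟨k, rfl, rfl⟩ := eq_comp_of_disjoint (σ_length F) (σ_length G)
      (fun e h h' => hFG (σ_disjoint h h')) h
    exact .inl ⟨A, k, B', hP⟩
  · obtain ⟨k, rfl, rfl⟩ := eq_comp_of_disjoint (σ_length G) (σ_length F)
      (fun e h h' => hFG (σ_disjoint h' h)) h
    exact .inr ⟨A', k, B, hP'⟩

theorem not_left_left {F G : 𝒢.Face} {P : Quiver.Path 𝒢.s 𝒢.t} (h₁ : Left F G P)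
    (h₂ : Left G F P) : False := by
  obtain ⟨-, B, -, -⟩ := h₁
  obtain ⟨-, B', -, -⟩ := h₂
  have := 𝒢.acyclic _ ((𝒢.σ F).comp (B.comp ((𝒢.σ G).comp B')))
  have h := congrArg Quiver.Path.length this
  have := σ_length F
  simp at h
  omega

theorem Left.trans {F G H : 𝒢.Face} {P : Quiver.Path 𝒢.s 𝒢.t} (h₁ : Left F G P)
    (h₂ : Left G H P) :
    ∃ (A : Quiver.Path 𝒢.s (𝒢.fs F)) (B : Quiver.Path (𝒢.ft F) (𝒢.fs G))
    (C : Quiver.Path (𝒢.ft G) (𝒢.fs H)) (D : Quiver.Path (𝒢.ft H) 𝒢.t),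
      P = A.comp ((𝒢.σ F).comp (B.comp ((𝒢.σ G).comp (C.comp ((𝒢.σ H).comp D))))) := by
  obtain ⟨A, B, R, rfl⟩ := h₁
  obtain ⟨A', C, D, h⟩ := h₂
  have h' : (A.comp ((𝒢.σ F).comp B)).comp ((𝒢.σ G).comp R) =
    A'.comp ((𝒢.σ G).comp (C.comp ((𝒢.σ H).comp D))) := by simpa using h
  obtain ⟨rfl, h''⟩ := comp_cancel 𝒢.acyclic h'
  obtain ⟨_, rfl⟩ := comp_cancel 𝒢.acyclic h''
  exact ⟨A, B, C, D, rfl⟩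

theorem square {F G : 𝒢.Face} (hFG : F ≠ G) {P P₁ P₂ : Quiver.Path 𝒢.s 𝒢.t}
    (h₁ : 𝒢.Step F P P₁) (h₂ : 𝒢.Step G P P₂) : ∃ W, 𝒢.Step G P₁ W ∧ 𝒢.Step F P₂ W := by
  have key : ∀ {F G : 𝒢.Face} {P P₁ P₂ : Quiver.Path 𝒢.s 𝒢.t}, 𝒢.Step F P P₁ → 𝒢.Step G P P₂ → Left F G P →
      ∃ W, 𝒢.Step G P₁ W ∧ 𝒢.Step F P₂ W := by
    rintro F G P P₁ P₂ h₁ h₂ ⟨A, B, C, rfl⟩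
    obtain rfl := step_unique h₁ ⟨A, B.comp ((𝒢.σ G).comp C), rfl, rfl⟩
    obtain rfl := step_unique h₂ ⟨A.comp ((𝒢.σ F).comp B), C, by simp, rfl⟩
    exact ⟨A.comp ((𝒢.τ F).comp (B.comp ((𝒢.τ G).comp C))),
      ⟨A.comp ((𝒢.τ F).comp B), C, by simp, by simp⟩,
      ⟨A, B.comp ((𝒢.τ G).comp C), by simp, by simp⟩⟩
  rcases left_or_left hFG h₁ h₂ with h | h
  · exact key h₁ h₂ h
  · obtain ⟨W, hW, hW'⟩ := key h₂ h₁ h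
    exact ⟨W, hW', hW⟩

theorem exists_order (X : 𝒢.LinearExtension) : ∃ d : 𝒢.Order 𝒢.p, d.list = X.list := by
  classical
  have key : ∀ (rest done : List 𝒢.Face) (P : Quiver.Path 𝒢.s 𝒢.t), done ++ rest = X.list →
      (∀ e, (edges P).count e + (done.map fun F => (edges (𝒢.σ F)).count e).sum =
        (edges 𝒢.p).count e + (done.map fun F => (edges (𝒢.τ F)).count e).sum) →
      ∃ d : 𝒢.Order P, d.list = rest := by
    intro rest
    induction rest with
    | nil =>
      intro done P hdone hP
      have hq : ∀ e, (edges P).count e = (edges 𝒢.q).count e := by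
        intro e
        have h₁ := hP e
        have h₂ := 𝒢.edge_balanced e
        have hX : X.list.toFinset = Finset.univ := by
          ext F; simp [X.mem]
        rw [List.append_nil] at hdone
        simp only [PlaneData.edgeAbove, PlaneData.edgeBelow, ← hX,
          List.sum_toFinset _ X.nodup] at h₂
        rw [hdone] at h₁
        omega
      obtain ⟨A, B, h⟩ := exists_comp_of_subset 𝒢.acyclic P 𝒢.q
        (fun h => 𝒢.s_ne_t (Quiver.Path.eq_of_length_zero _ h))
        (fun e he => List.count_pos_iff.1 (by rw [hq]; exact List.count_pos_iff.2 he))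
      obtain rfl := 𝒢.acyclic _ A
      obtain rfl := 𝒢.acyclic _ B
      obtain rfl : P = 𝒢.q := by simpa using h
      exact ⟨.nil, rfl⟩
    | cons F rest ih =>
      intro done P hdone hP
      have hnd : (done ++ F :: rest).Nodup := hdone ▸ X.nodup
      have hFd : F ∉ done := fun h => by
        have := List.disjoint_of_nodup_append hnd h; simp at this
      have hσ : ∀ e ∈ edges (𝒢.σ F), e ∈ edges P := by
        intro e he
        by_contra heP
        have h₀ : (done.map fun F => (edges (𝒢.σ F)).count e).sum = 0 := by
          simp only [List.sum_eq_zero_iff, List.mem_map, forall_exists_index, and_imp]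
          rintro _ H hH rfl
          refine List.count_eq_zero.2 fun h => ?_
          obtain rfl := σ_disjoint he h
          exact hFd hH
        have h₁ := hP e
        rw [h₀, List.count_eq_zero.2 heP] at h₁
        have h₂ : 1 ≤ 𝒢.edgeAbove e := by
          rw [𝒢.edge_balanced, PlaneData.edgeBelow]
          have := Finset.single_le_sum (f := fun F => (edges (𝒢.σ F)).count e)
            (fun _ _ => Nat.zero_le _) (Finset.mem_univ F)
          have := List.count_pos_iff.2 he
          omega
        have h₃ : ∑ F, (edges (𝒢.τ F)).count e ≠ 0 := by
          rw [PlaneData.edgeAbove] at h₂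
          omega
        obtain ⟨H, -, hH⟩ := Finset.exists_ne_zero_of_sum_ne_zero h₃
        have hHe : e ∈ edges (𝒢.τ H) := List.count_pos_iff.1 (Nat.pos_of_ne_zero hH)
        have hHF : 𝒢.Before H F := ⟨e, hHe, he⟩
        have hHX : H ∈ done ++ F :: rest := hdone ▸ X.mem H
        have hpw : (done ++ F :: rest).Pairwise fun F G => ¬ 𝒢.Before G F := hdone ▸ X.pairwise
        rw [List.mem_append, List.mem_cons] at hHX
        rcases hHX with hHX | rfl | hHX
        · refine hH ?_
          have h₄ : (done.map fun F => (edges (𝒢.τ F)).count e).sum = 0 := by omega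
          rw [List.sum_eq_zero_iff] at h₄
          exact h₄ _ (List.mem_map.2 ⟨H, hHX, rfl⟩)
        · exact 𝒢.before_acyclic _ (.single hHF)
        · exact (List.pairwise_cons.1 (List.pairwise_append.1 hpw).2.1).1 H hHX hHF
      obtain ⟨A, B, rfl⟩ := exists_comp_of_subset 𝒢.acyclic P (𝒢.σ F) (σ_length F) hσ
      obtain ⟨d, hd⟩ := ih (done ++ [F]) (A.comp ((𝒢.τ F).comp B)) (by simpa using hdone) (by
        intro e
        have := hP e
        simp only [edges_comp, List.count_append, List.map_append, List.map_cons, List.map_nil,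
          List.sum_append, List.sum_cons, List.sum_nil] at this ⊢
        omega)
      exact ⟨.cons F ⟨A, B, rfl, rfl⟩ d, by simp [Order.list, hd]⟩
  obtain ⟨d, hd⟩ := key X.list [] 𝒢.p rfl (by simp)
  exact ⟨d, hd⟩

end PastingScheme
end GrayPasting

namespace GrayPasting
universe w₃ w₂ v u u' v' w
open GrayCategory

section Along
variable {V : Type u} [Quiver.{v} V] {K : Type u'} [GrayCategory.{w₃, w₂, v'} K]

/-- The composite of the labels of the edges of a path. -/
def along (D : V ⥤q K) {a b : V} (P : Quiver.Path a b) : D.obj a ⟶ D.obj b :=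
  composePath (D.mapPath P)

theorem along_comp (D : V ⥤q K) {a b c : V} (P : Quiver.Path a b) (Q : Quiver.Path b c) :
    along D (P.comp Q) = along D P ≫ along D Q := by
  simp [along, composePath_comp]

end Along

variable {V : Type u} [Quiver.{v} V] (𝒢 : PastingScheme.{v, u, w} V)

/-- A labelling in a Gray-category: objects, 1-cells and 2-cells for vertices, edges and faces. -/
structure Labelling (K : Type u') [GrayCategory.{w₃, w₂, v'} K] where
  diagram : V ⥤q K
  cell : ∀ F : 𝒢.Face, along diagram (𝒢.σ F) ⟶ along diagram (𝒢.τ F)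

namespace Labelling

open PastingScheme Quiver

variable {𝒢} {K : Type u'} [GrayCategory.{w₃, w₂, v'} K] (𝓛 : Labelling 𝒢 K)

/-- The whiskered label of a face. -/
noncomputable def stepCell {F : 𝒢.Face} {P P' : Quiver.Path 𝒢.s 𝒢.t} (h : 𝒢.Step F P P') :
    along 𝓛.diagram P ⟶ along 𝓛.diagram P' :=
  plug (along 𝓛.diagram h.choose) (𝓛.cell F) (along 𝓛.diagram h.choose_spec.choose)
    (by rw [← along_comp, ← along_comp, ← h.choose_spec.choose_spec.1])
    (by rw [← along_comp, ← along_comp, ← h.choose_spec.choose_spec.2])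

theorem stepCell_eq {F : 𝒢.Face} {P P' : Quiver.Path 𝒢.s 𝒢.t} (h : 𝒢.Step F P P')
    (A : Quiver.Path 𝒢.s (𝒢.fs F)) (B : Quiver.Path (𝒢.ft F) 𝒢.t) (hP : P = A.comp ((𝒢.σ F).comp B))
    {x : 𝓛.diagram.obj 𝒢.s ⟶ 𝓛.diagram.obj (𝒢.fs F)}
    {y : 𝓛.diagram.obj (𝒢.ft F) ⟶ 𝓛.diagram.obj 𝒢.t}
    (hx : along 𝓛.diagram A = x) (hy : along 𝓛.diagram B = y)
    (e₁ : along 𝓛.diagram P = x ≫ along 𝓛.diagram (𝒢.σ F) ≫ y)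
    (e₂ : along 𝓛.diagram P' = x ≫ along 𝓛.diagram (𝒢.τ F) ≫ y) :
    𝓛.stepCell h = plug x (𝓛.cell F) y e₁ e₂ := by
  have h₁ := h.choose_spec.choose_spec.1
  obtain ⟨h₂, h₃⟩ := comp_cancel 𝒢.acyclic (h₁.symm.trans hP)
  obtain ⟨-, h₄⟩ := comp_cancel 𝒢.acyclic h₃
  subst hx hy h₂
  subst h₄
  rfl

variable {F G H : 𝒢.Face} {P PF PG W : Quiver.Path 𝒢.s 𝒢.t}

theorem left_states (hF : 𝒢.Step F P PF) (hFG : 𝒢.Step G PF W) (hG : 𝒢.Step G P PG)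
    {A : Quiver.Path 𝒢.s (𝒢.fs F)} {B : Quiver.Path (𝒢.ft F) (𝒢.fs G)}
    {C : Quiver.Path (𝒢.ft G) 𝒢.t} (hP : P = A.comp ((𝒢.σ F).comp (B.comp ((𝒢.σ G).comp C)))) :
    PF = A.comp ((𝒢.τ F).comp (B.comp ((𝒢.σ G).comp C))) ∧
    PG = A.comp ((𝒢.σ F).comp (B.comp ((𝒢.τ G).comp C))) ∧
    W = A.comp ((𝒢.τ F).comp (B.comp ((𝒢.τ G).comp C))) := by
  subst hP
  obtain rfl := step_unique hF ⟨A, _, rfl, rfl⟩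
  obtain rfl := step_unique hG ⟨A.comp ((𝒢.σ F).comp B), C, by simp, rfl⟩
  obtain rfl := step_unique hFG ⟨A.comp ((𝒢.τ F).comp B), C, by simp, rfl⟩
  simp

/-- The interchanger of two faces `F` and `G`, with `F` to the left of `G`. -/
noncomputable def leftSwapOf (hF : 𝒢.Step F P PF) (hFG : 𝒢.Step G PF W) (hG : 𝒢.Step G P PG)
    (hGF : 𝒢.Step F PG W)
    (A : Quiver.Path 𝒢.s (𝒢.fs F)) (B : Quiver.Path (𝒢.ft F) (𝒢.fs G))
    (C : Quiver.Path (𝒢.ft G) 𝒢.t) (hP : P = A.comp ((𝒢.σ F).comp (B.comp ((𝒢.σ G).comp C)))) :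
    𝓛.stepCell hF ≫ 𝓛.stepCell hFG ≅ 𝓛.stepCell hG ≫ 𝓛.stepCell hGF :=
  have h := left_states hF hFG hG hP
  eqToIso (congrArg₂ (· ≫ ·)
    (𝓛.stepCell_eq hF A (B.comp ((𝒢.σ G).comp C)) (by rw [hP]) rfl (by simp only [along_comp])
      (by rw [hP]; simp only [along_comp]) (by rw [h.1]; simp only [along_comp]))
    (𝓛.stepCell_eq hFG (A.comp ((𝒢.τ F).comp B)) C (by rw [h.1]; simp)
      (by simp only [along_comp]) rfl
      (by rw [h.1]; simp [along_comp]) (by rw [h.2.2]; simp [along_comp]))) ≪≫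
  swapIso (along 𝓛.diagram A) (𝓛.cell F) (along 𝓛.diagram B) (𝓛.cell G) (along 𝓛.diagram C)
    _ _ _ _ (by rw [hP]; simp [along_comp]) (by rw [h.2.1]; simp [along_comp])
    (by rw [h.2.1]; simp [along_comp]) (by rw [h.2.2]; simp [along_comp]) ≪≫
  eqToIso (congrArg₂ (· ≫ ·)
    (𝓛.stepCell_eq hG (A.comp ((𝒢.σ F).comp B)) C (by rw [hP]; simp)
      (by simp only [along_comp]) rfl _ _)
    (𝓛.stepCell_eq hGF A (B.comp ((𝒢.τ G).comp C)) (by rw [h.2.1]) rfl (by simp only [along_comp])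
      _ _)).symm

theorem leftSwapOf_heq (hF : 𝒢.Step F P PF) (hFG : 𝒢.Step G PF W) (hG : 𝒢.Step G P PG)
    (hGF : 𝒢.Step F PG W)
    (A : Quiver.Path 𝒢.s (𝒢.fs F)) (B : Quiver.Path (𝒢.ft F) (𝒢.fs G))
    (C : Quiver.Path (𝒢.ft G) 𝒢.t) (hP : P = A.comp ((𝒢.σ F).comp (B.comp ((𝒢.σ G).comp C)))) :
    (𝓛.leftSwapOf hF hFG hG hGF A B C hP).hom ≍
      wL₂ (along 𝓛.diagram A) (γ (𝓛.cell F)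
        (wL (along 𝓛.diagram B) (wR (𝓛.cell G) (along 𝓛.diagram C)))).hom := by
  simp only [leftSwapOf, Iso.trans_hom, eqToIso.hom]
  refine (eqToHom_comp_heq _ _).trans ((comp_eqToHom_heq _ _).trans ?_)
  apply swapIso_heq

theorem leftSwapOf_eq (hF : 𝒢.Step F P PF) (hFG : 𝒢.Step G PF W) (hG : 𝒢.Step G P PG)
    (hGF : 𝒢.Step F PG W)
    (A A' : Quiver.Path 𝒢.s (𝒢.fs F)) (B B' : Quiver.Path (𝒢.ft F) (𝒢.fs G))
    (C C' : Quiver.Path (𝒢.ft G) 𝒢.t) (hP : P = A.comp ((𝒢.σ F).comp (B.comp ((𝒢.σ G).comp C))))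
    (hP' : P = A'.comp ((𝒢.σ F).comp (B'.comp ((𝒢.σ G).comp C')))) :
    𝓛.leftSwapOf hF hFG hG hGF A B C hP = 𝓛.leftSwapOf hF hFG hG hGF A' B' C' hP' := by
  obtain ⟨rfl, h₁⟩ := comp_cancel 𝒢.acyclic (hP.symm.trans hP')
  obtain ⟨-, h₂⟩ := comp_cancel 𝒢.acyclic h₁
  obtain ⟨rfl, h₃⟩ := comp_cancel 𝒢.acyclic h₂
  obtain ⟨-, rfl⟩ := comp_cancel 𝒢.acyclic h₃
  rfl

open Classical in
/-- The interchanger (or its inverse) exchanging two consecutive faces. -/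
noncomputable def swap (hne : F ≠ G) (hF : 𝒢.Step F P PF) (hFG : 𝒢.Step G PF W)
    (hG : 𝒢.Step G P PG) (hGF : 𝒢.Step F PG W) :
    𝓛.stepCell hF ≫ 𝓛.stepCell hFG ≅ 𝓛.stepCell hG ≫ 𝓛.stepCell hGF :=
  if h : Left F G P then
    𝓛.leftSwapOf hF hFG hG hGF h.choose h.choose_spec.choose h.choose_spec.choose_spec.choose
      h.choose_spec.choose_spec.choose_spec
  else
    have h := (left_or_left hne hF hG).resolve_left h
    (𝓛.leftSwapOf hG hGF hF hFG h.choose h.choose_spec.choose h.choose_spec.choose_spec.choose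
      h.choose_spec.choose_spec.choose_spec).symm

theorem swap_of_left (hne : F ≠ G) (hF : 𝒢.Step F P PF) (hFG : 𝒢.Step G PF W)
    (hG : 𝒢.Step G P PG) (hGF : 𝒢.Step F PG W)
    (A : Quiver.Path 𝒢.s (𝒢.fs F)) (B : Quiver.Path (𝒢.ft F) (𝒢.fs G))
    (C : Quiver.Path (𝒢.ft G) 𝒢.t) (hP : P = A.comp ((𝒢.σ F).comp (B.comp ((𝒢.σ G).comp C)))) :
    𝓛.swap hne hF hFG hG hGF = 𝓛.leftSwapOf hF hFG hG hGF A B C hP := by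
  rw [swap, dif_pos ⟨A, B, C, hP⟩]
  apply leftSwapOf_eq

theorem swap_symm (hne : F ≠ G) (hF : 𝒢.Step F P PF) (hFG : 𝒢.Step G PF W)
    (hG : 𝒢.Step G P PG) (hGF : 𝒢.Step F PG W) :
    𝓛.swap hne.symm hG hGF hF hFG = (𝓛.swap hne hF hFG hG hGF).symm := by
  by_cases h : Left F G P
  · rw [swap, dif_neg (not_left_left h), swap, dif_pos h]
  · have h' := (left_or_left hne hF hG).resolve_left h
    rw [swap, dif_pos h', swap, dif_neg h]
    rfl

variable {PH PFG PFH PGH : Quiver.Path 𝒢.s 𝒢.t}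

/-- The two ways to reverse three consecutive faces agree. -/
def YB (hFG : F ≠ G) (hFH : F ≠ H) (hGH : G ≠ H)
    (f : 𝒢.Step F P PF) (g : 𝒢.Step G P PG) (h : 𝒢.Step H P PH)
    (fg : 𝒢.Step G PF PFG) (gf : 𝒢.Step F PG PFG) (fh : 𝒢.Step H PF PFH) (hf : 𝒢.Step F PH PFH)
    (gh : 𝒢.Step H PG PGH) (hg : 𝒢.Step G PH PGH)
    (fgh : 𝒢.Step H PFG W) (fhg : 𝒢.Step G PFH W) (ghf : 𝒢.Step F PGH W) : Prop :=
  (𝓛.swap hFG f fg g gf).hom ▷ 𝓛.stepCell fgh ≫ (α_ _ _ _).hom ≫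
    𝓛.stepCell g ◁ (𝓛.swap hFH gf fgh gh ghf).hom ≫ (α_ _ _ _).inv ≫
      (𝓛.swap hGH g gh h hg).hom ▷ 𝓛.stepCell ghf =
  (α_ _ _ _).hom ≫ 𝓛.stepCell f ◁ (𝓛.swap hGH fg fgh fh fhg).hom ≫ (α_ _ _ _).inv ≫
    (𝓛.swap hFH f fh h hf).hom ▷ 𝓛.stepCell fhg ≫ (α_ _ _ _).hom ≫
      𝓛.stepCell h ◁ (𝓛.swap hFG hf fhg hg ghf).hom ≫ (α_ _ _ _).inv

theorem yb_swap_left (hFG : F ≠ G) (hFH : F ≠ H) (hGH : G ≠ H)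
    (f : 𝒢.Step F P PF) (g : 𝒢.Step G P PG) (h : 𝒢.Step H P PH)
    (fg : 𝒢.Step G PF PFG) (gf : 𝒢.Step F PG PFG) (fh : 𝒢.Step H PF PFH) (hf : 𝒢.Step F PH PFH)
    (gh : 𝒢.Step H PG PGH) (hg : 𝒢.Step G PH PGH)
    (fgh : 𝒢.Step H PFG W) (fhg : 𝒢.Step G PFH W) (ghf : 𝒢.Step F PGH W)
    (yb : 𝓛.YB hFG hFH hGH f g h fg gf fh hf gh hg fgh fhg ghf) :
    𝓛.YB hFG.symm hGH hFH g f h gf fg gh hg fh hf fgh ghf fhg := by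
  unfold YB at *
  rw [swap_symm 𝓛 hFG f, swap_symm 𝓛 hFG hf]
  simp only [Iso.symm_hom]
  rw [← cancel_epi ((𝓛.swap hFG f fg g gf).hom ▷ 𝓛.stepCell fgh)]
  rw [hom_inv_whiskerRight_assoc]
  rw [← cancel_mono ((α_ _ _ _).hom ≫ 𝓛.stepCell h ◁ (𝓛.swap hFG hf fhg hg ghf).hom)]
  simp only [Category.assoc, Iso.inv_hom_id_assoc, whiskerLeft_inv_hom, Category.comp_id]
  rw [← cancel_mono (α_ _ _ _).inv]
  simp only [Category.assoc]
  rw [← yb]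
  simp

theorem yb_swap_right (hFG : F ≠ G) (hFH : F ≠ H) (hGH : G ≠ H)
    (f : 𝒢.Step F P PF) (g : 𝒢.Step G P PG) (h : 𝒢.Step H P PH)
    (fg : 𝒢.Step G PF PFG) (gf : 𝒢.Step F PG PFG) (fh : 𝒢.Step H PF PFH) (hf : 𝒢.Step F PH PFH)
    (gh : 𝒢.Step H PG PGH) (hg : 𝒢.Step G PH PGH)
    (fgh : 𝒢.Step H PFG W) (fhg : 𝒢.Step G PFH W) (ghf : 𝒢.Step F PGH W)
    (yb : 𝓛.YB hFG hFH hGH f g h fg gf fh hf gh hg fgh fhg ghf) :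
    𝓛.YB hFH hFG hGH.symm f h g fh hf fg gf hg gh fhg fgh ghf := by
  unfold YB at *
  rw [swap_symm 𝓛 hGH g, swap_symm 𝓛 hGH fg]
  simp only [Iso.symm_hom]
  rw [← cancel_epi (𝓛.stepCell f ◁ (𝓛.swap hGH fg fgh fh fhg).hom ≫ (α_ _ _ _).inv),
    ← cancel_epi (α_ _ _ _).hom]
  rw [← cancel_mono ((𝓛.swap hGH g gh h hg).hom ▷ 𝓛.stepCell ghf)]
  simp only [Category.assoc, Iso.inv_hom_id_assoc, whiskerLeft_hom_inv_assoc, inv_hom_whiskerRight,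
    Category.comp_id]
  rw [Iso.hom_inv_id_assoc]
  exact yb.symm

end Labelling
end GrayPasting

namespace GrayPasting
universe w₃ w₂ v u u' v' w
open GrayCategory
namespace Labelling

open PastingScheme Quiver
variable {V : Type u} [Quiver.{v} V] {𝒢 : PastingScheme.{v, u, w} V}
variable {K : Type u'} [GrayCategory.{w₃, w₂, v'} K] (𝓛 : Labelling 𝒢 K)
variable {F G H : 𝒢.Face} {P PF PG W PH PFG PFH PGH : Quiver.Path 𝒢.s 𝒢.t}

theorem stepCell_heq {F : 𝒢.Face} {P P' : Quiver.Path 𝒢.s 𝒢.t} (h : 𝒢.Step F P P')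
    (A : Quiver.Path 𝒢.s (𝒢.fs F)) (B : Quiver.Path (𝒢.ft F) 𝒢.t) (hP : P = A.comp ((𝒢.σ F).comp B))
    {x : 𝓛.diagram.obj 𝒢.s ⟶ 𝓛.diagram.obj (𝒢.fs F)}
    {y : 𝓛.diagram.obj (𝒢.ft F) ⟶ 𝓛.diagram.obj 𝒢.t}
    (hx : along 𝓛.diagram A = x) (hy : along 𝓛.diagram B = y) :
    𝓛.stepCell h ≍ wL x (wR (𝓛.cell F) y) := by
  have hP' := step_unique h ⟨A, B, hP, rfl⟩
  rw [𝓛.stepCell_eq h A B hP hx hy (by rw [hP, along_comp, along_comp, hx, hy])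
    (by rw [hP', along_comp, along_comp, hx, hy])]
  apply plug_heq

theorem swap_heq (hne : F ≠ G) (hF : 𝒢.Step F P PF) (hFG : 𝒢.Step G PF W)
    (hG : 𝒢.Step G P PG) (hGF : 𝒢.Step F PG W)
    (A : Quiver.Path 𝒢.s (𝒢.fs F)) (B : Quiver.Path (𝒢.ft F) (𝒢.fs G))
    (C : Quiver.Path (𝒢.ft G) 𝒢.t) (hP : P = A.comp ((𝒢.σ F).comp (B.comp ((𝒢.σ G).comp C))))
    {x : 𝓛.diagram.obj 𝒢.s ⟶ 𝓛.diagram.obj (𝒢.fs F)}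
    {y : 𝓛.diagram.obj (𝒢.ft F) ⟶ 𝓛.diagram.obj (𝒢.fs G)}
    {z : 𝓛.diagram.obj (𝒢.ft G) ⟶ 𝓛.diagram.obj 𝒢.t}
    (hx : along 𝓛.diagram A = x) (hy : along 𝓛.diagram B = y) (hz : along 𝓛.diagram C = z) :
    (𝓛.swap hne hF hFG hG hGF).hom ≍
      wL₂ x (γ (𝓛.cell F) (wL y (wR (𝓛.cell G) z))).hom := by
  subst hx hy hz
  rw [swap_of_left 𝓛 hne hF hFG hG hGF A B C hP]
  apply leftSwapOf_heq

theorem yb_of_left (hFG : F ≠ G) (hFH : F ≠ H) (hGH : G ≠ H)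
    (f : 𝒢.Step F P PF) (g : 𝒢.Step G P PG) (h : 𝒢.Step H P PH)
    (fg : 𝒢.Step G PF PFG) (gf : 𝒢.Step F PG PFG) (fh : 𝒢.Step H PF PFH) (hf : 𝒢.Step F PH PFH)
    (gh : 𝒢.Step H PG PGH) (hg : 𝒢.Step G PH PGH)
    (fgh : 𝒢.Step H PFG W) (fhg : 𝒢.Step G PFH W) (ghf : 𝒢.Step F PGH W)
    (A : Quiver.Path 𝒢.s (𝒢.fs F)) (B : Quiver.Path (𝒢.ft F) (𝒢.fs G))
    (C : Quiver.Path (𝒢.ft G) (𝒢.fs H)) (D : Quiver.Path (𝒢.ft H) 𝒢.t)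
    (hP : P = A.comp ((𝒢.σ F).comp (B.comp ((𝒢.σ G).comp (C.comp ((𝒢.σ H).comp D)))))) :
    𝓛.YB hFG hFH hGH f g h fg gf fh hf gh hg fgh fhg ghf := by
  obtain rfl := step_unique f ⟨A, B.comp ((𝒢.σ G).comp (C.comp ((𝒢.σ H).comp D))), hP, rfl⟩
  obtain rfl := step_unique g ⟨A.comp ((𝒢.σ F).comp B), C.comp ((𝒢.σ H).comp D),
    by simp [hP], rfl⟩
  obtain rfl := step_unique h ⟨A.comp ((𝒢.σ F).comp (B.comp ((𝒢.σ G).comp C))), D,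
    by simp [hP], rfl⟩
  obtain rfl := step_unique fg ⟨A.comp ((𝒢.τ F).comp B), C.comp ((𝒢.σ H).comp D),
    by simp, rfl⟩
  obtain rfl := step_unique fh ⟨A.comp ((𝒢.τ F).comp (B.comp ((𝒢.σ G).comp C))), D,
    by simp, rfl⟩
  obtain rfl := step_unique gh ⟨A.comp ((𝒢.σ F).comp (B.comp ((𝒢.τ G).comp C))), D,
    by simp, rfl⟩
  obtain rfl := step_unique fgh ⟨A.comp ((𝒢.τ F).comp (B.comp ((𝒢.τ G).comp C))), D,
    by simp, rfl⟩
  subst hP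
  unfold YB
  set a := along 𝓛.diagram A with ha
  set b := along 𝓛.diagram B with hb
  set c := along 𝓛.diagram C with hc
  set d := along 𝓛.diagram D with hd
  let δ := wL c (wR (𝓛.cell H) d)
  have e₁ := wL_comp b (wR (𝓛.cell G) (c ≫ along 𝓛.diagram (𝒢.σ H) ≫ d))
    (wL (along 𝓛.diagram (𝒢.τ G)) δ)
  have e₂ := wL_comp b (wL (along 𝓛.diagram (𝒢.σ G)) δ)
    (wR (𝓛.cell G) (c ≫ along 𝓛.diagram (𝒢.τ H) ≫ d))
  let ω := eqToHom e₁.symm ≫ wL₂ b (γ (𝓛.cell G) δ).hom ≫ eqToHom e₂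
  have hω : ω ≍ wL₂ b (γ (𝓛.cell G) δ).hom :=
    (eqToHom_comp_heq _ _).trans (comp_eqToHom_heq _ _)
  have hδ : ∀ r : 𝓛.diagram.obj (𝒢.fs G) ⟶ 𝓛.diagram.obj (𝒢.ft G),
      wL (b ≫ r ≫ c) (wR (𝓛.cell H) d) ≍ wL b (wL r δ) := fun r =>
    (wL_assoc _ _ _).trans (wL_heq _ (by simp) (by simp) (wL_assoc _ _ _))
  refine cube' (a := a ≫ along 𝓛.diagram (𝒢.σ F)) (a' := a ≫ along 𝓛.diagram (𝒢.τ F))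
    (wL a (𝓛.cell F)) _ _ _ _ ω ?_ ?_ ?_ ?_ ?_ ?_ ?_ ?_ ?_ ?_ ?_ ?_ ?_ ?_ ?_ ?_ ?_ ?_ ?_ ?_
      ?_ ?_ ?_ ?_ ?_ ?_
  iterate 8 simp [along_comp, ← ha, ← hb, ← hc, ← hd]
  · exact (𝓛.stepCell_heq _ A (B.comp ((𝒢.σ G).comp (C.comp ((𝒢.σ H).comp D)))) (by simp)
      rfl (by simp only [along_comp, ← hb, ← hc, ← hd])).trans (wM_assoc _ _ _).symm
  · exact (𝓛.stepCell_heq _ A (B.comp ((𝒢.τ G).comp (C.comp ((𝒢.σ H).comp D)))) (by simp)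
      rfl (by simp only [along_comp, ← hb, ← hc, ← hd])).trans (wM_assoc _ _ _).symm
  · exact (𝓛.stepCell_heq _ A (B.comp ((𝒢.σ G).comp (C.comp ((𝒢.τ H).comp D)))) (by simp)
      rfl (by simp only [along_comp, ← hb, ← hc, ← hd])).trans (wM_assoc _ _ _).symm
  · exact (𝓛.stepCell_heq _ A (B.comp ((𝒢.τ G).comp (C.comp ((𝒢.τ H).comp D)))) (by simp)
      rfl (by simp only [along_comp, ← hb, ← hc, ← hd])).trans (wM_assoc _ _ _).symm
  · exact (𝓛.stepCell_heq _ (A.comp ((𝒢.σ F).comp B)) (C.comp ((𝒢.σ H).comp D)) (by simp)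
      (x := (a ≫ along 𝓛.diagram (𝒢.σ F)) ≫ b) (by simp [along_comp, ← ha, ← hb])
      (by simp [along_comp, ← hc, ← hd])).trans (wL_assoc _ _ _)
  · exact (𝓛.stepCell_heq _ (A.comp ((𝒢.τ F).comp B)) (C.comp ((𝒢.σ H).comp D)) (by simp)
      (x := (a ≫ along 𝓛.diagram (𝒢.τ F)) ≫ b) (by simp [along_comp, ← ha, ← hb])
      (by simp [along_comp, ← hc, ← hd])).trans (wL_assoc _ _ _)
  · exact (𝓛.stepCell_heq _ (A.comp ((𝒢.σ F).comp B)) (C.comp ((𝒢.τ H).comp D)) (by simp)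
      (x := (a ≫ along 𝓛.diagram (𝒢.σ F)) ≫ b) (by simp [along_comp, ← ha, ← hb])
      (by simp [along_comp, ← hc, ← hd])).trans (wL_assoc _ _ _)
  · exact (𝓛.stepCell_heq _ (A.comp ((𝒢.τ F).comp B)) (C.comp ((𝒢.τ H).comp D)) (by simp)
      (x := (a ≫ along 𝓛.diagram (𝒢.τ F)) ≫ b) (by simp [along_comp, ← ha, ← hb])
      (by simp [along_comp, ← hc, ← hd])).trans (wL_assoc _ _ _)
  · exact (𝓛.stepCell_heq _ (A.comp ((𝒢.σ F).comp (B.comp ((𝒢.σ G).comp C)))) D (by simp)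
      (x := (a ≫ along 𝓛.diagram (𝒢.σ F)) ≫ (b ≫ along 𝓛.diagram (𝒢.σ G) ≫ c))
      (by simp [along_comp, ← ha, ← hb, ← hc])
      hd.symm).trans ((wL_assoc _ _ _).trans (wL_heq _ (by simp) (by simp) (hδ _)))
  · exact (𝓛.stepCell_heq _ (A.comp ((𝒢.τ F).comp (B.comp ((𝒢.σ G).comp C)))) D (by simp)
      (x := (a ≫ along 𝓛.diagram (𝒢.τ F)) ≫ (b ≫ along 𝓛.diagram (𝒢.σ G) ≫ c))
      (by simp [along_comp, ← ha, ← hb, ← hc])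
      hd.symm).trans ((wL_assoc _ _ _).trans (wL_heq _ (by simp) (by simp) (hδ _)))
  · exact (𝓛.stepCell_heq _ (A.comp ((𝒢.σ F).comp (B.comp ((𝒢.τ G).comp C)))) D (by simp)
      (x := (a ≫ along 𝓛.diagram (𝒢.σ F)) ≫ (b ≫ along 𝓛.diagram (𝒢.τ G) ≫ c))
      (by simp [along_comp, ← ha, ← hb, ← hc])
      hd.symm).trans ((wL_assoc _ _ _).trans (wL_heq _ (by simp) (by simp) (hδ _)))
  · exact (𝓛.stepCell_heq _ (A.comp ((𝒢.τ F).comp (B.comp ((𝒢.τ G).comp C)))) D (by simp)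
      (x := (a ≫ along 𝓛.diagram (𝒢.τ F)) ≫ (b ≫ along 𝓛.diagram (𝒢.τ G) ≫ c))
      (by simp [along_comp, ← ha, ← hb, ← hc])
      hd.symm).trans ((wL_assoc _ _ _).trans (wL_heq _ (by simp) (by simp) (hδ _)))
  · exact (𝓛.swap_heq _ _ _ _ _ A B _ rfl rfl rfl
      (by simp [along_comp, ← hc, ← hd])).trans (γ_assoc_middle _ _ _).symm
  · exact (𝓛.swap_heq _ _ _ _ _ A B (C.comp ((𝒢.τ H).comp D)) (by simp) rfl rfl
      (by simp [along_comp, ← hc, ← hd])).trans (γ_assoc_middle _ _ _).symm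
  · exact (𝓛.swap_heq _ _ _ _ _ A (B.comp ((𝒢.σ G).comp C)) D (by simp) rfl
      (y := b ≫ along 𝓛.diagram (𝒢.σ G) ≫ c)
      (by simp [along_comp, ← hb, ← hc]) rfl).trans ((γ_assoc_middle _ _ _).symm.trans
        (γ_heq _ (by simp [← hd]) (by simp [← hd]) (hδ _)))
  · exact (𝓛.swap_heq _ _ _ _ _ A (B.comp ((𝒢.τ G).comp C)) D (by simp) rfl
      (y := b ≫ along 𝓛.diagram (𝒢.τ G) ≫ c)
      (by simp [along_comp, ← hb, ← hc]) rfl).trans ((γ_assoc_middle _ _ _).symm.trans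
        (γ_heq _ (by simp [← hd]) (by simp [← hd]) (hδ _)))
  · exact (𝓛.swap_heq _ _ _ _ _ (A.comp ((𝒢.σ F).comp B)) C D (by simp)
      (x := (a ≫ along 𝓛.diagram (𝒢.σ F)) ≫ b) (by simp [along_comp, ← ha, ← hb]) rfl rfl).trans
        ((wL₂_assoc _ _ _).trans (wL₂_heq _ rfl rfl (heq_of_eq e₁) (heq_of_eq e₂) hω.symm))
  · exact (𝓛.swap_heq _ _ _ _ _ (A.comp ((𝒢.τ F).comp B)) C D (by simp)
      (x := (a ≫ along 𝓛.diagram (𝒢.τ F)) ≫ b) (by simp [along_comp, ← ha, ← hb]) rfl rfl).trans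
        ((wL₂_assoc _ _ _).trans (wL₂_heq _ rfl rfl (heq_of_eq e₁) (heq_of_eq e₂) hω.symm))

theorem yb (hFG : F ≠ G) (hFH : F ≠ H) (hGH : G ≠ H)
    (f : 𝒢.Step F P PF) (g : 𝒢.Step G P PG) (h : 𝒢.Step H P PH)
    (fg : 𝒢.Step G PF PFG) (gf : 𝒢.Step F PG PFG) (fh : 𝒢.Step H PF PFH) (hf : 𝒢.Step F PH PFH)
    (gh : 𝒢.Step H PG PGH) (hg : 𝒢.Step G PH PGH)
    (fgh : 𝒢.Step H PFG W) (fhg : 𝒢.Step G PFH W) (ghf : 𝒢.Step F PGH W) :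
    𝓛.YB hFG hFH hGH f g h fg gf fh hf gh hg fgh fhg ghf := by
  rcases left_or_left hFG f g with l₁ | l₁ <;> rcases left_or_left hFH f h with l₂ | l₂ <;>
    rcases left_or_left hGH g h with l₃ | l₃
  · obtain ⟨A, B, C, D, hP⟩ := l₁.trans l₃
    exact yb_of_left _ _ _ _ _ _ _ _ _ _ _ _ _ _ _ _ A B C D hP
  · obtain ⟨A, B, C, D, hP⟩ := l₂.trans l₃
    exact (yb_swap_right 𝓛 hFH hFG hGH.symm _ _ _ _ _ _ _ _ _ _ _ _ (yb_of_left 𝓛 hFH hFG hGH.symm _ _ _ _ _ _ _ _ _ _ _ _ A B C D hP))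
  · obtain ⟨A, B, C, D, hP⟩ := l₁.trans l₃
    exact (not_left_left l₂ ⟨A, B.comp ((𝒢.σ G).comp C), D, by simpa using hP⟩).elim
  · obtain ⟨A, B, C, D, hP⟩ := l₂.trans l₁
    exact (yb_swap_right 𝓛 hFH hFG hGH.symm _ _ _ _ _ _ _ _ _ _ _ _ (yb_swap_left 𝓛 hFH.symm hGH.symm hFG _ _ _ _ _ _ _ _ _ _ _ _ (yb_of_left 𝓛 hFH.symm hGH.symm hFG _ _ _ _ _ _ _ _ _ _ _ _ A B C D hP)))
  · obtain ⟨A, B, C, D, hP⟩ := l₁.trans l₂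
    exact (yb_swap_left 𝓛 hFG.symm hGH hFH _ _ _ _ _ _ _ _ _ _ _ _ (yb_of_left 𝓛 hFG.symm hGH hFH _ _ _ _ _ _ _ _ _ _ _ _ A B C D hP))
  · obtain ⟨A, B, C, D, hP⟩ := l₁.trans l₂
    exact (not_left_left l₃ ⟨A, B.comp ((𝒢.σ F).comp C), D, by simpa using hP⟩).elim
  · obtain ⟨A, B, C, D, hP⟩ := l₃.trans l₂
    exact (yb_swap_left 𝓛 hFG.symm hGH hFH _ _ _ _ _ _ _ _ _ _ _ _ (yb_swap_right 𝓛 hGH hFG.symm hFH.symm _ _ _ _ _ _ _ _ _ _ _ _ (yb_of_left 𝓛 hGH hFG.symm hFH.symm _ _ _ _ _ _ _ _ _ _ _ _ A B C D hP)))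
  · obtain ⟨A, B, C, D, hP⟩ := l₃.trans l₁
    exact (yb_swap_left 𝓛 hFG.symm hGH hFH _ _ _ _ _ _ _ _ _ _ _ _ (yb_swap_right 𝓛 hGH hFG.symm hFH.symm _ _ _ _ _ _ _ _ _ _ _ _ (yb_swap_left 𝓛 hGH.symm hFH.symm hFG.symm _ _ _ _ _ _ _ _ _ _ _ _ (yb_of_left 𝓛 hGH.symm hFH.symm hFG.symm _ _ _ _ _ _ _ _ _ _ _ _ A B C D hP))))

end Labelling
end GrayPasting

namespace GrayPasting

theorem yb_whisker {B : Type*} [Bicategory B] {P PF PG PH PFG PFH PGH W T : B}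
    {f : P ⟶ PF} {g : P ⟶ PG} {h : P ⟶ PH} {fg : PF ⟶ PFG} {gf : PG ⟶ PFG} {fh : PF ⟶ PFH}
    {hf : PH ⟶ PFH} {gh : PG ⟶ PGH} {hg : PH ⟶ PGH} {fgh : PFG ⟶ W} {fhg : PFH ⟶ W}
    {ghf : PGH ⟶ W} {r : PFG ⟶ T} {r₀ : W ⟶ T} (β : r ⟶ fgh ≫ r₀)
    (xz : f ≫ fg ⟶ g ≫ gf) (xy : gf ≫ fgh ⟶ gh ≫ ghf) (zy : g ≫ gh ⟶ h ≫ hg)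
    (zy' : fg ≫ fgh ⟶ fh ≫ fhg) (xy' : f ≫ fh ⟶ h ≫ hf) (xz' : hf ≫ fhg ⟶ hg ≫ ghf)
    (yb : xz ▷ fgh ≫ (α_ _ _ _).hom ≫ g ◁ xy ≫ (α_ _ _ _).inv ≫ zy ▷ ghf =
      (α_ _ _ _).hom ≫ f ◁ zy' ≫ (α_ _ _ _).inv ≫ xy' ▷ fhg ≫ (α_ _ _ _).hom ≫
        h ◁ xz' ≫ (α_ _ _ _).inv) :
    ((α_ _ _ _).inv ≫ xz ▷ r ≫ (α_ _ _ _).hom) ≫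
      (g ◁ (gf ◁ β ≫ (α_ _ _ _).inv ≫ xy ▷ r₀ ≫ (α_ _ _ _).hom) ≫ (α_ _ _ _).inv ≫
        zy ▷ (ghf ≫ r₀) ≫ (α_ _ _ _).hom) =
    (f ◁ (fg ◁ β ≫ (α_ _ _ _).inv ≫ zy' ▷ r₀ ≫ (α_ _ _ _).hom) ≫ (α_ _ _ _).inv ≫
        xy' ▷ (fhg ≫ r₀) ≫ (α_ _ _ _).hom) ≫
      h ◁ ((α_ _ _ _).inv ≫ xz' ▷ r₀ ≫ (α_ _ _ _).hom) := by
  have h1 : ((α_ _ _ _).inv ≫ xz ▷ r ≫ (α_ _ _ _).hom) ≫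
      (g ◁ (gf ◁ β ≫ (α_ _ _ _).inv ≫ xy ▷ r₀ ≫ (α_ _ _ _).hom) ≫ (α_ _ _ _).inv ≫
        zy ▷ (ghf ≫ r₀) ≫ (α_ _ _ _).hom) =
      f ◁ fg ◁ β ≫ 𝟙 _ ⊗≫ (xz ▷ fgh ≫ (α_ _ _ _).hom ≫ g ◁ xy ≫ (α_ _ _ _).inv ≫ zy ▷ ghf) ▷ r₀ ⊗≫ 𝟙 _ := by
    calc _ = 𝟙 _ ⊗≫ (xz ▷ r ≫ (g ≫ gf) ◁ β) ⊗≫ g ◁ xy ▷ r₀ ⊗≫ zy ▷ ghf ▷ r₀ ⊗≫ 𝟙 _ := by bicategory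
      _ = _ := by rw [← whisker_exchange]; bicategory
  rw [h1, yb]
  bicategory

theorem cons_whisker {B : Type*} [Bicategory B] {P P₀ P₁ W T : B} {f : P ⟶ P₀} {h : P ⟶ P₁}
    {fh : P₀ ⟶ W} {hf : P₁ ⟶ W} {r r' : P₀ ⟶ T} {s s' : W ⟶ T} (φ : r ⟶ r') (β : r ⟶ fh ≫ s)
    (β' : r' ⟶ fh ≫ s') (φ' : s ⟶ s') (sw : f ≫ fh ⟶ h ≫ hf) (e : φ ≫ β' = β ≫ fh ◁ φ') :
    f ◁ φ ≫ f ◁ β' ≫ (α_ _ _ _).inv ≫ sw ▷ s' ≫ (α_ _ _ _).hom =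
      (f ◁ β ≫ (α_ _ _ _).inv ≫ sw ▷ s ≫ (α_ _ _ _).hom) ≫ h ◁ hf ◁ φ' := by
  rw [← whiskerLeft_comp_assoc, e]
  calc _ = f ◁ β ⊗≫ ((f ≫ fh) ◁ φ' ≫ sw ▷ s') ⊗≫ 𝟙 _ := by bicategory
    _ = _ := by rw [whisker_exchange]; bicategory

theorem swap_head {B : Type*} [Bicategory B] {P P₀ P₁ W T : B} {f : P ⟶ P₀} {h : P ⟶ P₁}
    {fh : P₀ ⟶ W} {hf : P₁ ⟶ W} (s : W ⟶ T) (sw : f ≫ fh ⟶ h ≫ hf) (sw' : h ≫ hf ⟶ f ≫ fh)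
    (e : sw ≫ sw' = 𝟙 _) :
    ((α_ _ _ _).inv ≫ sw ▷ s ≫ (α_ _ _ _).hom) ≫ h ◁ (𝟙 _) ≫ (α_ _ _ _).inv ≫ sw' ▷ s ≫
      (α_ _ _ _).hom = 𝟙 _ ≫ f ◁ (𝟙 _) := by
  calc _ = 𝟙 _ ⊗≫ (sw ≫ sw') ▷ s ⊗≫ 𝟙 _ := by bicategory
    _ = _ := by rw [e]; bicategory

theorem swap_id {B : Type*} [Bicategory B] {P P₀ P₁ W T : B} {f : P ⟶ P₀} {h : P ⟶ P₁}
    {fh : P₀ ⟶ W} {hf : P₁ ⟶ W} (s : W ⟶ T) (sw : f ≫ fh ⟶ h ≫ hf) :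
    ((α_ _ _ _).inv ≫ sw ▷ s ≫ (α_ _ _ _).hom) ≫ 𝟙 (h ≫ hf ≫ s) =
      (f ◁ 𝟙 _ ≫ (α_ _ _ _).inv ≫ sw ▷ s ≫ (α_ _ _ _).hom) ≫ h ◁ (𝟙 (hf ≫ s)) := by
  simp

end GrayPasting

namespace GrayPasting
universe w₃ w₂ v u u' v' w
open GrayCategory

variable {V : Type u} [Quiver.{v} V] {𝒢 : PastingScheme.{v, u, w} V}
variable {K : Type u'} [GrayCategory.{w₃, w₂, v'} K] (𝓛 : Labelling 𝒢 K)

namespace Labelling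
open PastingScheme Quiver

/-- The composite 2-cell of the labels of the faces in the given order. -/
noncomputable def run : {P : Quiver.Path 𝒢.s 𝒢.t} → 𝒢.Order P →
    (along 𝓛.diagram P ⟶ along 𝓛.diagram 𝒢.q)
  | _, .nil => 𝟙 _
  | _, .cons _ h d => 𝓛.stepCell h ≫ run d

/-- The 3-cells built from interchangers of consecutive faces: the comparison 3-cells between
two compositions of the same pasting diagram. -/
inductive Chain : {P : Quiver.Path 𝒢.s 𝒢.t} → (d d' : 𝒢.Order P) → (𝓛.run d ⟶ 𝓛.run d') → Prop
  | refl {P : Quiver.Path 𝒢.s 𝒢.t} (d : 𝒢.Order P) : Chain d d (𝟙 _)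
  | trans {P : Quiver.Path 𝒢.s 𝒢.t} {d d' d'' : 𝒢.Order P} {φ : 𝓛.run d ⟶ 𝓛.run d'}
      {ψ : 𝓛.run d' ⟶ 𝓛.run d''} : Chain d d' φ → Chain d' d'' ψ → Chain d d'' (φ ≫ ψ)
  | cons {F : 𝒢.Face} {P P' : Quiver.Path 𝒢.s 𝒢.t} (h : 𝒢.Step F P P') {d d' : 𝒢.Order P'}
      {φ : 𝓛.run d ⟶ 𝓛.run d'} : Chain d d' φ → Chain (.cons F h d) (.cons F h d') (𝓛.stepCell h ◁ φ)
  | swap {F G : 𝒢.Face} {P PF PG W : Quiver.Path 𝒢.s 𝒢.t} (hne : F ≠ G) (f : 𝒢.Step F P PF)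
      (fg : 𝒢.Step G PF W) (g : 𝒢.Step G P PG) (gf : 𝒢.Step F PG W) (d : 𝒢.Order W) :
      Chain (.cons F f (.cons G fg d)) (.cons G g (.cons F gf d))
        ((α_ _ _ _).inv ≫ (𝓛.swap hne f fg g gf).hom ▷ 𝓛.run d ≫ (α_ _ _ _).hom)

variable {𝓛}

theorem Chain.perm {P : Quiver.Path 𝒢.s 𝒢.t} {d d' : 𝒢.Order P} {φ : 𝓛.run d ⟶ 𝓛.run d'}
    (h : 𝓛.Chain d d' φ) : d.list.Perm d'.list := by
  induction h with
  | refl d => exact .refl _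
  | trans _ _ h h' => exact h.trans h'
  | cons h _ ih => exact ih.cons _
  | swap hne f fg g gf d => exact .swap _ _ _

/-- The comparison 3-cell that brings the face `y` to the front. -/
inductive Bring (y : 𝒢.Face) : {P P₁ : Quiver.Path 𝒢.s 𝒢.t} → (d : 𝒢.Order P) →
    (st : 𝒢.Step y P P₁) → (d₁ : 𝒢.Order P₁) → (𝓛.run d ⟶ 𝓛.stepCell st ≫ 𝓛.run d₁) → Prop
  | head {P P₁ : Quiver.Path 𝒢.s 𝒢.t} (st : 𝒢.Step y P P₁) (d : 𝒢.Order P₁) :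
      Bring y (.cons y st d) st d (𝟙 _)
  | cons {x : 𝒢.Face} {P P₀ P₁ P₀₁ : Quiver.Path 𝒢.s 𝒢.t} (hne : x ≠ y) (stx : 𝒢.Step x P P₀)
      (st₀ : 𝒢.Step y P₀ P₀₁) (st : 𝒢.Step y P P₁) (stx₁ : 𝒢.Step x P₁ P₀₁) {d₀ : 𝒢.Order P₀}
      {d₀₁ : 𝒢.Order P₀₁} {φ : 𝓛.run d₀ ⟶ 𝓛.stepCell st₀ ≫ 𝓛.run d₀₁} :
      Bring y d₀ st₀ d₀₁ φ → Bring y (.cons x stx d₀) st (.cons x stx₁ d₀₁)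
        (𝓛.stepCell stx ◁ φ ≫ (α_ _ _ _).inv ≫ (𝓛.swap hne stx st₀ st stx₁).hom ▷ 𝓛.run d₀₁ ≫
          (α_ _ _ _).hom)

variable (𝓛) in
theorem exists_bring {y : 𝒢.Face} {P : Quiver.Path 𝒢.s 𝒢.t} (d : 𝒢.Order P) :
    ∀ {P₁ : Quiver.Path 𝒢.s 𝒢.t} (st : 𝒢.Step y P P₁), y ∈ d.list → ∃ d₁ φ, 𝓛.Bring y d st d₁ φ := by
  induction d with
  | nil => intro _ _ h; simp [Order.list] at h
  | @cons x P P' h d ih =>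
    intro P₁ st hy
    by_cases hxy : x = y
    · subst hxy
      obtain rfl := step_unique h st
      exact ⟨_, _, .head _ _⟩
    · have hy' : y ∈ d.list := by
        simp only [Order.list, List.mem_cons] at hy
        exact hy.resolve_left (fun e => hxy e.symm)
      obtain ⟨W, h₁, h₂⟩ := square hxy h st
      obtain ⟨d₁, φ, hb⟩ := ih h₁ hy'
      exact ⟨_, _, .cons hxy h h₁ st h₂ hb⟩

theorem Bring.perm {y : 𝒢.Face} {P P₁ : Quiver.Path 𝒢.s 𝒢.t} {d : 𝒢.Order P} {st : 𝒢.Step y P P₁}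
    {d₁ : 𝒢.Order P₁} {φ} (h : 𝓛.Bring y d st d₁ φ) : d.list.Perm (y :: d₁.list) := by
  induction h with
  | head st d => exact .refl _
  | cons hne stx st₀ st stx₁ _ ih =>
    exact (ih.cons _).trans (.swap _ _ _)

theorem Bring.unique {y : 𝒢.Face} {P P₁ : Quiver.Path 𝒢.s 𝒢.t} {d : 𝒢.Order P} {st : 𝒢.Step y P P₁}
    {d₁ e₁ : 𝒢.Order P₁} {φ ψ} (h : 𝓛.Bring y d st d₁ φ) (h' : 𝓛.Bring y d st e₁ ψ) :
    d₁ = e₁ ∧ φ ≍ ψ := by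
  induction h with
  | head st d =>
    cases h' with
    | head => exact ⟨rfl, HEq.rfl⟩
    | cons hne => exact (hne rfl).elim
  | cons hne stx st₀ st stx₁ _ ih =>
    cases h' with
    | head => exact (hne rfl).elim
    | cons hne' stx' st₀' st' stx₁' h' =>
      obtain rfl := step_unique st₀ st₀'
      obtain ⟨rfl, h⟩ := ih h'
      cases h
      exact ⟨rfl, HEq.rfl⟩

theorem Chain.bring {P : Quiver.Path 𝒢.s 𝒢.t} {d e : 𝒢.Order P} {φ : 𝓛.run d ⟶ 𝓛.run e}
    (h : 𝓛.Chain d e φ) : ∀ {y : 𝒢.Face} {P₁ : Quiver.Path 𝒢.s 𝒢.t} {st : 𝒢.Step y P P₁}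
    {d₁ e₁ : 𝒢.Order P₁} {β β'}, 𝓛.Bring y d st d₁ β → 𝓛.Bring y e st e₁ β' →
    ∃ φ', 𝓛.Chain d₁ e₁ φ' ∧ φ ≫ β' = β ≫ 𝓛.stepCell st ◁ φ' := by
  induction h with
  | refl d =>
    intro y P₁ st d₁ e₁ β β' hb hb'
    obtain ⟨rfl, h⟩ := hb.unique hb'
    cases h
    exact ⟨_, .refl _, by simp⟩
  | @trans P d d' d'' φ ψ h h' ih ih' =>
    intro y P₁ st d₁ e₁ β β' hb hb'
    obtain ⟨f₁, δ, hδ⟩ := 𝓛.exists_bring d' st (h.perm.subset (hb.perm.symm.subset (by simp)))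
    obtain ⟨φ', hφ', e⟩ := ih hb hδ
    obtain ⟨ψ', hψ', e'⟩ := ih' hδ hb'
    refine ⟨_, hφ'.trans hψ', ?_⟩
    rw [Category.assoc, e', ← Category.assoc, e, Category.assoc, whiskerLeft_comp]
  | @cons x P P' h d d' φ hφ ih =>
    intro y P₁ st d₁ e₁ β β' hb hb'
    cases hb with
    | head =>
      cases hb' with
      | head => exact ⟨φ, hφ, (Category.comp_id _).trans (Category.id_comp _).symm⟩
      | cons hne => exact (hne rfl).elim
    | cons hne stx st₀ st stx₁ hb =>
      cases hb' with
      | head => exact (hne rfl).elim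
      | cons hne' stx' st₀' st' stx₁' hb' =>
        obtain rfl := step_unique st₀ st₀'
        obtain ⟨φ', hφ', e⟩ := ih hb hb'
        refine ⟨_, hφ'.cons stx₁, ?_⟩
        exact cons_whisker φ _ _ φ' _ e
  | @swap x z P PF PG W hne f fg g gf r =>
    intro y P₁ st d₁ e₁ β β' hb hb'
    cases hb with
    | head =>
      cases hb' with
      | head => exact (hne rfl).elim
      | cons hne' stx st₀ st' stx₁ hb' =>
        cases hb' with
        | cons hne'' => exact (hne'' rfl).elim
        | head =>
          refine ⟨_, .refl _, ?_⟩
          refine swap_head _ _ _ ?_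
          rw [swap_symm 𝓛 hne f fg g gf]
          exact Iso.hom_inv_id _
    | cons hne₁ stx st₀ st stx₁ hb =>
      cases hb with
      | head =>
        cases hb' with
        | cons hne'' => exact (hne'' rfl).elim
        | head =>
          refine ⟨_, .refl _, ?_⟩
          refine swap_id _ _
      | cons hne₂ stz st₁ st' stz₁ hb =>
        cases hb' with
        | head => exact (hne₂ rfl).elim
        | cons hne₃ stz' st₂ st'' stz₂ hb' =>
          cases hb' with
          | head => exact (hne₁ rfl).elim
          | cons hne₄ stx' st₃ st₄ stx₂ hb' =>
            obtain rfl := step_unique st₁ st₃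
            obtain ⟨rfl, h⟩ := hb.unique hb'
            cases h
            refine ⟨_, .swap hne stx₁ stz₁ stz₂ stx₂ _, ?_⟩
            exact yb_whisker _ _ _ _ _ _ _ (𝓛.yb hne hne₁ hne₂ f g st fg gf st₀ stx₁ st₂ stz₂ st₁ stz₁ stx₂)

end Labelling
end GrayPasting

namespace GrayPasting
universe w₃ w₂ v u u' v' w
open GrayCategory

variable {V : Type u} [Quiver.{v} V] {𝒢 : PastingScheme.{v, u, w} V}
variable {K : Type u'} [GrayCategory.{w₃, w₂, v'} K] {𝓛 : Labelling 𝒢 K}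

namespace Labelling
open PastingScheme Quiver

theorem Bring.isIso {y : 𝒢.Face} {P P₁ : Quiver.Path 𝒢.s 𝒢.t} {d : 𝒢.Order P}
    {st : 𝒢.Step y P P₁} {d₁ : 𝒢.Order P₁} {φ} (h : 𝓛.Bring y d st d₁ φ) : IsIso φ := by
  induction h with
  | head st d => exact inferInstanceAs (IsIso (𝟙 (𝓛.stepCell st ≫ 𝓛.run d)))
  | @cons x P P₀ P₁ P₀₁ hne stx st₀ st stx₁ d₀ d₀₁ φ _ ih =>
    exact inferInstanceAs (IsIso (𝓛.stepCell stx ◁ φ ≫ (α_ _ _ _).inv ≫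
      (𝓛.swap hne stx st₀ st stx₁).hom ▷ 𝓛.run d₀₁ ≫ (α_ _ _ _).hom))

theorem Bring.chain {y : 𝒢.Face} {P P₁ : Quiver.Path 𝒢.s 𝒢.t} {d : 𝒢.Order P}
    {st : 𝒢.Step y P P₁} {d₁ : 𝒢.Order P₁} {φ} (h : 𝓛.Bring y d st d₁ φ) :
    ∃ ψ, 𝓛.Chain (.cons y st d₁) d ψ := by
  induction h with
  | head st d => exact ⟨_, .refl _⟩
  | cons hne stx st₀ st stx₁ _ ih =>
    obtain ⟨ψ, hψ⟩ := ih
    exact ⟨_, (Chain.swap hne.symm st stx₁ stx st₀ _).trans (hψ.cons stx)⟩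

theorem Chain.eq_of_nil {P : Quiver.Path 𝒢.s 𝒢.t} {d e : 𝒢.Order P} {φ : 𝓛.run d ⟶ 𝓛.run e}
    (h : 𝓛.Chain d e φ) : d.list = [] → ∃ hde : d = e, φ = eqToHom (by rw [hde]) := by
  induction h with
  | refl d => exact fun _ => ⟨rfl, rfl⟩
  | trans _ _ ih ih' =>
    intro hd
    obtain ⟨rfl, rfl⟩ := ih hd
    obtain ⟨rfl, rfl⟩ := ih' hd
    exact ⟨rfl, by simp⟩
  | cons => intro h; cases h
  | swap => intro h; cases h

theorem Chain.unique {P : Quiver.Path 𝒢.s 𝒢.t} {d : 𝒢.Order P} :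
    ∀ {e : 𝒢.Order P} {φ ψ : 𝓛.run d ⟶ 𝓛.run e}, 𝓛.Chain d e φ → 𝓛.Chain d e ψ → φ = ψ := by
  induction d with
  | nil =>
    intro e φ ψ h h'
    obtain ⟨rfl, rfl⟩ := h.eq_of_nil rfl
    obtain ⟨_, rfl⟩ := h'.eq_of_nil rfl
    rfl
  | @cons y P P' st d ih =>
    intro e φ ψ h h'
    obtain ⟨e₁, β, hβ⟩ := 𝓛.exists_bring e st (h.perm.subset (by simp [Order.list]))
    have := hβ.isIso
    obtain ⟨φ', hφ', e₂⟩ := h.bring (.head st d) hβ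
    obtain ⟨ψ', hψ', e₃⟩ := h'.bring (.head st d) hβ
    rw [← cancel_mono β, e₂, e₃, ih hφ' hψ']

variable (𝓛) in
theorem exists_chain {P : Quiver.Path 𝒢.s 𝒢.t} (d : 𝒢.Order P) :
    ∀ e : 𝒢.Order P, d.list.Perm e.list → ∃ φ, 𝓛.Chain d e φ := by
  induction d with
  | nil =>
    intro e h
    cases e with
    | nil => exact ⟨_, .refl _⟩
    | cons => simp [Order.list] at h
  | @cons y P P' st d ih =>
    intro e h
    obtain ⟨e₁, β, hβ⟩ := 𝓛.exists_bring e st (h.subset (by simp [Order.list]))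
    obtain ⟨φ, hφ⟩ := ih e₁ (List.Perm.cons_inv (h.trans hβ.perm))
    obtain ⟨ψ, hψ⟩ := hβ.chain
    exact ⟨_, (hφ.cons st).trans hψ⟩

/-- The pasting theorem: two compositions of the same pasting diagram are related by exactly one
comparison 3-cell. -/
theorem existsUnique_chain {P : Quiver.Path 𝒢.s 𝒢.t} (d e : 𝒢.Order P)
    (h : d.list.Perm e.list) : ∃! φ, 𝓛.Chain d e φ := by
  obtain ⟨φ, hφ⟩ := 𝓛.exists_chain d e h
  exact ⟨φ, hφ, fun ψ hψ => hψ.unique hφ⟩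

end Labelling

namespace PastingScheme

/-- The sequence of moves from `p` to `q` crossing the faces in the given order. -/
noncomputable def LinearExtension.order (X : 𝒢.LinearExtension) : 𝒢.Order 𝒢.p :=
  (exists_order X).choose

theorem LinearExtension.order_list (X : 𝒢.LinearExtension) : X.order.list = X.list :=
  (exists_order X).choose_spec

theorem LinearExtension.perm (X Y : 𝒢.LinearExtension) : X.list.Perm Y.list :=
  (List.perm_ext_iff_of_nodup X.nodup Y.nodup).2 fun F => by simp [X.mem, Y.mem]

variable (𝒢) in
/-- `𝒞_𝒢`, the contractible groupoid on the linear extensions: it has exactly one morphism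
between any two objects. -/
abbrev C := Codiscrete 𝒢.LinearExtension

end PastingScheme

namespace Labelling
open PastingScheme

theorem existsUnique_compare (X Y : 𝒢.LinearExtension) : ∃! φ, 𝓛.Chain X.order Y.order φ :=
  existsUnique_chain _ _ (by rw [X.order_list, Y.order_list]; exact X.perm Y)

variable (𝓛) in
/-- The unique comparison 3-cell between two compositions. -/
noncomputable def compare (X Y : 𝒢.LinearExtension) : 𝓛.run X.order ⟶ 𝓛.run Y.order :=
  (existsUnique_compare (𝓛 := 𝓛) X Y).choose

variable (𝓛) in
theorem compare_chain (X Y : 𝒢.LinearExtension) :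
    𝓛.Chain X.order Y.order (𝓛.compare X Y) :=
  (existsUnique_compare X Y).choose_spec.1

variable (𝓛) in
/-- The functor `𝒞_𝒢 ⥤ 𝒦(S, T)[p, q]` of a labelling: a linear extension goes to the corresponding
composite 2-cell, a morphism to the unique comparison 3-cell. -/
noncomputable def functor : 𝒢.C ⥤ (along 𝓛.diagram 𝒢.p ⟶ along 𝓛.diagram 𝒢.q) where
  obj X := 𝓛.run X.as.order
  map {X Y} _ := 𝓛.compare X.as Y.as
  map_id _ := (𝓛.compare_chain _ _).unique (.refl _)
  map_comp _ _ := (𝓛.compare_chain _ _).unique ((𝓛.compare_chain _ _).trans (𝓛.compare_chain _ _))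

end Labelling
end GrayPasting

namespace GrayPasting
universe w₃ w₂ v u u' v' w
open GrayCategory

variable {V : Type u} [Quiver.{v} V] {𝒢 : PastingScheme.{v, u, w} V}

theorem edges_nodup (hV : Acyclic V) {a b : V} (P : Quiver.Path a b) : (edges P).Nodup := by
  induction P with
  | nil => simp [edges]
  | @cons c d P e ih =>
    refine ih.append (List.nodup_singleton _) ?_
    rintro f hf hf'
    obtain rfl := List.mem_singleton.1 hf'
    obtain ⟨A, B, -⟩ := exists_split_of_mem P hf
    exact hV.contra B e

namespace PastingScheme
open Quiver

/-- `F ⋖ G`: one has `F ⊲ G`, and `F`, `G` are consecutive in some linear extension. -/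
def Glueable (F G : 𝒢.Face) : Prop :=
  𝒢.Before F G ∧ ∃ (X : 𝒢.LinearExtension) (U W : List 𝒢.Face), X.list = U ++ F :: G :: W

theorem Order.exists_steps {F G : 𝒢.Face} {W : List 𝒢.Face} : ∀ {P : Quiver.Path 𝒢.s 𝒢.t}
    (d : 𝒢.Order P) (U : List 𝒢.Face), d.list = U ++ F :: G :: W →
    ∃ P₀ P₁ P₂, 𝒢.Step F P₀ P₁ ∧ 𝒢.Step G P₁ P₂
  | _, .nil, U, h => by cases U <;> simp [Order.list] at h
  | _, .cons H h₀ .nil, [], h => by simp [Order.list] at h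
  | _, .cons H h₀ (.cons H' h₁ d), [], h => by
    simp only [Order.list, List.nil_append, List.cons.injEq] at h
    obtain ⟨rfl, rfl, -⟩ := h
    exact ⟨_, _, _, h₀, h₁⟩
  | _, .cons H h₀ d, K :: U, h => by
    simp only [Order.list, List.cons_append, List.cons.injEq] at h
    exact exists_steps d U h.2

/-- The common boundary of two consecutive faces: `src` and `tgt` are the ends of the face `F#G`,
and `F` and `G` meet along the path `mF.τF.nF = mG.σG.nG`. -/
structure Glue (F G : 𝒢.Face) where
  src : V
  tgt : V
  mF : Path src (𝒢.fs F)
  mG : Path src (𝒢.fs G)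
  nF : Path (𝒢.ft F) tgt
  nG : Path (𝒢.ft G) tgt
  left : mF.length = 0 ∨ mG.length = 0
  right : nF.length = 0 ∨ nG.length = 0
  eq : mF.comp ((𝒢.τ F).comp nF) = mG.comp ((𝒢.σ G).comp nG)

theorem Glueable.exists_glue {F G : 𝒢.Face} (h : Glueable F G) : Nonempty (𝒢.Glue F G) := by
  obtain ⟨-, X, U, W, hX⟩ := h
  obtain ⟨d, hd⟩ := exists_order X
  obtain ⟨P₀, P₁, P₂, ⟨A, B, -, rfl⟩, ⟨C, D, h, -⟩⟩ := d.exists_steps U (hd.trans hX)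
  rcases comp_eq_comp h with ⟨m, -, h⟩ | ⟨m, -, h⟩
  · rcases comp_eq_comp ((h.trans (Path.comp_assoc _ _ _).symm :
      (𝒢.τ F).comp B = (m.comp (𝒢.σ G)).comp D)) with ⟨n, h', -⟩ | ⟨n, h', -⟩
    · exact ⟨⟨_, _, .nil, m, n, .nil, .inl rfl, .inr rfl, by simp [h']⟩⟩
    · exact ⟨⟨_, _, .nil, m, .nil, n, .inl rfl, .inl rfl, by simp [h']⟩⟩
  · rcases comp_eq_comp (((Path.comp_assoc _ _ _).trans h.symm :
      (m.comp (𝒢.τ F)).comp B = (𝒢.σ G).comp D)) with ⟨n, h', -⟩ | ⟨n, h', -⟩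
    · exact ⟨⟨_, _, m, .nil, n, .nil, .inr rfl, .inr rfl, by simp [h']⟩⟩
    · exact ⟨⟨_, _, m, .nil, .nil, n, .inr rfl, .inl rfl, by simp [← h']⟩⟩

/-- The common boundary of `F` and `G`. -/
noncomputable def Glueable.glue {F G : 𝒢.Face} (h : Glueable F G) : 𝒢.Glue F G :=
  h.exists_glue.some

theorem Glueable.ne {F G : 𝒢.Face} (h : Glueable F G) : F ≠ G := by
  rintro rfl
  exact 𝒢.before_acyclic _ (.single h.1)

theorem no_repeat {a b c d : V} (P : Path a b) (k : Path b c) (Q : Path c d) {x : Edge V}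
    (hx : x ∈ edges P) (hx' : x ∈ edges Q) (hV : Acyclic V) : False := by
  obtain ⟨A, B, -⟩ := exists_split_of_mem P hx
  obtain ⟨A', B', -⟩ := exists_split_of_mem Q hx'
  exact hV.contra (B.comp (k.comp A')) x.2.2

/-- The path `k` shared by `F` and `G`. -/
theorem Glue.split {F G : 𝒢.Face} (g : 𝒢.Glue F G) (hb : 𝒢.Before F G) :
    ∃ (x y : V) (k : Path x y), k.length ≠ 0 ∧
      edges (𝒢.τ F) = edges g.mG ++ edges k ++ edges g.nG ∧
      edges (𝒢.σ G) = edges g.mF ++ edges k ++ edges g.nF ∧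
      (g.src = 𝒢.fs F ∧ x = 𝒢.fs G ∨ g.src = 𝒢.fs G ∧ x = 𝒢.fs F) := by
  obtain ⟨e, he, he'⟩ := hb
  obtain ⟨s, t, mF, mG, nF, nG, l, r, eq⟩ := g
  dsimp only
  rcases l with l | l
  · obtain rfl := Path.eq_of_length_zero _ l
    obtain rfl := Path.eq_nil_of_length_zero _ l
    rw [Path.nil_comp] at eq
    rcases r with r | r
    · obtain rfl := Path.eq_of_length_zero _ r
      obtain rfl := Path.eq_nil_of_length_zero _ r
      refine ⟨_, _, 𝒢.σ G, σ_length G, ?_, by simp [edges], .inl ⟨rfl, rfl⟩⟩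
      rw [show 𝒢.τ F = _ from eq, edges_comp, edges_comp, List.append_assoc]
    · obtain rfl := Path.eq_of_length_zero _ r
      obtain rfl := Path.eq_nil_of_length_zero _ r
      rw [Path.comp_nil] at eq
      rcases comp_eq_comp eq with ⟨k, h₁, h₂⟩ | ⟨k, h₁, h₂⟩
      · rw [h₁] at eq
        exact (no_repeat _ k _ he he' 𝒢.acyclic).elim
      · refine ⟨_, _, k, fun hk => ?_, by rw [h₁, edges_comp]; simp [edges],
          by rw [h₂, edges_comp]; simp [edges], .inl ⟨rfl, rfl⟩⟩
        have := Path.eq_of_length_zero _ hk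
        rw [h₁, edges_comp] at he
        rw [← length_edges, List.length_eq_zero_iff] at hk
        rw [hk, List.append_nil] at he
        exact no_repeat _ .nil _ he he' 𝒢.acyclic
  · obtain rfl := Path.eq_of_length_zero _ l
    obtain rfl := Path.eq_nil_of_length_zero _ l
    rw [Path.nil_comp] at eq
    rcases r with r | r
    · obtain rfl := Path.eq_of_length_zero _ r
      obtain rfl := Path.eq_nil_of_length_zero _ r
      rw [Path.comp_nil] at eq
      rcases comp_eq_comp eq with ⟨k, h₁, h₂⟩ | ⟨k, h₁, h₂⟩
      · refine ⟨_, _, k, fun hk => ?_, by rw [h₂, edges_comp]; simp [edges],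
          by rw [h₁, edges_comp]; simp [edges], .inr ⟨rfl, rfl⟩⟩
        rw [h₁, edges_comp] at he'
        rw [← length_edges, List.length_eq_zero_iff] at hk
        rw [hk, List.append_nil] at he'
        exact no_repeat _ .nil _ he' he 𝒢.acyclic
      · exact (no_repeat _ k _ he' he 𝒢.acyclic).elim
    · obtain rfl := Path.eq_of_length_zero _ r
      obtain rfl := Path.eq_nil_of_length_zero _ r
      refine ⟨_, _, 𝒢.τ F, τ_length F, by simp [edges], ?_, .inr ⟨rfl, rfl⟩⟩
      rw [show 𝒢.σ G = _ from eq.symm, edges_comp, edges_comp, List.append_assoc]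

end PastingScheme
end GrayPasting

namespace GrayPasting
universe w₃ w₂ v u u' v' w
open GrayCategory

variable {V : Type u} [Quiver.{v} V] {𝒢 : PastingScheme.{v, u, w} V}

theorem count_inner [DecidableEq V] {a b : V} (P : Quiver.Path a b) (hP : P.length ≠ 0) (x : V) :
    (innerVertices P).count x + [a].count x = ((edges P).map fun e => e.1).count x := by
  have : ∀ {b : V} (P : Quiver.Path a b), P.length ≠ 0 →
      ((edges P).map fun e => e.1) = a :: innerVertices P := by
    intro b P hP
    induction P with
    | nil => simp at hP
    | @cons c d P e ih =>
      by_cases h0 : P.length = 0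
      · obtain rfl := Quiver.Path.eq_of_length_zero _ h0
        obtain rfl := Quiver.Path.eq_nil_of_length_zero _ h0
        rfl
      · have h := ih h0
        have h' : ((edges (P.cons e)).map fun e => e.1) = (a :: innerVertices P) ++ [c] := by
          rw [← h, edges, List.map_append]; rfl
        have h'' : innerVertices (P.cons e) = innerVertices P ++ [c] := congrArg List.tail h'
        rw [h', h'']
        rfl
  rw [this P hP, List.count_cons, List.count_cons]
  simp

namespace PastingScheme
open Quiver

/-- The upper boundary of the face `F#G`. -/
noncomputable def Glueable.top {F G : 𝒢.Face} (h : Glueable F G) : Path h.glue.src h.glue.tgt :=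
  h.glue.mF.comp ((𝒢.σ F).comp h.glue.nF)

/-- The lower boundary of the face `F#G`. -/
noncomputable def Glueable.bottom {F G : 𝒢.Face} (h : Glueable F G) :
    Path h.glue.src h.glue.tgt :=
  h.glue.mG.comp ((𝒢.τ G).comp h.glue.nG)

open Classical in
/-- The plane graph with `F` and `G` replaced by the single face `F#G`, denoted `none`. -/
noncomputable def Glueable.plane {F G : 𝒢.Face} (h : Glueable F G) : PlaneData.{v, u, w} V where
  s := 𝒢.s
  t := 𝒢.t
  p := 𝒢.p
  q := 𝒢.q
  Face := Option {H : 𝒢.Face // H ≠ F ∧ H ≠ G}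
  fs
    | none => h.glue.src
    | some H => 𝒢.fs H
  ft
    | none => h.glue.tgt
    | some H => 𝒢.ft H
  σ
    | none => h.top
    | some H => 𝒢.σ H
  τ
    | none => h.bottom
    | some H => 𝒢.τ H

theorem sum_glue {F G : 𝒢.Face} (h : Glueable F G) (f : 𝒢.Face → ℕ) (f' : h.plane.Face → ℕ)
    (hf : ∀ H, f' (some H) = f H.1) : ∑ H, f H + f' none = f F + f G + ∑ H, f' H := by
  classical
  have h₁ : ∑ H, f' H = f' none + ∑ H : {H : 𝒢.Face // H ≠ F ∧ H ≠ G}, f' (some H) := by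
    have key : ∀ (i : Fintype (Option {H : 𝒢.Face // H ≠ F ∧ H ≠ G})) (g : _ → ℕ),
        (@Finset.univ _ i).sum g = g none + ∑ H, g (some H) := by
      intro i g
      rw [← Fintype.sum_option]
      congr!
    exact key _ f'
  have h₂ : ∑ H : {H : 𝒢.Face // H ≠ F ∧ H ≠ G}, f' (some H) =
      ∑ H ∈ (Finset.univ.erase F).erase G, f H := by
    rw [Finset.sum_subtype (p := fun H => H ≠ F ∧ H ≠ G) _ (by simp [and_comm])]
    exact Fintype.sum_congr _ _ hf
  have h₃ := Finset.add_sum_erase Finset.univ f (Finset.mem_univ F)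
  have h₄ := Finset.add_sum_erase (Finset.univ.erase F) f
    (Finset.mem_erase.2 ⟨h.ne.symm, Finset.mem_univ G⟩)
  omega

theorem not_before_swap {F G : 𝒢.Face} (h : 𝒢.Before F G) : ¬ 𝒢.Before G F := fun h' =>
  𝒢.before_acyclic F (.tail (.single h) h')

theorem not_before_self (F : 𝒢.Face) : ¬ 𝒢.Before F F := fun h => 𝒢.before_acyclic F (.single h)

theorem edges_none_σ {F G : 𝒢.Face} (h : Glueable F G) :
    edges (h.plane.σ none) = edges h.glue.mF ++ (edges (𝒢.σ F) ++ edges h.glue.nF) := by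
  simp [Glueable.plane, Glueable.top, Glueable.bottom, edges_comp]

theorem edges_none_τ {F G : 𝒢.Face} (h : Glueable F G) :
    edges (h.plane.τ none) = edges h.glue.mG ++ (edges (𝒢.τ G) ++ edges h.glue.nG) := by
  simp [Glueable.plane, Glueable.top, Glueable.bottom, edges_comp]

theorem Glueable.before_none {F G : 𝒢.Face} (h : Glueable F G) {H} :
    h.plane.Before (some H) none ↔ 𝒢.Before H.1 F ∨ 𝒢.Before H.1 G := by
  obtain ⟨x, y, k, -, h₁, h₂, -⟩ := h.glue.split h.1
  constructor
  · rintro ⟨e, he, he'⟩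
    rw [edges_none_σ] at he'
    simp only [List.mem_append] at he'
    rcases he' with he' | he' | he'
    · exact .inr ⟨e, he, by rw [h₂]; simp [he']⟩
    · exact .inl ⟨e, he, he'⟩
    · exact .inr ⟨e, he, by rw [h₂]; simp [he']⟩
  · rintro (⟨e, he, he'⟩ | ⟨e, he, he'⟩)
    · exact ⟨e, he, by rw [edges_none_σ]; simp [he']⟩
    · refine ⟨e, he, ?_⟩
      rw [h₂] at he'
      simp only [List.mem_append] at he'
      rw [edges_none_σ]
      rcases he' with (he' | he') | he'
      · simp [he']
      · exact (H.2.1 (τ_disjoint he (by rw [h₁]; simp [he']))).elim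
      · simp [he']

theorem Glueable.none_before {F G : 𝒢.Face} (h : Glueable F G) {H} :
    h.plane.Before none (some H) ↔ 𝒢.Before F H.1 ∨ 𝒢.Before G H.1 := by
  obtain ⟨x, y, k, -, h₁, h₂, -⟩ := h.glue.split h.1
  constructor
  · rintro ⟨e, he, he'⟩
    rw [edges_none_τ] at he
    simp only [List.mem_append] at he
    rcases he with he | he | he
    · exact .inl ⟨e, by rw [h₁]; simp [he], he'⟩
    · exact .inr ⟨e, he, he'⟩
    · exact .inl ⟨e, by rw [h₁]; simp [he], he'⟩
  · rintro (⟨e, he, he'⟩ | ⟨e, he, he'⟩)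
    · refine ⟨e, ?_, he'⟩
      rw [h₁] at he
      simp only [List.mem_append] at he
      rw [edges_none_τ]
      rcases he with (he | he) | he
      · simp [he]
      · exact (H.2.2 (σ_disjoint he' (by rw [h₂]; simp [he]))).elim
      · simp [he]
    · exact ⟨e, by rw [edges_none_τ]; simp [he], he'⟩

theorem Glueable.some_before {F G : 𝒢.Face} (h : Glueable F G) {H H'} :
    h.plane.Before (some H) (some H') ↔ 𝒢.Before H.1 H'.1 := Iff.rfl

theorem Glueable.not_none_before {F G : 𝒢.Face} (h : Glueable F G) :
    ¬ h.plane.Before none none := by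
  classical
  rintro ⟨e, he, he'⟩
  obtain ⟨x, y, k, -, h₁, h₂, -⟩ := h.glue.split h.1
  have hnd := edges_nodup 𝒢.acyclic (h.glue.mF.comp ((𝒢.τ F).comp h.glue.nF))
  have hnd' := edges_nodup 𝒢.acyclic (h.glue.mG.comp ((𝒢.σ G).comp h.glue.nG))
  rw [← h.glue.eq] at hnd'
  have h₃ := List.nodup_iff_count_le_one.1 hnd e
  simp only [edges_comp, h₁, List.count_append] at h₃
  rw [edges_none_τ, List.mem_append, List.mem_append] at he
  rw [edges_none_σ, List.mem_append, List.mem_append] at he'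
  have hG : e ∉ edges (𝒢.τ G) := by
    intro h₄
    rcases he' with he' | he' | he'
    · exact not_before_self G ⟨e, h₄, by rw [h₂]; simp [he']⟩
    · exact not_before_swap h.1 ⟨e, h₄, he'⟩
    · exact not_before_self G ⟨e, h₄, by rw [h₂]; simp [he']⟩
  have hF : e ∉ edges (𝒢.σ F) := by
    intro h₄
    rcases he with he | he | he
    · exact not_before_self F ⟨e, by rw [h₁]; simp [he], h₄⟩
    · exact hG he
    · exact not_before_self F ⟨e, by rw [h₁]; simp [he], h₄⟩
  have a₁ : 0 < (edges h.glue.mG).count e + (edges h.glue.nG).count e := by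
    rcases he with he | he | he
    · have := List.count_pos_iff.2 he; omega
    · exact (hG he).elim
    · have := List.count_pos_iff.2 he; omega
  have a₂ : 0 < (edges h.glue.mF).count e + (edges h.glue.nF).count e := by
    rcases he' with he' | he' | he'
    · have := List.count_pos_iff.2 he'; omega
    · exact (hF he').elim
    · have := List.count_pos_iff.2 he'; omega
  omega

open Classical in
theorem Glueable.before_acyclic {F G : 𝒢.Face} (h : Glueable F G) (H : h.plane.Face) :
    ¬ Relation.TransGen h.plane.Before H H := by
  obtain ⟨X, U, W, hX⟩ := h.2
  let r : 𝒢.Face → ℕ := fun H => X.list.idxOf H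
  have hr : ∀ {H H'}, 𝒢.Before H H' → r H < r H' := by
    intro H H' hb
    by_contra hlt
    have h₁ := List.idxOf_lt_length_iff.2 (X.mem H)
    have h₂ := List.idxOf_lt_length_iff.2 (X.mem H')
    rcases (not_lt.1 hlt).lt_or_eq with h₃ | h₃
    · refine List.pairwise_iff_getElem.1 X.pairwise _ _ h₂ h₁ h₃ ?_
      simpa using hb
    · obtain rfl := (List.idxOf_inj (X.mem H')).1 h₃
      exact not_before_self _ hb
  have hnd : (U ++ F :: G :: W).Nodup := hX ▸ X.nodup
  have hFU : F ∉ U := fun hF => by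
    have := List.disjoint_of_nodup_append hnd hF; simp at this
  have hGU : G ∉ U := fun hF => by
    have := List.disjoint_of_nodup_append hnd hF; simp at this
  have rF : r F = U.length := by
    simp [r, hX, List.idxOf_append_of_notMem hFU]
  have rG : r G = U.length + 1 := by
    simp [r, hX, List.idxOf_append_of_notMem hGU, List.idxOf_cons_ne _ h.ne]
  have hinj : ∀ {H H'}, r H = r H' → H = H' := fun {H H'} e => (List.idxOf_inj (X.mem H)).1 e
  let r' : h.plane.Face → ℕ
    | none => r F
    | some H => r H.1
  have key : ∀ {H H' : h.plane.Face}, h.plane.Before H H' → r' H < r' H' := by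
    rintro (_ | H) (_ | H') hb
    · exact (h.not_none_before hb).elim
    · change r F < r H'.1
      rcases h.none_before.1 hb with hb | hb <;> have := hr hb <;> omega
    · change r H.1 < r F
      rcases h.before_none.1 hb with hb | hb
      · exact hr hb
      · have h₁ := hr hb
        have h₂ : r H.1 ≠ r F := fun e => H.2.1 (hinj e)
        omega
    · exact hr hb
  have key' : ∀ {H H' : h.plane.Face}, Relation.TransGen h.plane.Before H H' → r' H < r' H' := by
    intro H H' hb
    induction hb with
    | single hb => exact key hb
    | tail _ hb ih => exact ih.trans (key hb)
  exact fun hb => lt_irrefl _ (key' hb)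

/-- The pasting scheme `𝒢^{FG}`. -/
noncomputable def Glueable.scheme {F G : 𝒢.Face} (h : Glueable F G) :
    PastingScheme.{v, u, w} V where
  toPlaneData := h.plane
  acyclic := 𝒢.acyclic
  s_ne_t := 𝒢.s_ne_t
  fs_ne_ft := by
    rintro (_ | H)
    · change h.glue.src ≠ h.glue.tgt
      intro e
      have h₁ : ∀ {a b : V} (P : Path a b), a = b → P.length = 0 := by
        rintro a b P rfl
        rw [𝒢.acyclic _ P]; rfl
      have h₂ := h₁ (h.glue.mF.comp ((𝒢.σ F).comp h.glue.nF)) e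
      have := σ_length F
      simp at h₂
      omega
    · exact 𝒢.fs_ne_ft _
  edge_balanced := by
    classical
    intro e
    have h₀ := 𝒢.edge_balanced e
    have h₁ := sum_glue h (fun H => (edges (𝒢.σ H)).count e) (fun H => (edges (h.plane.σ H)).count e)
      (fun _ => rfl)
    have h₂ := sum_glue h (fun H => (edges (𝒢.τ H)).count e) (fun H => (edges (h.plane.τ H)).count e)
      (fun _ => rfl)
    have h₃ := congrArg (fun P => (edges P).count e) h.glue.eq
    simp only [PlaneData.edgeAbove, PlaneData.edgeBelow, edges_none_σ, edges_none_τ, edges_comp,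
      List.count_append] at *
    change (edges 𝒢.p).count e + _ = (edges 𝒢.q).count e + _
    omega
  edge_le_one := by
    classical
    intro e
    have h₀ := 𝒢.edge_le_one e
    have h₂ := sum_glue h (fun H => (edges (𝒢.τ H)).count e) (fun H => (edges (h.plane.τ H)).count e)
      (fun _ => rfl)
    obtain ⟨x, y, k, -, h₄, -, -⟩ := h.glue.split h.1
    have h₃ := congrArg (fun l => l.count e) h₄
    simp only [PlaneData.edgeAbove, edges_none_τ, List.count_append] at *
    change (edges 𝒢.p).count e + _ ≤ 1
    omega
  vertex_balanced := by
    classical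
    intro x
    have h₀ := 𝒢.vertex_balanced x
    have h₁ := sum_glue h (fun H => (innerVertices (𝒢.σ H)).count x) (fun H => (innerVertices (h.plane.σ H)).count x)
      (fun _ => rfl)
    have h₂ := sum_glue h (fun H => (innerVertices (𝒢.τ H)).count x) (fun H => (innerVertices (h.plane.τ H)).count x)
      (fun _ => rfl)
    have h₃ := congrArg (fun P => ((edges P).map fun e => e.1).count x) h.glue.eq
    have h₄ := count_inner (𝒢.σ F) (σ_length F) x
    have h₅ := count_inner (𝒢.σ G) (σ_length G) x
    have h₆ := count_inner (𝒢.τ F) (τ_length F) x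
    have h₇ := count_inner (𝒢.τ G) (τ_length G) x
    have h₈ := count_inner (h.plane.σ none) (by
      have := σ_length F; simp [Glueable.plane, Glueable.top, Glueable.bottom]; omega) x
    have h₉ := count_inner (h.plane.τ none) (by
      have := τ_length G; simp [Glueable.plane, Glueable.top, Glueable.bottom]; omega) x
    simp only [PlaneData.vertexAbove, PlaneData.vertexBelow, edges_none_σ, edges_none_τ, edges_comp,
      List.map_append, List.count_append] at *
    change (innerVertices 𝒢.p).count x + _ = (innerVertices 𝒢.q).count x + _
    omega
  vertex_le_one := by
    classical
    intro x
    have h₀ := 𝒢.vertex_le_one x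
    have h₂ := sum_glue h (fun H => (innerVertices (𝒢.τ H)).count x) (fun H => (innerVertices (h.plane.τ H)).count x)
      (fun _ => rfl)
    obtain ⟨a, b, k, hk, h₃, -, h₁⟩ := h.glue.split h.1
    have h₃ := congrArg (fun l => (l.map fun e => e.1).count x) h₃
    have h₅ := count_inner k hk x
    have h₆ := count_inner (𝒢.τ F) (τ_length F) x
    have h₇ := count_inner (𝒢.τ G) (τ_length G) x
    have h₉ := count_inner (h.plane.τ none) (by
      have := τ_length G; simp [Glueable.plane, Glueable.top, Glueable.bottom]; omega) x
    have h₁' : [h.glue.src].count x + [a].count x = [𝒢.fs F].count x + [𝒢.fs G].count x := by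
      rcases h₁ with ⟨h₁, rfl⟩ | ⟨h₁, rfl⟩
      · rw [h₁]
      · rw [h₁, add_comm]
    change _ + [h.glue.src].count x = _ at h₉
    simp only [PlaneData.vertexAbove, edges_none_τ, List.map_append, List.count_append] at *
    change (innerVertices 𝒢.p).count x + _ ≤ 1
    omega
  before_acyclic := h.before_acyclic

/-- The faces of `𝒢` that make up a face of `𝒢^{FG}`, in order. -/
def Glueable.unglue {F G : 𝒢.Face} (h : Glueable F G) : h.scheme.Face → List 𝒢.Face
  | none => [F, G]
  | some H => [H.1]

/-- The linear extension `U F G W` obtained from `U (F#G) W`. -/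
def Glueable.expand {F G : 𝒢.Face} (h : Glueable F G) (X : h.scheme.LinearExtension) :
    𝒢.LinearExtension where
  list := X.list.flatMap h.unglue
  nodup := by
    rw [List.nodup_flatMap]
    refine ⟨?_, ?_⟩
    · rintro (_ | H) -
      · simp [unglue, h.ne]
      · simp [unglue]
    · refine X.nodup.imp ?_
      rintro (_ | H) (_ | H') hne
      · exact (hne rfl).elim
      · simpa [Function.onFun, unglue] using H'.2
      · simpa [Function.onFun, unglue] using H.2
      · have : H'.1 ≠ H.1 := fun e => hne (congrArg some (Subtype.ext e.symm))
        simpa [Function.onFun, unglue] using this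
  mem H := by
    rw [List.mem_flatMap]
    by_cases hH : H ≠ F ∧ H ≠ G
    · exact ⟨some ⟨H, hH⟩, X.mem (some ⟨H, hH⟩), by simp [unglue]⟩
    · refine ⟨none, X.mem none, ?_⟩
      simp only [unglue, List.mem_cons, List.not_mem_nil, or_false]
      tauto
  pairwise := by
    rw [List.pairwise_flatMap]
    refine ⟨?_, ?_⟩
    · rintro (_ | H) -
      · simpa [unglue] using not_before_swap h.1
      · simp [unglue]
    · refine (List.Pairwise.and X.nodup X.pairwise).imp ?_
      rintro (_ | H) (_ | H') ⟨hne, hb⟩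
      · exact (hne rfl).elim
      · have := mt h.before_none.2 hb
        simpa [unglue, not_or] using this
      · have := mt h.none_before.2 hb
        simpa [unglue, not_or] using this
      · simpa [unglue] using mt h.some_before.2 hb

/-- The functor `S_FG : 𝒞_{𝒢^{FG}} ⥤ 𝒞_𝒢`. -/
noncomputable def Glueable.S {F G : 𝒢.Face} (h : Glueable F G) : h.scheme.C ⥤ 𝒢.C :=
  Codiscrete.functorOfFun h.expand

end PastingScheme
end GrayPasting

namespace GrayPasting
universe w₃ w₂ v u u' v' w
open GrayCategory

variable {V : Type u} [Quiver.{v} V] {𝒢 : PastingScheme.{v, u, w} V}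
variable {K : Type u'} [GrayCategory.{w₃, w₂, v'} K]

/-- The 3-cell `Γ` whiskered by 1-cells `A` and `B`. -/
def plug₂ {W X Y Z : K} {f f' : W ⟶ Z} (A : W ⟶ X) {a a' : X ⟶ Y} {α α' : a ⟶ a'} (Γ : α ⟶ α')
    (B : Y ⟶ Z) (h : f = A ≫ a ≫ B) (h' : f' = A ≫ a' ≫ B) :
    plug A α B h h' ⟶ plug A α' B h h' :=
  eqToHom h ◁ (wL₂ A (wR₂ Γ B) ▷ eqToHom h'.symm)

namespace Labelling
open PastingScheme

variable (𝓛 : Labelling 𝒢 K)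

/-- The labelling with the same objects and 1-cells and with the 2-cells `β`. -/
def withCells (β : ∀ H : 𝒢.Face, along 𝓛.diagram (𝒢.σ H) ⟶ along 𝓛.diagram (𝒢.τ H)) :
    Labelling 𝒢 K where
  diagram := 𝓛.diagram
  cell := β

/-- The whiskered 3-cell of a face. -/
noncomputable def stepCell₂ {β : ∀ H : 𝒢.Face, along 𝓛.diagram (𝒢.σ H) ⟶ along 𝓛.diagram (𝒢.τ H)}
    (Γ : ∀ H, 𝓛.cell H ⟶ β H) {F : 𝒢.Face} {P P' : Quiver.Path 𝒢.s 𝒢.t} (h : 𝒢.Step F P P') :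
    𝓛.stepCell h ⟶ (𝓛.withCells β).stepCell h :=
  plug₂ _ (Γ F) _ _ _

/-- The horizontal composite of the whiskered 3-cells of all faces, in the given order. -/
noncomputable def run₂ {β : ∀ H : 𝒢.Face, along 𝓛.diagram (𝒢.σ H) ⟶ along 𝓛.diagram (𝒢.τ H)}
    (Γ : ∀ H, 𝓛.cell H ⟶ β H) : {P : Quiver.Path 𝒢.s 𝒢.t} → (d : 𝒢.Order P) →
      (𝓛.run d ⟶ (𝓛.withCells β).run d)
  | _, .nil => 𝟙 _
  | _, .cons _ h d => 𝓛.stepCell₂ Γ h ▷ 𝓛.run d ≫ (𝓛.withCells β).stepCell h ◁ run₂ Γ d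

/-- The components `Γ*_X` of the transformation induced by 3-cells `Γ` between face labels. -/
noncomputable def star {β : ∀ H : 𝒢.Face, along 𝓛.diagram (𝒢.σ H) ⟶ along 𝓛.diagram (𝒢.τ H)}
    (Γ : ∀ H, 𝓛.cell H ⟶ β H) (X : 𝒢.C) :
    𝓛.functor.obj X ⟶ (𝓛.withCells β).functor.obj X :=
  𝓛.run₂ Γ X.as.order

variable {F G : 𝒢.Face} (h : Glueable F G)

/-- The pasting `α_G.α_F` of the labels of `F` and `G`: first `α_F`, then `α_G`, each whiskered by
the 1-cells that lie between the boundary of the face and the boundary of `F#G`. -/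
noncomputable def pasting : along 𝓛.diagram h.top ⟶ along 𝓛.diagram h.bottom :=
  plug (f' := along 𝓛.diagram (h.glue.mF.comp ((𝒢.τ F).comp h.glue.nF)))
    (along 𝓛.diagram h.glue.mF) (𝓛.cell F) (along 𝓛.diagram h.glue.nF)
    (by rw [Glueable.top, along_comp, along_comp]) (by rw [along_comp, along_comp]) ≫
  plug (along 𝓛.diagram h.glue.mG) (𝓛.cell G) (along 𝓛.diagram h.glue.nG)
    (by rw [h.glue.eq, along_comp, along_comp]) (by rw [Glueable.bottom, along_comp, along_comp])

/-- Labels for the faces of `𝒢^{FG}`: `α'` on `F#G`, the labels of `𝓛` elsewhere. -/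
def gluedCell (α' : along 𝓛.diagram h.top ⟶ along 𝓛.diagram h.bottom) :
    ∀ H : h.scheme.Face, along 𝓛.diagram (h.scheme.σ H) ⟶ along 𝓛.diagram (h.scheme.τ H)
  | none => α'
  | some H => 𝓛.cell H.1

/-- The labelling `𝓛_FG` of `𝒢^{FG}`, with `α_G.α_F` on the face `F#G`. -/
noncomputable def glue : Labelling h.scheme K where
  diagram := 𝓛.diagram
  cell := 𝓛.gluedCell h (𝓛.pasting h)

/-- A 3-cell on the face `F#G` and identity 3-cells on the other faces. -/
noncomputable def gluedCell₂ {α' : along 𝓛.diagram h.top ⟶ along 𝓛.diagram h.bottom}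
    (Θ : 𝓛.pasting h ⟶ α') : ∀ H : h.scheme.Face, (𝓛.glue h).cell H ⟶ 𝓛.gluedCell h α' H
  | none => Θ
  | some _ => 𝟙 _

/-- The labelling `𝓛^{α'}_{FG}` of `𝒢^{FG}`, with `α'` on the face `F#G`. -/
noncomputable def glueWith (α' : along 𝓛.diagram h.top ⟶ along 𝓛.diagram h.bottom) :
    Labelling h.scheme K :=
  (𝓛.glue h).withCells (𝓛.gluedCell h α')

/-- The component at `X` of the transformation `𝓛_FG ⇒ 𝓛^{α'}_{FG}` induced by a 3-cell
`α_G.α_F ⇛ α'` acting on the face `F#G`. -/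
noncomputable def gluedStar {α' : along 𝓛.diagram h.top ⟶ along 𝓛.diagram h.bottom}
    (Θ : 𝓛.pasting h ⟶ α') (X : h.scheme.C) :
    (𝓛.glue h).functor.obj X ⟶ (𝓛.glueWith h α').functor.obj X :=
  (𝓛.glue h).star (𝓛.gluedCell₂ h Θ) X

end Labelling

end GrayPasting

/-! The groupoids `𝒞` have exactly one morphism between any two objects. Hence `S_FG` is fully
faithful for free, and it is essentially surjective as soon as its source has an object. The
hypothesis `F ⋖ G` supplies one: an ordering `UFGW`, read as `U(F#G)W`.

The equality of `𝓛_FG` with `𝓛 ∘ S_FG` holds on objects because whiskering by 1-cells is strictly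
functorial: the whiskered `α_G.α_F` is equal, not just isomorphic, to the whiskered `α_F` followed
by the whiskered `α_G` (`glue_stepCell_none`, `run_expandOrder`). On morphisms, comparison 3-cells
are generated by exchanges of consecutive faces and are unique (`Chain.unique`), so it suffices that
every exchange in `𝒢^{FG}` is a chain of exchanges in `𝒢`. Only an exchange of `F#G` with another
face `H` needs an argument. The axioms `γ_comp_left` and `γ_comp_right` decompose the interchanger
of a composite 2-cell, so `H` is exchanged with `F` and `G` one after the other (`swap_none_heq`,
`swap_none_heq'`, `Chain.exists_expandOrder`).

For the last claim, interchangers are natural in both arguments, so 3-cells placed on the faces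
commute with each exchange, hence with all comparison 3-cells (`swap_naturality`,
`star_naturality`). The naturality square of the transformation is then a pasting of three squares:
the image under `𝓛` of a square in `𝒞_𝒢`, which commutes as all squares there do; the naturality of
the equality of functors; and the naturality of `Π*`.

Composites of labels along a path are only propositionally equal to the 1-cells in the axioms. The
bridging lemmas are therefore stated with `≍` and take the identifications as hypotheses, which are
then substituted away. -/

namespace GrayPasting
universe w₃ w₂ v u u' v' w
open GrayCategory

/-! ### Exchanges of consecutive cells in a bicategory -/

section Bicategorical

variable {B : Type*} [Bicategory B]

theorem comp_heq_comp {C : Type*} [Category C] {a a' b b' c c' : C} (ha : a = a') (hb : b = b')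
    (hc : c = c') {f : a ⟶ b} {f' : a' ⟶ b'} {g : b ⟶ c} {g' : b' ⟶ c'} (hf : f ≍ f')
    (hg : g ≍ g') : f ≫ g ≍ f' ≫ g' := by
  subst ha hb hc; cases hf; cases hg; rfl

/-- Inverses on opposite sides of one morphism agree. This carries a result about an exchange over
to the reverse exchange, in `exists_chain_swap_symm`. -/
theorem heq_of_comp_eq_id {C : Type*} [Category C] {a a' b b' : C} (ha : a = a') (hb : b = b')
    {f : a ⟶ b} {f' : a' ⟶ b'} {g : b ⟶ a} {g' : b' ⟶ a'} (hf : f ≍ f') (h : g ≫ f = 𝟙 _)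
    (h' : f' ≫ g' = 𝟙 _) : g ≍ g' := by
  subst ha hb; cases hf
  refine heq_of_eq ?_
  rw [← Category.comp_id g, ← h', ← Category.assoc, h, Category.id_comp]

theorem square_inv {C : Type*} [Category C] {a b a' b' : C} (f : a ≅ b) (f' : a' ≅ b')
    {g : a ⟶ a'} {k : b ⟶ b'} (h : f.inv ≫ g = k ≫ f'.inv) : f.hom ≫ k = g ≫ f'.hom := by
  rw [Iso.inv_comp_eq, ← Category.assoc, Iso.eq_comp_inv] at h
  exact h.symm

theorem square_comp {C : Type*} [Category C] {a b c a' b' c' : C} {f : a ⟶ b} {f₁ : b ⟶ c}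
    {f' : a' ⟶ b'} {f₁' : b' ⟶ c'} {x : a ⟶ a'} {y : b ⟶ b'} {z : c ⟶ c'}
    (h : f ≫ y = x ≫ f') (h' : f₁ ≫ z = y ≫ f₁') : (f ≫ f₁) ≫ z = x ≫ f' ≫ f₁' := by
  rw [Category.assoc, h', ← Category.assoc, h, Category.assoc]

theorem square_whisker {a b c : B} {f f' : a ⟶ b} (φ : f ⟶ f') {g g₁ g' g₁' : b ⟶ c} {η : g ⟶ g₁}
    {η' : g' ⟶ g₁'} {x : g ⟶ g'} {y : g₁ ⟶ g₁'} (h : η ≫ y = x ≫ η') :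
    f ◁ η ≫ φ ▷ g₁ ≫ f' ◁ y = (φ ▷ g ≫ f' ◁ x) ≫ f' ◁ η' := by
  rw [whisker_exchange_assoc, Category.assoc, ← whiskerLeft_comp, ← whiskerLeft_comp, h]

theorem swap_whisker_inv {P P₀ P₁ W T : B} {f : P ⟶ P₀} {h : P ⟶ P₁} {fh : P₀ ⟶ W} {hf : P₁ ⟶ W}
    (s : W ⟶ T) (sw : f ≫ fh ≅ h ≫ hf) :
    ((α_ _ _ _).inv ≫ sw.inv ▷ s ≫ (α_ _ _ _).hom) ≫
      (α_ _ _ _).inv ≫ sw.hom ▷ s ≫ (α_ _ _ _).hom = 𝟙 _ := by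
  simp

theorem swap_whisker_heq {P P₀ P₁ W T : B} {f : P ⟶ P₀} {h : P ⟶ P₁} {fh : P₀ ⟶ W}
    {hf : P₁ ⟶ W} {s s' : W ⟶ T} (hs : s = s') (sw : f ≫ fh ⟶ h ≫ hf) :
    (α_ _ _ _).inv ≫ sw ▷ s ≫ (α_ _ _ _).hom ≍ (α_ _ _ _).inv ≫ sw ▷ s' ≫ (α_ _ _ _).hom := by
  subst hs
  rfl

theorem whiskerLeft_heq {x y z : B} (f : x ⟶ y) {g g' h h' : y ⟶ z} (hg : g = h) (hg' : g' = h')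
    {η : g ⟶ g'} {θ : h ⟶ h'} (e : η ≍ θ) : f ◁ η ≍ f ◁ θ := by
  subst hg hg'; cases e; rfl

/-- The associators are identities in a strict bicategory. This is needed where a single step across
`F#G` becomes a step across `F` and a step across `G`. -/
theorem comp_whiskerLeft_heq [Bicategory.Strict B] {w x y z : B} (f : w ⟶ x) (g : x ⟶ y)
    {k : w ⟶ y} (hk : k = f ≫ g) {h h' : y ⟶ z} (η : h ⟶ h') : k ◁ η ≍ f ◁ g ◁ η := by
  subst hk
  rw [comp_whiskerLeft]
  simp only [Bicategory.Strict.associator_eqToIso, eqToIso.hom, eqToIso.inv]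
  exact (eqToHom_comp_heq _ _).trans (comp_eqToHom_heq _ _)

/-- Exchanging `x₁ ≫ x₂` with `z` amounts to exchanging first `x₂`, then `x₁` with `z`. -/
theorem swap_comp_left_heq [Bicategory.Strict B] {f₀ f₁ f₂ g₀ g₁ g₂ t : B} {x₁ : f₀ ⟶ f₁}
    {x₂ : f₁ ⟶ f₂} {x : f₀ ⟶ f₂} {y₁ : g₀ ⟶ g₁} {y₂ : g₁ ⟶ g₂} {y : g₀ ⟶ g₂} {z₀ : f₀ ⟶ g₀}
    {z₁ : f₁ ⟶ g₁} {z₂ : f₂ ⟶ g₂} (hx : x = x₁ ≫ x₂) (hy : y = y₁ ≫ y₂)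
    {s : x ≫ z₂ ⟶ z₀ ≫ y} {s₁ : x₁ ≫ z₁ ⟶ z₀ ≫ y₁} {s₂ : x₂ ≫ z₂ ⟶ z₁ ≫ y₂}
    (hs : s ≍ (α_ x₁ x₂ z₂).hom ≫ x₁ ◁ s₂ ≫ (α_ x₁ z₁ y₂).inv ≫ s₁ ▷ y₂ ≫ (α_ z₀ y₁ y₂).hom)
    {r r' : g₂ ⟶ t} (hr : r = r') :
    (α_ _ _ _).inv ≫ s ▷ r ≫ (α_ _ _ _).hom ≍
      x₁ ◁ ((α_ _ _ _).inv ≫ s₂ ▷ r' ≫ (α_ _ _ _).hom) ≫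
        (α_ _ _ _).inv ≫ s₁ ▷ (y₂ ≫ r') ≫ (α_ _ _ _).hom := by
  subst hx hy hr; cases hs
  -- By coherence the two sides differ by an associator at each end. By strictness both are
  -- `eqToHom`s, which `≍` ignores.
  have : x₁ ◁ ((α_ _ _ _).inv ≫ s₂ ▷ r ≫ (α_ _ _ _).hom) ≫
        (α_ _ _ _).inv ≫ s₁ ▷ (y₂ ≫ r) ≫ (α_ _ _ _).hom =
      (α_ _ _ _).inv ≫ ((α_ _ _ _).inv ≫ ((α_ x₁ x₂ z₂).hom ≫ x₁ ◁ s₂ ≫ (α_ x₁ z₁ y₂).inv ≫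
        s₁ ▷ y₂ ≫ (α_ z₀ y₁ y₂).hom) ▷ r ≫ (α_ _ _ _).hom) ≫ z₀ ◁ (α_ _ _ _).hom := by
    bicategory
  rw [this]
  have e : z₀ ◁ (α_ y₁ y₂ r).hom = eqToHom (by simp) := by
    simp [Bicategory.Strict.associator_eqToIso]
  rw [e, Bicategory.Strict.associator_eqToIso x₁ x₂ (z₂ ≫ r)]
  simp only [eqToIso.inv]
  exact ((eqToHom_comp_heq _ _).trans (comp_eqToHom_heq _ _)).symm

/-- Exchanging `z` with `x₁ ≫ x₂` amounts to exchanging `z` first with `x₁`, then with `x₂`. -/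
theorem swap_comp_right_heq [Bicategory.Strict B] {f₀ f₁ f₂ g₀ g₁ g₂ t : B} {x₁ : f₀ ⟶ f₁}
    {x₂ : f₁ ⟶ f₂} {x : f₀ ⟶ f₂} {y₁ : g₀ ⟶ g₁} {y₂ : g₁ ⟶ g₂} {y : g₀ ⟶ g₂} {z₀ : f₀ ⟶ g₀}
    {z₁ : f₁ ⟶ g₁} {z₂ : f₂ ⟶ g₂} (hx : x = x₁ ≫ x₂) (hy : y = y₁ ≫ y₂)
    {s : z₀ ≫ y ⟶ x ≫ z₂} {s₁ : z₀ ≫ y₁ ⟶ x₁ ≫ z₁} {s₂ : z₁ ≫ y₂ ⟶ x₂ ≫ z₂}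
    (hs : s ≍ (α_ z₀ y₁ y₂).inv ≫ s₁ ▷ y₂ ≫ (α_ x₁ z₁ y₂).hom ≫ x₁ ◁ s₂ ≫ (α_ x₁ x₂ z₂).inv)
    {r r' : g₂ ⟶ t} (hr : r = r') :
    (α_ _ _ _).inv ≫ s ▷ r ≫ (α_ _ _ _).hom ≍
      ((α_ _ _ _).inv ≫ s₁ ▷ (y₂ ≫ r') ≫ (α_ _ _ _).hom) ≫
        x₁ ◁ ((α_ _ _ _).inv ≫ s₂ ▷ r' ≫ (α_ _ _ _).hom) := by
  subst hx hy hr; cases hs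
  -- As for the composite on the other side: only associators at the two ends remain, and these are
  -- `eqToHom`s.
  have : ((α_ _ _ _).inv ≫ s₁ ▷ (y₂ ≫ r) ≫ (α_ _ _ _).hom) ≫
        x₁ ◁ ((α_ _ _ _).inv ≫ s₂ ▷ r ≫ (α_ _ _ _).hom) =
      z₀ ◁ (α_ _ _ _).inv ≫ ((α_ _ _ _).inv ≫ ((α_ z₀ y₁ y₂).inv ≫ s₁ ▷ y₂ ≫
        (α_ x₁ z₁ y₂).hom ≫ x₁ ◁ s₂ ≫ (α_ x₁ x₂ z₂).inv) ▷ r ≫ (α_ _ _ _).hom) ≫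
          (α_ _ _ _).hom := by
    bicategory
  rw [this]
  have e : z₀ ◁ (α_ y₁ y₂ r).inv = eqToHom (by simp) := by
    simp [Bicategory.Strict.associator_eqToIso]
  rw [e, Bicategory.Strict.associator_eqToIso x₁ x₂ (z₂ ≫ r)]
  simp only [eqToIso.hom]
  exact ((eqToHom_comp_heq _ _).trans (comp_eqToHom_heq _ _)).symm

/-- Naturality of an exchange of consecutive cells, whiskered by the remaining ones. -/
theorem swap_whisker_naturality {P P₀ P₁ W T : B} {f f' : P ⟶ P₀} {h h' : P ⟶ P₁}
    {fh fh' : P₀ ⟶ W} {hf hf' : P₁ ⟶ W} {r r' : W ⟶ T} (φ : f ⟶ f') (ψ : h ⟶ h')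
    (φ₁ : hf ⟶ hf') (ψ₁ : fh ⟶ fh') (ρ : r ⟶ r') (s : f ≫ fh ⟶ h ≫ hf)
    (s' : f' ≫ fh' ⟶ h' ≫ hf')
    (hs : s ≫ ψ ▷ hf ≫ h' ◁ φ₁ = (φ ▷ fh ≫ f' ◁ ψ₁) ≫ s') :
    ((α_ _ _ _).inv ≫ s ▷ r ≫ (α_ _ _ _).hom) ≫ ψ ▷ (hf ≫ r) ≫ h' ◁ (φ₁ ▷ r ≫ hf' ◁ ρ) =
      (φ ▷ (fh ≫ r) ≫ f' ◁ (ψ₁ ▷ r ≫ fh' ◁ ρ)) ≫ (α_ _ _ _).inv ≫ s' ▷ r' ≫ (α_ _ _ _).hom := by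
  calc _ = 𝟙 _ ⊗≫ (s ≫ ψ ▷ hf ≫ h' ◁ φ₁) ▷ r ⊗≫ h' ◁ hf' ◁ ρ := by bicategory
    -- The hypothesis `hs` moves the exchange past the 3-cells of the two faces. It then remains to
    -- move it past `ρ`, which acts on the later cells and so commutes with it by
    -- `whisker_exchange`.
    _ = 𝟙 _ ⊗≫ (φ ▷ fh ≫ f' ◁ ψ₁) ▷ r ⊗≫ (s' ▷ r ≫ (h' ≫ hf') ◁ ρ) ⊗≫ 𝟙 _ := by
      rw [hs]; bicategory
    _ = _ := by rw [← whisker_exchange s' ρ]; bicategory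

end Bicategorical

/-! ### Naturality and composition of the interchanger, up to heterogeneous equality -/

variable {K : Type u} [GrayCategory.{w₃, w₂, v} K]

/-- The interchanger is natural in both arguments. -/
theorem γ_naturality {X Y Z : K} {a a' : X ⟶ Y} {α α' : a ⟶ a'} (Γ : α ⟶ α') {n n' : Y ⟶ Z}
    {β β' : n ⟶ n'} (Θ : β ⟶ β') :
    (γ α β).hom ≫ wL₂ a Θ ▷ wR α n' ≫ wL a β' ◁ wR₂ Γ n' =
      (wR₂ Γ n ▷ wL a' β ≫ wR α' n ◁ wL₂ a' Θ) ≫ (γ α' β').hom := by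
  rw [Category.assoc, γ_naturality_right, ← Category.assoc, ← Category.assoc,
    γ_naturality_left, Category.assoc, Category.assoc, whisker_exchange]

/-- The steps across faces live between labels of whole paths, which agree with the composites in
the axiom only propositionally. Listing every identification as a hypothesis allows all of them to
be substituted at once. -/
theorem γ_naturality_of_heq {X Y Z : K} {a a' : X ⟶ Y} {α α' : a ⟶ a'} (Γ : α ⟶ α')
    {n n' : Y ⟶ Z} {β β' : n ⟶ n'} (Θ : β ⟶ β') {f₀₀ f₁₀ f₀₁ f₁₁ : X ⟶ Z}
    (e₀₀ : f₀₀ = a ≫ n) (e₁₀ : f₁₀ = a' ≫ n) (e₀₁ : f₀₁ = a ≫ n') (e₁₁ : f₁₁ = a' ≫ n')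
    {x₀ x₀' : f₀₀ ⟶ f₁₀} {x₁ x₁' : f₀₁ ⟶ f₁₁} {y₀ y₀' : f₀₀ ⟶ f₀₁} {y₁ y₁' : f₁₀ ⟶ f₁₁}
    (hx₀ : x₀ ≍ wR α n) (hx₀' : x₀' ≍ wR α' n) (hx₁ : x₁ ≍ wR α n') (hx₁' : x₁' ≍ wR α' n')
    (hy₀ : y₀ ≍ wL a β) (hy₀' : y₀' ≍ wL a β') (hy₁ : y₁ ≍ wL a' β) (hy₁' : y₁' ≍ wL a' β')
    {ξ₀ : x₀ ⟶ x₀'} {ξ₁ : x₁ ⟶ x₁'} {υ₀ : y₀ ⟶ y₀'} {υ₁ : y₁ ⟶ y₁'}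
    (hξ₀ : ξ₀ ≍ wR₂ Γ n) (hξ₁ : ξ₁ ≍ wR₂ Γ n') (hυ₀ : υ₀ ≍ wL₂ a Θ) (hυ₁ : υ₁ ≍ wL₂ a' Θ)
    {s : x₀ ≫ y₁ ⟶ y₀ ≫ x₁} {s' : x₀' ≫ y₁' ⟶ y₀' ≫ x₁'} (hs : s ≍ (γ α β).hom)
    (hs' : s' ≍ (γ α' β').hom) :
    s ≫ υ₀ ▷ x₁ ≫ y₀' ◁ ξ₁ = (ξ₀ ▷ y₁ ≫ x₀' ◁ υ₁) ≫ s' := by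
  subst e₀₀ e₁₀ e₀₁ e₁₁
  cases hx₀; cases hx₀'; cases hx₁; cases hx₁'
  cases hy₀; cases hy₀'; cases hy₁; cases hy₁'
  cases hξ₀; cases hξ₁; cases hυ₀; cases hυ₁; cases hs; cases hs'
  exact γ_naturality Γ Θ

/-- The axiom `γ_comp_left` in the form used for steps across faces: `α₁` and `α₂` will be the two
factors of `α_G.α_F`, and `β` the label of a face to their right. -/
theorem γ_comp_left_of_heq {X Y Z : K} {a₀ a₁ a₂ : X ⟶ Y} (α₁ : a₀ ⟶ a₁) (α₂ : a₁ ⟶ a₂)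
    {n n' : Y ⟶ Z} (β : n ⟶ n') {f₀ f₁ f₂ g₀ g₁ g₂ : X ⟶ Z}
    (e₀ : f₀ = a₀ ≫ n) (e₁ : f₁ = a₁ ≫ n) (e₂ : f₂ = a₂ ≫ n)
    (e₀' : g₀ = a₀ ≫ n') (e₁' : g₁ = a₁ ≫ n') (e₂' : g₂ = a₂ ≫ n')
    {x₁ : f₀ ⟶ f₁} {x₂ : f₁ ⟶ f₂} {x : f₀ ⟶ f₂} {y₁ : g₀ ⟶ g₁} {y₂ : g₁ ⟶ g₂} {y : g₀ ⟶ g₂}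
    {z₀ : f₀ ⟶ g₀} {z₁ : f₁ ⟶ g₁} {z₂ : f₂ ⟶ g₂} (hx : x = x₁ ≫ x₂) (hy : y = y₁ ≫ y₂)
    {s : x ≫ z₂ ⟶ z₀ ≫ y} {s₁ : x₁ ≫ z₁ ⟶ z₀ ≫ y₁} {s₂ : x₂ ≫ z₂ ⟶ z₁ ≫ y₂}
    (hx₁ : x₁ ≍ wR α₁ n) (hx₂ : x₂ ≍ wR α₂ n) (hy₁ : y₁ ≍ wR α₁ n') (hy₂ : y₂ ≍ wR α₂ n')
    (hz₀ : z₀ ≍ wL a₀ β) (hz₁ : z₁ ≍ wL a₁ β) (hz₂ : z₂ ≍ wL a₂ β)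
    (hs₁ : s₁ ≍ (γ α₁ β).hom) (hs₂ : s₂ ≍ (γ α₂ β).hom) (hs : s ≍ (γ (α₁ ≫ α₂) β).hom) :
    s ≍ (α_ x₁ x₂ z₂).hom ≫ x₁ ◁ s₂ ≫ (α_ x₁ z₁ y₂).inv ≫ s₁ ▷ y₂ ≫ (α_ z₀ y₁ y₂).hom := by
  subst e₀ e₁ e₂ e₀' e₁' e₂'
  cases hx₁; cases hx₂; cases hy₁; cases hy₂; cases hz₀; cases hz₁; cases hz₂
  cases hs₁; cases hs₂
  exact hs.trans (γ_comp_left α₁ α₂ β)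

/-- The mirror image, from `γ_comp_right`: the face labelled by `β` lies to the left of the
composite. -/
theorem γ_comp_right_of_heq {X Y Z : K} {a₀ a₁ a₂ : Y ⟶ Z} (α₁ : a₀ ⟶ a₁) (α₂ : a₁ ⟶ a₂)
    {n n' : X ⟶ Y} (β : n ⟶ n') {f₀ f₁ f₂ g₀ g₁ g₂ : X ⟶ Z}
    (e₀ : f₀ = n ≫ a₀) (e₁ : f₁ = n ≫ a₁) (e₂ : f₂ = n ≫ a₂)
    (e₀' : g₀ = n' ≫ a₀) (e₁' : g₁ = n' ≫ a₁) (e₂' : g₂ = n' ≫ a₂)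
    {x₁ : f₀ ⟶ f₁} {x₂ : f₁ ⟶ f₂} {x : f₀ ⟶ f₂} {y₁ : g₀ ⟶ g₁} {y₂ : g₁ ⟶ g₂} {y : g₀ ⟶ g₂}
    {z₀ : f₀ ⟶ g₀} {z₁ : f₁ ⟶ g₁} {z₂ : f₂ ⟶ g₂} (hx : x = x₁ ≫ x₂) (hy : y = y₁ ≫ y₂)
    {s : z₀ ≫ y ⟶ x ≫ z₂} {s₁ : z₀ ≫ y₁ ⟶ x₁ ≫ z₁} {s₂ : z₁ ≫ y₂ ⟶ x₂ ≫ z₂}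
    (hx₁ : x₁ ≍ wL n α₁) (hx₂ : x₂ ≍ wL n α₂) (hy₁ : y₁ ≍ wL n' α₁) (hy₂ : y₂ ≍ wL n' α₂)
    (hz₀ : z₀ ≍ wR β a₀) (hz₁ : z₁ ≍ wR β a₁) (hz₂ : z₂ ≍ wR β a₂)
    (hs₁ : s₁ ≍ (γ β α₁).hom) (hs₂ : s₂ ≍ (γ β α₂).hom) (hs : s ≍ (γ β (α₁ ≫ α₂)).hom) :
    s ≍ (α_ z₀ y₁ y₂).inv ≫ s₁ ▷ y₂ ≫ (α_ x₁ z₁ y₂).hom ≫ x₁ ◁ s₂ ≫ (α_ x₁ x₂ z₂).inv := by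
  subst e₀ e₁ e₂ e₀' e₁' e₂'
  cases hx₁; cases hx₂; cases hy₁; cases hy₂; cases hz₀; cases hz₁; cases hz₂
  cases hs₁; cases hs₂
  exact hs.trans (γ_comp_right β α₁ α₂)

end GrayPasting

/-! ### 3-cells between face labels commute with comparison 3-cells -/

namespace GrayPasting
universe w₃ w₂ v u u' v' w
open GrayCategory

theorem plug₂_heq {K : Type u} [GrayCategory.{w₃, w₂, v} K] {W X Y Z : K} {f f' : W ⟶ Z}
    (A : W ⟶ X) {a a' : X ⟶ Y} {α α' : a ⟶ a'} (Γ : α ⟶ α') (B : Y ⟶ Z) (h : f = A ≫ a ≫ B)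
    (h' : f' = A ≫ a' ≫ B) : plug₂ A Γ B h h' ≍ wL₂ A (wR₂ Γ B) := by
  subst h h'
  exact whisker_id_heq _

variable {V : Type u} [Quiver.{v} V] {𝒢 : PastingScheme.{v, u, w} V}

namespace PastingScheme

/-- A way of moving a path down to `q` is determined by the faces it crosses, in order. -/
theorem Order.list_injective : ∀ {P : Quiver.Path 𝒢.s 𝒢.t} {d e : 𝒢.Order P},
    d.list = e.list → d = e
  | _, .nil, e, h => by
    cases e with
    | nil => rfl
    | cons => simp [Order.list] at h
  | _, .cons F st d, e, h => by
    cases e with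
    | nil => simp [Order.list] at h
    | cons G st' e =>
      simp only [Order.list, List.cons.injEq] at h
      obtain ⟨rfl, h⟩ := h
      obtain rfl := step_unique st st'
      rw [Order.list_injective h]

end PastingScheme

variable {K : Type u'} [GrayCategory.{w₃, w₂, v'} K] (𝓛 : Labelling 𝒢 K)

namespace Labelling
open PastingScheme

variable {F G : 𝒢.Face} {P PF PG W : Quiver.Path 𝒢.s 𝒢.t}
variable {β : ∀ H : 𝒢.Face, along 𝓛.diagram (𝒢.σ H) ⟶ along 𝓛.diagram (𝒢.τ H)}
  (Γ : ∀ H, 𝓛.cell H ⟶ β H)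

/-- Acyclicity makes the decomposition of `P` around `σ F` unique, so the decomposition chosen in
`stepCell₂` may be replaced by any given one. -/
theorem stepCell₂_heq {P P' : Quiver.Path 𝒢.s 𝒢.t} (h : 𝒢.Step F P P')
    (A : Quiver.Path 𝒢.s (𝒢.fs F)) (B : Quiver.Path (𝒢.ft F) 𝒢.t)
    (hP : P = A.comp ((𝒢.σ F).comp B))
    {x : 𝓛.diagram.obj 𝒢.s ⟶ 𝓛.diagram.obj (𝒢.fs F)}
    {y : 𝓛.diagram.obj (𝒢.ft F) ⟶ 𝓛.diagram.obj 𝒢.t}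
    (hx : along 𝓛.diagram A = x) (hy : along 𝓛.diagram B = y) :
    𝓛.stepCell₂ Γ h ≍ wL₂ x (wR₂ (Γ F) y) := by
  have h₁ := h.choose_spec.choose_spec.1
  obtain ⟨h₂, h₃⟩ := comp_cancel 𝒢.acyclic (h₁.symm.trans hP)
  obtain ⟨-, h₄⟩ := comp_cancel 𝒢.acyclic h₃
  subst hx hy h₂
  subst h₄
  exact plug₂_heq _ _ _ _ _

/-- The interchanger `γ` expects its left cell in the form `wR _ y` and its right cell in the form
`wL x _`. This lemma and the next three regroup two-sided whiskerings accordingly. -/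
theorem stepCell_heq_wR (h : 𝒢.Step F P PF) (A : Quiver.Path 𝒢.s (𝒢.fs F))
    (B : Quiver.Path (𝒢.ft F) 𝒢.t) (hP : P = A.comp ((𝒢.σ F).comp B))
    {y : 𝓛.diagram.obj (𝒢.ft F) ⟶ 𝓛.diagram.obj 𝒢.t} (hy : along 𝓛.diagram B = y) :
    𝓛.stepCell h ≍ wR (wL (along 𝓛.diagram A) (𝓛.cell F)) y :=
  (𝓛.stepCell_heq h A B hP rfl hy).trans (wM_assoc _ _ _).symm

theorem stepCell_heq_wL (h : 𝒢.Step F P PF) (A : Quiver.Path 𝒢.s (𝒢.fs F))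
    (B : Quiver.Path (𝒢.ft F) 𝒢.t) (hP : P = A.comp ((𝒢.σ F).comp B)) {X : K}
    {x : 𝓛.diagram.obj 𝒢.s ⟶ X} {y : X ⟶ 𝓛.diagram.obj (𝒢.fs F)}
    (hx : along 𝓛.diagram A = x ≫ y) :
    𝓛.stepCell h ≍ wL x (wL y (wR (𝓛.cell F) (along 𝓛.diagram B))) :=
  (𝓛.stepCell_heq h A B hP hx rfl).trans (wL_assoc _ _ _)

theorem stepCell₂_heq_wR (h : 𝒢.Step F P PF) (A : Quiver.Path 𝒢.s (𝒢.fs F))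
    (B : Quiver.Path (𝒢.ft F) 𝒢.t) (hP : P = A.comp ((𝒢.σ F).comp B))
    {y : 𝓛.diagram.obj (𝒢.ft F) ⟶ 𝓛.diagram.obj 𝒢.t} (hy : along 𝓛.diagram B = y) :
    𝓛.stepCell₂ Γ h ≍ wR₂ (wL₂ (along 𝓛.diagram A) (Γ F)) y :=
  (𝓛.stepCell₂_heq Γ h A B hP rfl hy).trans (wM₂_assoc _ _ _).symm

theorem stepCell₂_heq_wL (h : 𝒢.Step F P PF) (A : Quiver.Path 𝒢.s (𝒢.fs F))
    (B : Quiver.Path (𝒢.ft F) 𝒢.t) (hP : P = A.comp ((𝒢.σ F).comp B)) {X : K}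
    {x : 𝓛.diagram.obj 𝒢.s ⟶ X} {y : X ⟶ 𝓛.diagram.obj (𝒢.fs F)}
    (hx : along 𝓛.diagram A = x ≫ y) :
    𝓛.stepCell₂ Γ h ≍ wL₂ x (wL₂ y (wR₂ (Γ F) (along 𝓛.diagram B))) :=
  (𝓛.stepCell₂_heq Γ h A B hP hx rfl).trans (wL₂_assoc _ _ _)

/-- By `γ_assoc_middle` the 1-cell in front of `F` is absorbed into the first argument. The exchange
becomes a bare `γ`, to which the axioms apply directly. -/
theorem swap_heq_γ (hne : F ≠ G) (hF : 𝒢.Step F P PF) (hFG : 𝒢.Step G PF W)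
    (hG : 𝒢.Step G P PG) (hGF : 𝒢.Step F PG W)
    (A : Quiver.Path 𝒢.s (𝒢.fs F)) (B : Quiver.Path (𝒢.ft F) (𝒢.fs G))
    (C : Quiver.Path (𝒢.ft G) 𝒢.t) (hP : P = A.comp ((𝒢.σ F).comp (B.comp ((𝒢.σ G).comp C)))) :
    (𝓛.swap hne hF hFG hG hGF).hom ≍
      (γ (wL (along 𝓛.diagram A) (𝓛.cell F))
        (wL (along 𝓛.diagram B) (wR (𝓛.cell G) (along 𝓛.diagram C)))).hom :=
  (𝓛.swap_heq hne hF hFG hG hGF A B C hP rfl rfl rfl).trans (γ_assoc_middle _ _ _).symm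

/-- With `F` to the left of `G` the exchange is an interchanger and not its inverse. The claim is
its naturality with respect to `Γ F` and `Γ G`, each whiskered by the 1-cells around it. -/
theorem swap_naturality_of_left (hne : F ≠ G) (hF : 𝒢.Step F P PF) (hFG : 𝒢.Step G PF W)
    (hG : 𝒢.Step G P PG) (hGF : 𝒢.Step F PG W) (hl : Left F G P) :
    (𝓛.swap hne hF hFG hG hGF).hom ≫ 𝓛.stepCell₂ Γ hG ▷ 𝓛.stepCell hGF ≫
        (𝓛.withCells β).stepCell hG ◁ 𝓛.stepCell₂ Γ hGF =
      (𝓛.stepCell₂ Γ hF ▷ 𝓛.stepCell hFG ≫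
        (𝓛.withCells β).stepCell hF ◁ 𝓛.stepCell₂ Γ hFG) ≫
        ((𝓛.withCells β).swap hne hF hFG hG hGF).hom := by
  obtain ⟨A, B, C, hP⟩ := hl
  obtain ⟨h₁, h₂, h₃⟩ := left_states hF hFG hG hP
  refine γ_naturality_of_heq (wL₂ (along 𝓛.diagram A) (Γ F))
    (wL₂ (along 𝓛.diagram B) (wR₂ (Γ G) (along 𝓛.diagram C))) ?_ ?_ ?_ ?_
    (𝓛.stepCell_heq_wR hF A _ hP ?_) ((𝓛.withCells β).stepCell_heq_wR hF A _ hP ?_)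
    (𝓛.stepCell_heq_wR hGF A _ h₂ ?_) ((𝓛.withCells β).stepCell_heq_wR hGF A _ h₂ ?_)
    (𝓛.stepCell_heq_wL hG (A.comp ((𝒢.σ F).comp B)) C (by simp [hP]) ?_)
    ((𝓛.withCells β).stepCell_heq_wL hG (A.comp ((𝒢.σ F).comp B)) C (by simp [hP]) ?_)
    (𝓛.stepCell_heq_wL hFG (A.comp ((𝒢.τ F).comp B)) C (by simp [h₁]) ?_)
    ((𝓛.withCells β).stepCell_heq_wL hFG (A.comp ((𝒢.τ F).comp B)) C (by simp [h₁]) ?_)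
    (𝓛.stepCell₂_heq_wR Γ hF A _ hP ?_) (𝓛.stepCell₂_heq_wR Γ hGF A _ h₂ ?_)
    (𝓛.stepCell₂_heq_wL Γ hG (A.comp ((𝒢.σ F).comp B)) C (by simp [hP]) ?_)
    (𝓛.stepCell₂_heq_wL Γ hFG (A.comp ((𝒢.τ F).comp B)) C (by simp [h₁]) ?_)
    (𝓛.swap_heq_γ hne hF hFG hG hGF A B C hP)
    ((𝓛.withCells β).swap_heq_γ hne hF hFG hG hGF A B C hP)
  all_goals first
    | (simp only [hP, h₁, h₂, h₃, along_comp, Category.assoc]; done)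
    | exact along_comp _ _ _
    | exact (along_comp _ _ _).trans ((congrArg _ (along_comp _ _ _)).trans
        (Category.assoc _ _ _).symm)
    | exact (along_comp _ _ _).trans (congrArg _ (along_comp _ _ _))

theorem swap_naturality (hne : F ≠ G) (hF : 𝒢.Step F P PF) (hFG : 𝒢.Step G PF W)
    (hG : 𝒢.Step G P PG) (hGF : 𝒢.Step F PG W) :
    (𝓛.swap hne hF hFG hG hGF).hom ≫ 𝓛.stepCell₂ Γ hG ▷ 𝓛.stepCell hGF ≫
        (𝓛.withCells β).stepCell hG ◁ 𝓛.stepCell₂ Γ hGF =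
      (𝓛.stepCell₂ Γ hF ▷ 𝓛.stepCell hFG ≫
        (𝓛.withCells β).stepCell hF ◁ 𝓛.stepCell₂ Γ hFG) ≫
        ((𝓛.withCells β).swap hne hF hFG hG hGF).hom := by
  rcases left_or_left hne hF hG with hl | hl
  · exact 𝓛.swap_naturality_of_left Γ hne hF hFG hG hGF hl
  -- Here `G` is on the left, so the exchange is the inverse of an interchanger and its naturality
  -- square is read backwards.
  · have := 𝓛.swap_naturality_of_left Γ hne.symm hG hGF hF hFG hl
    rw [swap_symm 𝓛 hne hF, swap_symm (𝓛.withCells β) hne hF] at this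
    exact square_inv _ _ this

variable {𝓛} in
/-- The comparison 3-cells commute with 3-cells between the labels of the faces. -/
theorem Chain.exists_run₂_comp {d e : 𝒢.Order P} {φ : 𝓛.run d ⟶ 𝓛.run e} (h : 𝓛.Chain d e φ) :
    ∃ ψ, (𝓛.withCells β).Chain d e ψ ∧ φ ≫ 𝓛.run₂ Γ e = 𝓛.run₂ Γ d ≫ ψ := by
  induction h with
  | refl d => exact ⟨_, .refl d, (Category.id_comp _).trans (Category.comp_id _).symm⟩
  | trans _ _ ih ih' =>
    obtain ⟨ψ, hψ, e⟩ := ih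
    obtain ⟨ψ', hψ', e'⟩ := ih'
    exact ⟨_, hψ.trans hψ', square_comp e e'⟩
  | @cons F P P' st d d' φ _ ih =>
    obtain ⟨ψ, hψ, e⟩ := ih
    -- The 3-cell at the first face and the chain on the remaining faces act on different factors,
    -- so they commute by whisker exchange.
    exact ⟨_, hψ.cons st, square_whisker _ e⟩
  | swap hne f fg g gf d =>
    exact ⟨_, .swap hne f fg g gf d, swap_whisker_naturality _ _ _ _ _ _ _
      (𝓛.swap_naturality Γ hne f fg g gf)⟩

/-- Pushing a comparison 3-cell through `run₂` gives some chain for the new labels. Since chains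
with given ends are unique, it is the comparison 3-cell of the new labelling. -/
theorem star_naturality {X Y : 𝒢.C} (f : X ⟶ Y) :
    𝓛.functor.map f ≫ 𝓛.star Γ Y = 𝓛.star Γ X ≫ (𝓛.withCells β).functor.map f := by
  obtain ⟨ψ, hψ, e⟩ := (𝓛.compare_chain X.as Y.as).exists_run₂_comp Γ
  exact e.trans (congrArg (𝓛.run₂ Γ X.as.order ≫ ·)
    (hψ.unique ((𝓛.withCells β).compare_chain X.as Y.as)))

end Labelling
end GrayPasting

/-! ### Orders of the glued scheme, and the equivalence `S` -/

namespace GrayPasting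
universe w₃ w₂ v u u' v' w
open GrayCategory

variable {V : Type u} [Quiver.{v} V] {𝒢 : PastingScheme.{v, u, w} V}

namespace PastingScheme

variable {F G : 𝒢.Face} (h : Glueable F G)

/-- Crossing the face `F#G` amounts to crossing first `F`, then `G`. -/
theorem Glueable.exists_steps {P P' : Quiver.Path 𝒢.s 𝒢.t} (st : h.scheme.Step none P P') :
    ∃ P₁, 𝒢.Step F P P₁ ∧ 𝒢.Step G P₁ P' := by
  obtain ⟨(A : Quiver.Path 𝒢.s h.glue.src), (B : Quiver.Path h.glue.tgt 𝒢.t), hP, hP'⟩ := st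
  replace hP : P = A.comp (h.top.comp B) := hP
  replace hP' : P' = A.comp (h.bottom.comp B) := hP'
  exact ⟨A.comp ((h.glue.mF.comp ((𝒢.τ F).comp h.glue.nF)).comp B),
    ⟨A.comp h.glue.mF, h.glue.nF.comp B, by simp [hP, Glueable.top], by simp⟩,
    ⟨A.comp h.glue.mG, h.glue.nG.comp B, by simp [h.glue.eq], by simp [hP', Glueable.bottom]⟩⟩

/-- The way of moving a path down to `q` that crosses `F` and `G` instead of `F#G`. -/
noncomputable def Glueable.expandOrder {F G : 𝒢.Face} (h : Glueable F G) :
    {P : Quiver.Path h.scheme.s h.scheme.t} → h.scheme.Order P → 𝒢.Order P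
  | _, .nil => .nil
  | _, .cons none st d => .cons F (h.exists_steps st).choose_spec.1
      (.cons G (h.exists_steps st).choose_spec.2 (expandOrder h d))
  | _, .cons (some H) st d => .cons (𝒢 := 𝒢) H.1 st (expandOrder h d)

/-- The path between `F` and `G` is determined by `P`, so the steps chosen in `expandOrder` can be
replaced by any at hand. -/
theorem Glueable.expandOrder_none {P P₁ P' : Quiver.Path 𝒢.s 𝒢.t} (st : h.scheme.Step none P P')
    (d : h.scheme.Order P') (f : 𝒢.Step F P P₁) (g : 𝒢.Step G P₁ P') :
    h.expandOrder (.cons none st d) = .cons F f (.cons G g (h.expandOrder d)) := by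
  obtain rfl := step_unique f (h.exists_steps st).choose_spec.1
  rfl

theorem Glueable.expandOrder_list {P : Quiver.Path h.scheme.s h.scheme.t}
    (d : h.scheme.Order P) : (h.expandOrder d).list = d.list.flatMap h.unglue := by
  induction d with
  | nil => rfl
  | cons H st d ih =>
    cases H with
    | none => exact congrArg (fun l => F :: G :: l) ih
    | some H => exact congrArg (fun l => H.1 :: l) ih

/-- Both orders come from choices, but an order is determined by its list of faces, so comparing the
lists suffices. -/
theorem Glueable.expand_order (X : h.scheme.LinearExtension) :
    (h.expand X).order = h.expandOrder X.order := by
  refine Order.list_injective ((h.expand X).order_list.trans ?_)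
  refine (congrArg (fun l => l.flatMap h.unglue) X.order_list.symm).trans ?_
  exact (h.expandOrder_list X.order).symm

/-- A linear extension `U F G W` yields a linear extension `U (F#G) W`. -/
theorem Glueable.nonempty_linearExtension : Nonempty h.scheme.LinearExtension := by
  classical
  obtain ⟨X, U, W, hX⟩ := h.2
  have hnd : (U ++ F :: G :: W).Nodup := hX ▸ X.nodup
  have hpw : (U ++ F :: G :: W).Pairwise fun F G => ¬ 𝒢.Before G F := hX ▸ X.pairwise
  have hmem : ∀ H, H ∈ U ++ F :: G :: W := fun H => hX ▸ X.mem H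
  -- The partial map that discards `F` and `G` and reads every other face in the glued scheme. The
  -- outer `Option` is the partiality; the inner one belongs to the type of faces, where `none` is
  -- `F#G`. Thus `filterMap f` transports `U` and `W`.
  let f : 𝒢.Face → Option h.scheme.Face := fun H =>
    if hH : H ≠ F ∧ H ≠ G then some (some ⟨H, hH⟩) else none
  have hf : ∀ {H c}, f H = some c ↔ ∃ hH, c = some ⟨H, hH⟩ := by
    intro H c
    by_cases hH : H ≠ F ∧ H ≠ G
    · rw [show f H = some (some ⟨H, hH⟩) from dif_pos hH]
      exact ⟨fun e => ⟨hH, (Option.some.inj e).symm⟩, fun ⟨_, e⟩ => congrArg some e.symm⟩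
    · rw [show f H = none from dif_neg hH]
      exact ⟨fun e => (Option.some_ne_none _ e.symm).elim, fun ⟨hH', _⟩ => (hH hH').elim⟩
  have hinj : ∀ H H' c, c ∈ f H → c ∈ f H' → H = H' := by
    intro H H' c hc hc'
    obtain ⟨_, rfl⟩ := hf.1 hc
    obtain ⟨_, e⟩ := hf.1 hc'
    exact congrArg Subtype.val (Option.some.inj e)
  have hnone : ∀ l : List 𝒢.Face, none ∉ l.filterMap f := by
    intro l hl
    obtain ⟨H, -, e⟩ := List.mem_filterMap.1 hl
    obtain ⟨_, e⟩ := hf.1 e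
    cases e
  have hsub : ∀ l : List 𝒢.Face, l.Pairwise (fun F G => ¬ 𝒢.Before G F) →
      (l.filterMap f).Pairwise fun F G => ¬ h.scheme.Before G F := by
    intro l hl
    refine List.pairwise_filterMap.2 (hl.imp ?_)
    intro H H' hb c hc c' hc'
    obtain ⟨_, rfl⟩ := hf.1 hc
    obtain ⟨_, rfl⟩ := hf.1 hc'
    exact hb
  rw [List.nodup_append'] at hnd
  rw [List.pairwise_append, List.pairwise_cons, List.pairwise_cons] at hpw
  obtain ⟨hU, ⟨hF, hG, hW⟩, hUW⟩ := hpw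
  refine ⟨⟨U.filterMap f ++ List.cons (α := h.scheme.Face) none (W.filterMap f), ?_, ?_, ?_⟩⟩
  · rw [List.nodup_append']
    have hndW := (List.nodup_cons.1 (List.nodup_cons.1 hnd.2.1).2).2
    refine ⟨hnd.1.filterMap hinj, List.nodup_cons.2 ⟨hnone _, hndW.filterMap hinj⟩, ?_⟩
    intro c hc hc'
    rcases List.mem_cons.1 hc' with rfl | hc'
    · exact hnone _ hc
    · obtain ⟨H, hH, e⟩ := List.mem_filterMap.1 hc
      obtain ⟨H', hH', e'⟩ := List.mem_filterMap.1 hc'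
      obtain rfl := hinj _ _ _ e e'
      exact hnd.2.2 hH (by simp [hH'])
  · rintro (_ | H)
    · exact List.mem_append_right _ List.mem_cons_self
    · have e : f H.1 = some (some H) := hf.2 ⟨H.2, rfl⟩
      have := hmem H.1
      simp only [List.mem_append, List.mem_cons, H.2.1, H.2.2, false_or] at this
      rcases this with hH | hH
      · exact List.mem_append_left _ (List.mem_filterMap.2 ⟨_, hH, e⟩)
      · exact List.mem_append_right _ (List.mem_cons_of_mem _ (List.mem_filterMap.2 ⟨_, hH, e⟩))
  -- The relations of `F#G` to another face are those of `F` and `G` taken together (`before_none`,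
  -- `none_before`). Since `F` and `G` are adjacent in the given order, `U` and `W` satisfy them on
  -- either side of `F#G`.
  · refine List.pairwise_append.2 ⟨hsub U hU, List.pairwise_cons.2 ⟨?_, hsub W hW⟩, ?_⟩
    · intro c hc hb
      obtain ⟨H, hH, e⟩ := List.mem_filterMap.1 hc
      obtain ⟨_, rfl⟩ := hf.1 e
      rcases h.before_none.1 hb with hb | hb
      · exact hF H (by simp [hH]) hb
      · exact hG H hH hb
    · intro c hc c' hc' hb
      obtain ⟨H, hH, e⟩ := List.mem_filterMap.1 hc
      obtain ⟨_, rfl⟩ := hf.1 e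
      rcases List.mem_cons.1 hc' with rfl | hc'
      · rcases h.none_before.1 hb with hb | hb
        · exact hUW H hH F (by simp) hb
        · exact hUW H hH G (by simp) hb
      · obtain ⟨H', hH', e'⟩ := List.mem_filterMap.1 hc'
        obtain ⟨_, rfl⟩ := hf.1 e'
        exact hUW H hH H' (by simp [hH']) hb

/-- All hom-sets are singletons, which gives fullness and faithfulness. All objects of the target
are isomorphic, so a single object of the source gives essential surjectivity. -/
theorem Glueable.S_isEquivalence : h.S.IsEquivalence where
  faithful := ⟨fun _ => Subsingleton.elim _ _⟩
  full := ⟨fun _ => ⟨default, Subsingleton.elim _ _⟩⟩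
  essSurj := ⟨fun _ => ⟨⟨h.nonempty_linearExtension.some⟩, ⟨Codiscrete.iso _ _⟩⟩⟩

end PastingScheme

variable {K : Type u'} [GrayCategory.{w₃, w₂, v'} K] (𝓛 : Labelling 𝒢 K)

namespace Labelling
open PastingScheme

variable {F G : 𝒢.Face} (h : Glueable F G)

end Labelling
end GrayPasting

/-! ### The whiskered 2-cell of `F#G` as a composite -/

namespace GrayPasting
universe w₃ w₂ v u u' v' w
open GrayCategory

section Gray

variable {K : Type u} [GrayCategory.{w₃, w₂, v} K]

theorem γ_heq_left {X Y Z : K} {f f' h h' : X ⟶ Y} {α : f ⟶ f'} {δ : h ⟶ h'} {g g' : Y ⟶ Z}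
    (β : g ⟶ g') (e : f = h) (e' : f' = h') (ha : α ≍ δ) : (γ α β).hom ≍ (γ δ β).hom := by
  subst e e'; cases ha; rfl

/-- Associativity of whiskering lets `m` and `n` count either as part of the surroundings of `κ` or
as part of a larger cell `θ`. In the application they are the labels of the paths between the ends
of a face and those of `F#G`. -/
theorem wL_wR_heq {V W X Y Z T : K} (a : V ⟶ W) (m : W ⟶ X) {c c' : X ⟶ Y} (κ : c ⟶ c')
    (n : Y ⟶ Z) (b : Z ⟶ T) {k k' : W ⟶ Z} (hk : k = m ≫ c ≫ n) (hk' : k' = m ≫ c' ≫ n)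
    {θ : k ⟶ k'} (hθ : θ ≍ wL m (wR κ n)) : wL (a ≫ m) (wR κ (n ≫ b)) ≍ wL a (wR θ b) := by
  subst hk hk'; cases hθ
  refine (wL_assoc _ _ _).trans (wL_heq _ (by simp) (by simp) ?_)
  exact (wL_heq _ (by simp) (by simp) (wR_assoc _ _ _).symm).trans (wM_assoc _ _ _).symm

/-- The same regrouping inside an interchanger: `γ_assoc_left` transfers `n` from the second
argument to the first. -/
theorem γ_wL_wR_heq {V W X Y Z T U : K} (a : V ⟶ W) (m : W ⟶ X) {c c' : X ⟶ Y} (κ : c ⟶ c')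
    (n : Y ⟶ Z) (b : Z ⟶ T) {g g' : T ⟶ U} (β : g ⟶ g') {k k' : W ⟶ Z} (hk : k = m ≫ c ≫ n)
    (hk' : k' = m ≫ c' ≫ n) {θ : k ⟶ k'} (hθ : θ ≍ wL m (wR κ n)) :
    (γ (wL (a ≫ m) κ) (wL (n ≫ b) β)).hom ≍ (γ (wL a θ) (wL b β)).hom := by
  subst hk hk'; cases hθ
  refine (γ_heq _ (by simp) (by simp) (wL_assoc _ _ _)).trans ((γ_assoc_left _ _ _).symm.trans ?_)
  refine (γ_heq_left _ (by simp) (by simp) (wM_assoc _ _ _)).trans ?_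
  exact γ_heq_left _ (by simp) (by simp) (wL_assoc _ _ _)

end Gray

variable {V : Type u} [Quiver.{v} V] {𝒢 : PastingScheme.{v, u, w} V}

namespace PastingScheme

variable {F G : 𝒢.Face} (h : Glueable F G)

/-- The path in which `F` and `G` meet. -/
noncomputable def Glueable.middle : Quiver.Path h.glue.src h.glue.tgt :=
  h.glue.mF.comp ((𝒢.τ F).comp h.glue.nF)

theorem Glueable.comp_top_comp (A : Quiver.Path 𝒢.s h.glue.src) (B : Quiver.Path h.glue.tgt 𝒢.t) :
    A.comp (h.top.comp B) = (A.comp h.glue.mF).comp ((𝒢.σ F).comp (h.glue.nF.comp B)) := by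
  simp [Glueable.top]

theorem Glueable.comp_middle_comp (A : Quiver.Path 𝒢.s h.glue.src)
    (B : Quiver.Path h.glue.tgt 𝒢.t) :
    A.comp (h.middle.comp B) = (A.comp h.glue.mG).comp ((𝒢.σ G).comp (h.glue.nG.comp B)) := by
  simp [Glueable.middle, h.glue.eq]

theorem Glueable.eq_middle {P P₁ : Quiver.Path 𝒢.s 𝒢.t} (f : 𝒢.Step F P P₁)
    {A : Quiver.Path 𝒢.s h.glue.src} {B : Quiver.Path h.glue.tgt 𝒢.t}
    (hP : P = A.comp (h.top.comp B)) : P₁ = A.comp (h.middle.comp B) :=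
  step_unique f ⟨A.comp h.glue.mF, h.glue.nF.comp B, by rw [hP, h.comp_top_comp],
    by simp [Glueable.middle]⟩

end PastingScheme

variable {K : Type u'} [GrayCategory.{w₃, w₂, v'} K] (𝓛 : Labelling 𝒢 K)

namespace Labelling
open PastingScheme

variable {F G : 𝒢.Face}

section Factor

variable {x y : V} {P PF PG W : Quiver.Path 𝒢.s 𝒢.t} {m : Quiver.Path x (𝒢.fs F)}
  {n : Quiver.Path (𝒢.ft F) y} {k k' : 𝓛.diagram.obj x ⟶ 𝓛.diagram.obj y}
  (hk : k = along 𝓛.diagram m ≫ along 𝓛.diagram (𝒢.σ F) ≫ along 𝓛.diagram n)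
  (hk' : k' = along 𝓛.diagram m ≫ along 𝓛.diagram (𝒢.τ F) ≫ along 𝓛.diagram n)
  {θ : k ⟶ k'} (hθ : θ ≍ wL (along 𝓛.diagram m) (wR (𝓛.cell F) (along 𝓛.diagram n)))

include hk hk' hθ

/-- In this section `θ` stands for either factor of `α_G.α_F`, and `x`, `y` for the ends of `F#G`. A
step across `F` or across `G` then takes the form of `θ` whiskered by the surroundings `A`, `B` of
`F#G`, so the two steps acquire common outer 1-cells. -/
theorem stepCell_heq_of_heq (h : 𝒢.Step F P PF) (A : Quiver.Path 𝒢.s x) (B : Quiver.Path y 𝒢.t)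
    (hP : P = (A.comp m).comp ((𝒢.σ F).comp (n.comp B))) :
    𝓛.stepCell h ≍ wL (along 𝓛.diagram A) (wR θ (along 𝓛.diagram B)) :=
  (𝓛.stepCell_heq h _ _ hP (along_comp _ _ _) (along_comp _ _ _)).trans
    (wL_wR_heq _ _ _ _ _ hk hk' hθ)

theorem stepCell_heq_wR_of_heq (h : 𝒢.Step F P PF) (A : Quiver.Path 𝒢.s x) (B : Quiver.Path y 𝒢.t)
    (hP : P = (A.comp m).comp ((𝒢.σ F).comp (n.comp B)))
    {b : 𝓛.diagram.obj y ⟶ 𝓛.diagram.obj 𝒢.t} (hB : along 𝓛.diagram B = b) :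
    𝓛.stepCell h ≍ wR (wL (along 𝓛.diagram A) θ) b := by
  subst hB
  exact (𝓛.stepCell_heq_of_heq hk hk' hθ h A B hP).trans (wM_assoc _ _ _).symm

theorem stepCell_heq_wL_of_heq (h : 𝒢.Step F P PF) (A : Quiver.Path 𝒢.s x) (B : Quiver.Path y 𝒢.t)
    (hP : P = (A.comp m).comp ((𝒢.σ F).comp (n.comp B))) {X : K} {a : 𝓛.diagram.obj 𝒢.s ⟶ X}
    {b : X ⟶ 𝓛.diagram.obj x} (hA : along 𝓛.diagram A = a ≫ b) :
    𝓛.stepCell h ≍ wL a (wL b (wR θ (along 𝓛.diagram B))) := by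
  refine (𝓛.stepCell_heq_of_heq hk hk' hθ h A B hP).trans ?_
  rw [hA]
  exact wL_assoc _ _ _

/-- Writing the exchange with `θ` in place of the bare label gives the two factors of `α_G.α_F` the
same second argument in `γ`, as `γ_comp_left_of_heq` requires. -/
theorem swap_heq_γ_left (hne : F ≠ G) (hF : 𝒢.Step F P PF) (hFG : 𝒢.Step G PF W)
    (hG : 𝒢.Step G P PG) (hGF : 𝒢.Step F PG W) (A : Quiver.Path 𝒢.s x)
    (B : Quiver.Path y (𝒢.fs G)) (C : Quiver.Path (𝒢.ft G) 𝒢.t)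
    (hP : P = (A.comp m).comp ((𝒢.σ F).comp (n.comp (B.comp ((𝒢.σ G).comp C))))) :
    (𝓛.swap hne hF hFG hG hGF).hom ≍ (γ (wL (along 𝓛.diagram A) θ)
      (wL (along 𝓛.diagram B) (wR (𝓛.cell G) (along 𝓛.diagram C)))).hom := by
  refine (𝓛.swap_heq_γ hne hF hFG hG hGF (A.comp m) (n.comp B) C (by simp [hP])).trans ?_
  rw [along_comp, along_comp]
  exact γ_wL_wR_heq _ _ _ _ _ _ hk hk' hθ

/-- The counterpart for `γ_comp_right_of_heq`: `θ` now sits in the second argument, and the first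
one is common to both factors. -/
theorem swap_heq_γ_right (hne : G ≠ F) (hG : 𝒢.Step G P PG) (hGF : 𝒢.Step F PG W)
    (hF : 𝒢.Step F P PF) (hFG : 𝒢.Step G PF W) (A : Quiver.Path 𝒢.s (𝒢.fs G))
    (B : Quiver.Path (𝒢.ft G) x) (C : Quiver.Path y 𝒢.t)
    (hP : P = A.comp ((𝒢.σ G).comp ((B.comp m).comp ((𝒢.σ F).comp (n.comp C))))) :
    (𝓛.swap hne hG hGF hF hFG).hom ≍ (γ (wL (along 𝓛.diagram A) (𝓛.cell G))
      (wL (along 𝓛.diagram B) (wR θ (along 𝓛.diagram C)))).hom := by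
  refine (𝓛.swap_heq_γ hne hG hGF hF hFG A (B.comp m) (n.comp C) hP).trans ?_
  rw [along_comp, along_comp]
  exact γ_heq _ (by simp [hk]) (by simp [hk']) (wL_wR_heq _ _ _ _ _ hk hk' hθ)

end Factor

variable (h : Glueable F G)

/-- The first factor of `α_G.α_F`: the label of `F`, whiskered. -/
noncomputable def pastingFst : along 𝓛.diagram h.top ⟶ along 𝓛.diagram h.middle :=
  plug (along 𝓛.diagram h.glue.mF) (𝓛.cell F) (along 𝓛.diagram h.glue.nF)
    (by rw [Glueable.top, along_comp, along_comp]) (by rw [Glueable.middle, along_comp, along_comp])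

/-- The second factor of `α_G.α_F`: the label of `G`, whiskered. -/
noncomputable def pastingSnd : along 𝓛.diagram h.middle ⟶ along 𝓛.diagram h.bottom :=
  plug (along 𝓛.diagram h.glue.mG) (𝓛.cell G) (along 𝓛.diagram h.glue.nG)
    (by rw [Glueable.middle, h.glue.eq, along_comp, along_comp])
    (by rw [Glueable.bottom, along_comp, along_comp])

theorem pasting_eq : 𝓛.pasting h = 𝓛.pastingFst h ≫ 𝓛.pastingSnd h := rfl

theorem along_top : along 𝓛.diagram h.top = along 𝓛.diagram h.glue.mF ≫
    along 𝓛.diagram (𝒢.σ F) ≫ along 𝓛.diagram h.glue.nF := by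
  rw [Glueable.top, along_comp, along_comp]

theorem along_middle : along 𝓛.diagram h.middle = along 𝓛.diagram h.glue.mF ≫
    along 𝓛.diagram (𝒢.τ F) ≫ along 𝓛.diagram h.glue.nF := by
  rw [Glueable.middle, along_comp, along_comp]

theorem along_middle' : along 𝓛.diagram h.middle = along 𝓛.diagram h.glue.mG ≫
    along 𝓛.diagram (𝒢.σ G) ≫ along 𝓛.diagram h.glue.nG := by
  rw [Glueable.middle, h.glue.eq, along_comp, along_comp]

theorem along_bottom : along 𝓛.diagram h.bottom = along 𝓛.diagram h.glue.mG ≫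
    along 𝓛.diagram (𝒢.τ G) ≫ along 𝓛.diagram h.glue.nG := by
  rw [Glueable.bottom, along_comp, along_comp]

theorem pastingFst_heq : 𝓛.pastingFst h ≍
    wL (along 𝓛.diagram h.glue.mF) (wR (𝓛.cell F) (along 𝓛.diagram h.glue.nF)) :=
  plug_heq _ _ _ _ _

theorem pastingSnd_heq : 𝓛.pastingSnd h ≍
    wL (along 𝓛.diagram h.glue.mG) (wR (𝓛.cell G) (along 𝓛.diagram h.glue.nG)) :=
  plug_heq _ _ _ _ _

/-- Whiskering by a 1-cell preserves vertical composition strictly (`wR_comp`, `wL_comp`), and each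
whiskered factor of `α_G.α_F` is a step across `F` or `G`. This is the source of the equality on
objects. -/
theorem glue_stepCell_none {P P₁ P' : Quiver.Path 𝒢.s 𝒢.t} (st : h.scheme.Step none P P')
    (f : 𝒢.Step F P P₁) (g : 𝒢.Step G P₁ P') :
    (𝓛.glue h).stepCell st = 𝓛.stepCell f ≫ 𝓛.stepCell g := by
  obtain ⟨(A : Quiver.Path 𝒢.s h.glue.src), (B : Quiver.Path h.glue.tgt 𝒢.t), hP, hP'⟩ := id st
  have hP₀ : P = A.comp (h.top.comp B) := hP
  have hP₁ := h.eq_middle f hP₀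
  have hP₂ : P' = A.comp (h.bottom.comp B) := hP'
  refine eq_of_heq (((𝓛.glue h).stepCell_heq st A B hP rfl rfl).trans ?_)
  change wL (along 𝓛.diagram A) (wR (𝓛.pasting h) (along 𝓛.diagram B)) ≍ _
  rw [pasting_eq, wR_comp, wL_comp]
  refine comp_heq_comp ?_ ?_ ?_
    (𝓛.stepCell_heq_of_heq (𝓛.along_top h) (𝓛.along_middle h) (𝓛.pastingFst_heq h) f A B
      (by rw [hP₀, h.comp_top_comp])).symm
    (𝓛.stepCell_heq_of_heq (𝓛.along_middle' h) (𝓛.along_bottom h) (𝓛.pastingSnd_heq h) g A B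
      (by rw [hP₁, h.comp_middle_comp])).symm
  · rw [hP₀, along_comp, along_comp]
  · rw [hP₁, along_comp, along_comp]
  · rw [hP₂, along_comp, along_comp]

/-- The composite 2-cells of a labelling agree with those of the glued labelling. -/
theorem run_expandOrder {P : Quiver.Path h.scheme.s h.scheme.t} (d : h.scheme.Order P) :
    𝓛.run (h.expandOrder d) = (𝓛.glue h).run d := by
  induction d with
  | nil => rfl
  | cons H st d ih =>
    cases H with
    | none =>
      refine Eq.trans ?_ (congrArg (fun x => x ≫ (𝓛.glue h).run d)
        (𝓛.glue_stepCell_none h st (h.exists_steps st).choose_spec.1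
          (h.exists_steps st).choose_spec.2).symm)
      refine Eq.trans ?_ (Category.assoc _ _ _).symm
      exact congrArg (fun x => 𝓛.stepCell (h.exists_steps st).choose_spec.1 ≫
        𝓛.stepCell (h.exists_steps st).choose_spec.2 ≫ x) ih
    | some H => exact congrArg (fun x => 𝓛.stepCell (F := H.1) st ≫ x) ih

end Labelling
end GrayPasting

/-! ### Interchangers of `F#G` with another face -/

namespace GrayPasting
universe w₃ w₂ v u u' v' w
open GrayCategory

variable {V : Type u} [Quiver.{v} V] {𝒢 : PastingScheme.{v, u, w} V}
variable {K : Type u'} [GrayCategory.{w₃, w₂, v'} K] (𝓛 : Labelling 𝒢 K)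

namespace Labelling
open PastingScheme

/-- Composing with any chain back gives a chain from `d` to itself, and the identity is the only
one. -/
theorem Chain.exists_inv {𝓛 : Labelling 𝒢 K} {P : Quiver.Path 𝒢.s 𝒢.t} {d e : 𝒢.Order P}
    {φ : 𝓛.run d ⟶ 𝓛.run e} (hφ : 𝓛.Chain d e φ) : ∃ ψ, 𝓛.Chain e d ψ ∧ φ ≫ ψ = 𝟙 _ := by
  obtain ⟨ψ, hψ⟩ := 𝓛.exists_chain e d hφ.perm.symm
  exact ⟨ψ, hψ, (hφ.trans hψ).unique (.refl d)⟩

variable {F G : 𝒢.Face} (h : Glueable F G)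

/-- This is the axiom `γ_comp_left` for `α_G.α_F`, with `H` to the right of `F#G`. Since `α_G` comes
last in the composite, `H` is exchanged first with `G`, then with `F`. -/
theorem swap_none_heq {H : {H : 𝒢.Face // H ≠ F ∧ H ≠ G}}
    (hne : (none : h.scheme.Face) ≠ some H) {P P₁ PN PH P₁H W : Quiver.Path 𝒢.s 𝒢.t}
    (st : h.scheme.Step none P PN) (sth : h.scheme.Step (some H) PN W)
    (hst : h.scheme.Step (some H) P PH) (st' : h.scheme.Step none PH W)
    (f₁ : 𝒢.Step F P P₁) (g₁ : 𝒢.Step G P₁ PN) (hh : 𝒢.Step H.1 P₁ P₁H) (f₂ : 𝒢.Step F PH P₁H)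
    (g₂ : 𝒢.Step G P₁H W) (sth' : 𝒢.Step H.1 PN W) (hst' : 𝒢.Step H.1 P PH)
    (hl : Left (𝒢 := h.scheme) none (some H) P) :
    ((𝓛.glue h).swap hne st sth hst st').hom ≍
      (α_ (𝓛.stepCell f₁) (𝓛.stepCell g₁) (𝓛.stepCell sth')).hom ≫
        𝓛.stepCell f₁ ◁ (𝓛.swap H.2.2.symm g₁ sth' hh g₂).hom ≫
          (α_ (𝓛.stepCell f₁) (𝓛.stepCell hh) (𝓛.stepCell g₂)).inv ≫
            (𝓛.swap H.2.1.symm f₁ hh hst' f₂).hom ▷ 𝓛.stepCell g₂ ≫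
              (α_ (𝓛.stepCell hst') (𝓛.stepCell f₂) (𝓛.stepCell g₂)).hom := by
  obtain ⟨(A : Quiver.Path 𝒢.s h.glue.src), (B : Quiver.Path h.glue.tgt (𝒢.fs H.1)),
    (C : Quiver.Path (𝒢.ft H.1) 𝒢.t), hP⟩ := hl
  have hP₀ : P = A.comp (h.top.comp (B.comp ((𝒢.σ H.1).comp C))) := hP
  obtain ⟨hN, hH, hW⟩ : PN = A.comp (h.bottom.comp (B.comp ((𝒢.σ H.1).comp C))) ∧
    PH = A.comp (h.top.comp (B.comp ((𝒢.τ H.1).comp C))) ∧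
    W = A.comp (h.bottom.comp (B.comp ((𝒢.τ H.1).comp C))) := left_states st sth hst hP
  have hP₁ := h.eq_middle f₁ hP₀
  have hP₁H := h.eq_middle f₂ hH
  refine γ_comp_left_of_heq (wL (along 𝓛.diagram A) (𝓛.pastingFst h))
    (wL (along 𝓛.diagram A) (𝓛.pastingSnd h))
    (wL (along 𝓛.diagram B) (wR (𝓛.cell H.1) (along 𝓛.diagram C))) ?_ ?_ ?_ ?_ ?_ ?_
    (𝓛.glue_stepCell_none h st f₁ g₁) (𝓛.glue_stepCell_none h st' f₂ g₂) ?_ ?_ ?_ ?_ ?_ ?_ ?_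
    (𝓛.swap_heq_γ_left (𝓛.along_top h) (𝓛.along_middle h) (𝓛.pastingFst_heq h) _ _ _ _ _ A B C ?_)
    (𝓛.swap_heq_γ_left (𝓛.along_middle' h) (𝓛.along_bottom h) (𝓛.pastingSnd_heq h) _ _ _ _ _ A B C
      ?_) ?_
  · exact (congrArg (along 𝓛.diagram) hP₀).trans (by simp only [along_comp, Category.assoc])
  · exact (congrArg (along 𝓛.diagram) hP₁).trans (by simp only [along_comp, Category.assoc])
  · exact (congrArg (along 𝓛.diagram) hN).trans (by simp only [along_comp, Category.assoc])
  · exact (congrArg (along 𝓛.diagram) hH).trans (by simp only [along_comp, Category.assoc])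
  · exact (congrArg (along 𝓛.diagram) hP₁H).trans (by simp only [along_comp, Category.assoc])
  · exact (congrArg (along 𝓛.diagram) hW).trans (by simp only [along_comp, Category.assoc])
  · exact 𝓛.stepCell_heq_wR_of_heq (𝓛.along_top h) (𝓛.along_middle h) (𝓛.pastingFst_heq h) f₁ A _
      (by rw [hP₀, h.comp_top_comp]) (by simp only [along_comp])
  · exact 𝓛.stepCell_heq_wR_of_heq (𝓛.along_middle' h) (𝓛.along_bottom h) (𝓛.pastingSnd_heq h) g₁
      A _ (by rw [hP₁, h.comp_middle_comp]) (by simp only [along_comp])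
  · exact 𝓛.stepCell_heq_wR_of_heq (𝓛.along_top h) (𝓛.along_middle h) (𝓛.pastingFst_heq h) f₂ A _
      (by rw [hH, h.comp_top_comp]) (by simp only [along_comp])
  · exact 𝓛.stepCell_heq_wR_of_heq (𝓛.along_middle' h) (𝓛.along_bottom h) (𝓛.pastingSnd_heq h) g₂
      A _ (by rw [hP₁H, h.comp_middle_comp]) (by simp only [along_comp])
  · exact 𝓛.stepCell_heq_wL hst' (A.comp (h.top.comp B)) C (by simp [hP₀])
      (by simp only [along_comp, Category.assoc])
  · exact 𝓛.stepCell_heq_wL hh (A.comp (h.middle.comp B)) C (by simp [hP₁])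
      (by simp only [along_comp, Category.assoc])
  · exact 𝓛.stepCell_heq_wL sth' (A.comp (h.bottom.comp B)) C (by simp [hN])
      (by simp only [along_comp, Category.assoc])
  · rw [hP₀, h.comp_top_comp]
  · rw [hP₁, h.comp_middle_comp]
  -- The exchange in the glued labelling is the interchanger of the whiskered `α_G.α_F`, which has
  -- to be presented as a composite of its two whiskered factors.
  · refine ((𝓛.glue h).swap_heq_γ hne st sth hst st' A B C hP).trans ?_
    rw [← wL_comp, ← pasting_eq]
    rfl

/-- With `H` to the left of `F#G` the composite `α_G.α_F` is the second argument of `γ`, so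
`γ_comp_right` applies. Now `H` comes first and is exchanged with `F`, then with `G`. -/
theorem swap_none_heq' {H : {H : 𝒢.Face // H ≠ F ∧ H ≠ G}}
    (hne : some H ≠ (none : h.scheme.Face)) {P P₁ PN PH P₁H W : Quiver.Path 𝒢.s 𝒢.t}
    (hst : h.scheme.Step (some H) P PH) (st' : h.scheme.Step none PH W)
    (st : h.scheme.Step none P PN) (sth : h.scheme.Step (some H) PN W)
    (f₁ : 𝒢.Step F P P₁) (g₁ : 𝒢.Step G P₁ PN) (hh : 𝒢.Step H.1 P₁ P₁H) (f₂ : 𝒢.Step F PH P₁H)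
    (g₂ : 𝒢.Step G P₁H W) (sth' : 𝒢.Step H.1 PN W) (hst' : 𝒢.Step H.1 P PH)
    (hl : Left (𝒢 := h.scheme) (some H) none P) :
    ((𝓛.glue h).swap hne hst st' st sth).hom ≍
      (α_ (𝓛.stepCell hst') (𝓛.stepCell f₂) (𝓛.stepCell g₂)).inv ≫
        (𝓛.swap H.2.1 hst' f₂ f₁ hh).hom ▷ 𝓛.stepCell g₂ ≫
          (α_ (𝓛.stepCell f₁) (𝓛.stepCell hh) (𝓛.stepCell g₂)).hom ≫
            𝓛.stepCell f₁ ◁ (𝓛.swap H.2.2 hh g₂ g₁ sth').hom ≫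
              (α_ (𝓛.stepCell f₁) (𝓛.stepCell g₁) (𝓛.stepCell sth')).inv := by
  obtain ⟨(A : Quiver.Path 𝒢.s (𝒢.fs H.1)), (B : Quiver.Path (𝒢.ft H.1) h.glue.src),
    (C : Quiver.Path h.glue.tgt 𝒢.t), hP⟩ := hl
  have hP₀ : P = A.comp ((𝒢.σ H.1).comp (B.comp (h.top.comp C))) := hP
  obtain ⟨hH, hN, hW⟩ : PH = A.comp ((𝒢.τ H.1).comp (B.comp (h.top.comp C))) ∧
    PN = A.comp ((𝒢.σ H.1).comp (B.comp (h.bottom.comp C))) ∧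
    W = A.comp ((𝒢.τ H.1).comp (B.comp (h.bottom.comp C))) := left_states hst st' st hP
  have hP₀' : P = (A.comp ((𝒢.σ H.1).comp B)).comp (h.top.comp C) := by simp [hP₀]
  have hH' : PH = (A.comp ((𝒢.τ H.1).comp B)).comp (h.top.comp C) := by simp [hH]
  have hP₁ := h.eq_middle f₁ hP₀'
  have hP₁H := h.eq_middle f₂ hH'
  refine γ_comp_right_of_heq
    (wL (along 𝓛.diagram B) (wR (𝓛.pastingFst h) (along 𝓛.diagram C)))
    (wL (along 𝓛.diagram B) (wR (𝓛.pastingSnd h) (along 𝓛.diagram C)))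
    (wL (along 𝓛.diagram A) (𝓛.cell H.1)) ?_ ?_ ?_ ?_ ?_ ?_
    (𝓛.glue_stepCell_none h st f₁ g₁) (𝓛.glue_stepCell_none h st' f₂ g₂) ?_ ?_ ?_ ?_ ?_ ?_ ?_
    (𝓛.swap_heq_γ_right (𝓛.along_top h) (𝓛.along_middle h) (𝓛.pastingFst_heq h) _ _ _ _ _ A B C
      ?_)
    (𝓛.swap_heq_γ_right (𝓛.along_middle' h) (𝓛.along_bottom h) (𝓛.pastingSnd_heq h) _ _ _ _ _
      A B C ?_) ?_
  · exact (congrArg (along 𝓛.diagram) hP₀).trans (by simp only [along_comp, Category.assoc])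
  · exact (congrArg (along 𝓛.diagram) hP₁).trans (by simp only [along_comp, Category.assoc])
  · exact (congrArg (along 𝓛.diagram) hN).trans (by simp only [along_comp, Category.assoc])
  · exact (congrArg (along 𝓛.diagram) hH).trans (by simp only [along_comp, Category.assoc])
  · exact (congrArg (along 𝓛.diagram) hP₁H).trans (by simp only [along_comp, Category.assoc])
  · exact (congrArg (along 𝓛.diagram) hW).trans (by simp only [along_comp, Category.assoc])
  · exact 𝓛.stepCell_heq_wL_of_heq (𝓛.along_top h) (𝓛.along_middle h) (𝓛.pastingFst_heq h) f₁
      (A.comp ((𝒢.σ H.1).comp B)) C (by rw [hP₀', h.comp_top_comp])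
      (by simp only [along_comp, Category.assoc])
  · exact 𝓛.stepCell_heq_wL_of_heq (𝓛.along_middle' h) (𝓛.along_bottom h) (𝓛.pastingSnd_heq h) g₁
      (A.comp ((𝒢.σ H.1).comp B)) C (by rw [hP₁, h.comp_middle_comp])
      (by simp only [along_comp, Category.assoc])
  · exact 𝓛.stepCell_heq_wL_of_heq (𝓛.along_top h) (𝓛.along_middle h) (𝓛.pastingFst_heq h) f₂
      (A.comp ((𝒢.τ H.1).comp B)) C (by rw [hH', h.comp_top_comp])
      (by simp only [along_comp, Category.assoc])
  · exact 𝓛.stepCell_heq_wL_of_heq (𝓛.along_middle' h) (𝓛.along_bottom h) (𝓛.pastingSnd_heq h) g₂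
      (A.comp ((𝒢.τ H.1).comp B)) C (by rw [hP₁H, h.comp_middle_comp])
      (by simp only [along_comp, Category.assoc])
  · exact 𝓛.stepCell_heq_wR hst' A _ hP₀ (by simp only [along_comp])
  · exact 𝓛.stepCell_heq_wR hh A (B.comp (h.middle.comp C)) (by simp [hP₁])
      (by simp only [along_comp])
  · exact 𝓛.stepCell_heq_wR sth' A _ hN (by simp only [along_comp])
  · rw [hP₀', h.comp_top_comp]
    simp
  · rw [hP₁, h.comp_middle_comp]
    simp
  · refine ((𝓛.glue h).swap_heq_γ hne hst st' st sth A B C hP).trans ?_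
    rw [← wL_comp, ← wR_comp, ← pasting_eq]
    rfl

end Labelling
end GrayPasting

/-! ### Comparison 3-cells of the glued labelling, and the theorem -/

namespace GrayPasting
universe w₃ w₂ v u u' v' w
open GrayCategory

variable {V : Type u} [Quiver.{v} V] {𝒢 : PastingScheme.{v, u, w} V}
variable {K : Type u'} [GrayCategory.{w₃, w₂, v'} K] (𝓛 : Labelling 𝒢 K)

namespace Labelling
open PastingScheme

/-- Keeping the type of `φ` independent of the orders lets these be replaced by equal ones without
touching `φ`. -/
theorem exists_chain_heq_of_eq {𝓛 : Labelling 𝒢 K} {P : Quiver.Path 𝒢.s 𝒢.t}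
    {d d' e e' : 𝒢.Order P} (hd : d = d') (he : e = e') {X : Type w₃} {φ : X}
    (hφ : ∃ ψ, 𝓛.Chain d' e' ψ ∧ φ ≍ ψ) : ∃ ψ, 𝓛.Chain d e ψ ∧ φ ≍ ψ := by
  subst hd he
  exact hφ

variable {F G : 𝒢.Face} (h : Glueable F G)

theorem exists_chain_swap_none {H : {H : 𝒢.Face // H ≠ F ∧ H ≠ G}}
    (hne : (none : h.scheme.Face) ≠ some H) {P PN PH W : Quiver.Path 𝒢.s 𝒢.t}
    (st : h.scheme.Step none P PN) (sth : h.scheme.Step (some H) PN W)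
    (hst : h.scheme.Step (some H) P PH) (st' : h.scheme.Step none PH W) (d : h.scheme.Order W)
    (hl : Left (𝒢 := h.scheme) none (some H) P) :
    ∃ ψ, 𝓛.Chain (h.expandOrder (.cons none st (.cons (some H) sth d)))
      (h.expandOrder (.cons (some H) hst (.cons none st' d))) ψ ∧
      (α_ _ _ _).inv ≫ ((𝓛.glue h).swap hne st sth hst st').hom ▷ (𝓛.glue h).run d ≫
        (α_ _ _ _).hom ≍ ψ := by
  obtain ⟨P₁, f₁, g₁⟩ := h.exists_steps st
  have sth' : 𝒢.Step H.1 PN W := sth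
  have hst' : 𝒢.Step H.1 P PH := hst
  -- `P₁H` is the path beyond `F` and `H`, still above `G`. Crossing `G` from there leads to `W`,
  -- because the step across `H` from `PN` has only one target.
  obtain ⟨P₁H, hh, f₂⟩ := square H.2.1.symm f₁ hst'
  obtain ⟨W', g₂, hW⟩ := square H.2.2 hh g₁
  obtain rfl := step_unique hW sth'
  refine exists_chain_heq_of_eq (h.expandOrder_none st _ f₁ g₁)
    (congrArg (Order.cons (𝒢 := 𝒢) H.1 hst') (h.expandOrder_none st' d f₂ g₂)) ?_
  -- The chain `FGH`, `FHG`, `HFG`, followed by the remaining faces.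
  exact ⟨_, (Chain.cons f₁ (.swap H.2.2.symm g₁ sth' hh g₂ (h.expandOrder d))).trans
    (.swap H.2.1.symm f₁ hh hst' f₂ (.cons G g₂ (h.expandOrder d))),
    swap_comp_left_heq (𝓛.glue_stepCell_none h st f₁ g₁) (𝓛.glue_stepCell_none h st' f₂ g₂)
      (𝓛.swap_none_heq h hne st sth hst st' f₁ g₁ hh f₂ g₂ sth' hst' hl)
      (𝓛.run_expandOrder h d).symm⟩

theorem exists_chain_swap_none' {H : {H : 𝒢.Face // H ≠ F ∧ H ≠ G}}
    (hne : some H ≠ (none : h.scheme.Face)) {P PN PH W : Quiver.Path 𝒢.s 𝒢.t}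
    (hst : h.scheme.Step (some H) P PH) (st' : h.scheme.Step none PH W)
    (st : h.scheme.Step none P PN) (sth : h.scheme.Step (some H) PN W) (d : h.scheme.Order W)
    (hl : Left (𝒢 := h.scheme) (some H) none P) :
    ∃ ψ, 𝓛.Chain (h.expandOrder (.cons (some H) hst (.cons none st' d)))
      (h.expandOrder (.cons none st (.cons (some H) sth d))) ψ ∧
      (α_ _ _ _).inv ≫ ((𝓛.glue h).swap hne hst st' st sth).hom ▷ (𝓛.glue h).run d ≫
        (α_ _ _ _).hom ≍ ψ := by
  obtain ⟨P₁, f₁, g₁⟩ := h.exists_steps st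
  have sth' : 𝒢.Step H.1 PN W := sth
  have hst' : 𝒢.Step H.1 P PH := hst
  obtain ⟨P₁H, hh, f₂⟩ := square H.2.1.symm f₁ hst'
  obtain ⟨W', g₂, hW⟩ := square H.2.2 hh g₁
  obtain rfl := step_unique hW sth'
  refine exists_chain_heq_of_eq
    (congrArg (Order.cons (𝒢 := 𝒢) H.1 hst') (h.expandOrder_none st' d f₂ g₂))
    (h.expandOrder_none st _ f₁ g₁) ?_
  -- The chain `HFG`, `FHG`, `FGH`, followed by the remaining faces.
  exact ⟨_, (Chain.swap H.2.1 hst' f₂ f₁ hh (.cons G g₂ (h.expandOrder d))).trans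
    (Chain.cons f₁ (.swap H.2.2 hh g₂ g₁ sth' (h.expandOrder d))),
    swap_comp_right_heq (𝓛.glue_stepCell_none h st f₁ g₁) (𝓛.glue_stepCell_none h st' f₂ g₂)
      (𝓛.swap_none_heq' h hne hst st' st sth f₁ g₁ hh f₂ g₂ sth' hst' hl)
      (𝓛.run_expandOrder h d).symm⟩

/-- Both the reverse exchange and the reverse chain are inverses of one and the same 3-cell, so they
coincide. Each pair of faces then needs treatment in one direction only. -/
theorem exists_chain_swap_symm {H₁ H₂ : h.scheme.Face} (hne : H₁ ≠ H₂)
    {P P₁ P₂ W : Quiver.Path h.scheme.s h.scheme.t} (f : h.scheme.Step H₁ P P₁)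
    (fg : h.scheme.Step H₂ P₁ W) (g : h.scheme.Step H₂ P P₂) (gf : h.scheme.Step H₁ P₂ W)
    (d : h.scheme.Order W)
    (hs : ∃ ψ, 𝓛.Chain (h.expandOrder (.cons H₁ f (.cons H₂ fg d)))
      (h.expandOrder (.cons H₂ g (.cons H₁ gf d))) ψ ∧
      (α_ _ _ _).inv ≫ ((𝓛.glue h).swap hne f fg g gf).hom ▷ (𝓛.glue h).run d ≫
        (α_ _ _ _).hom ≍ ψ) :
    ∃ ψ, 𝓛.Chain (h.expandOrder (.cons H₂ g (.cons H₁ gf d)))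
      (h.expandOrder (.cons H₁ f (.cons H₂ fg d))) ψ ∧
      (α_ _ _ _).inv ≫ ((𝓛.glue h).swap hne.symm g gf f fg).hom ▷ (𝓛.glue h).run d ≫
        (α_ _ _ _).hom ≍ ψ := by
  obtain ⟨ψ, hψ, e⟩ := hs
  obtain ⟨ψ', hψ', e'⟩ := hψ.exists_inv
  refine ⟨ψ', hψ', heq_of_comp_eq_id (𝓛.run_expandOrder h _).symm (𝓛.run_expandOrder h _).symm
    e ?_ e'⟩
  rw [swap_symm (𝓛.glue h) hne f fg g gf]
  exact swap_whisker_inv _ _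

theorem exists_chain_swap {H₁ H₂ : h.scheme.Face} (hne : H₁ ≠ H₂)
    {P P₁ P₂ W : Quiver.Path h.scheme.s h.scheme.t} (f : h.scheme.Step H₁ P P₁)
    (fg : h.scheme.Step H₂ P₁ W) (g : h.scheme.Step H₂ P P₂) (gf : h.scheme.Step H₁ P₂ W)
    (d : h.scheme.Order W) :
    ∃ ψ, 𝓛.Chain (h.expandOrder (.cons H₁ f (.cons H₂ fg d)))
      (h.expandOrder (.cons H₂ g (.cons H₁ gf d))) ψ ∧
      (α_ _ _ _).inv ≫ ((𝓛.glue h).swap hne f fg g gf).hom ▷ (𝓛.glue h).run d ≫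
        (α_ _ _ _).hom ≍ ψ := by
  have key {H : {H : 𝒢.Face // H ≠ F ∧ H ≠ G}} (hne : (none : h.scheme.Face) ≠ some H)
      {P PN PH W : Quiver.Path 𝒢.s 𝒢.t} (st : h.scheme.Step none P PN)
      (sth : h.scheme.Step (some H) PN W) (hst : h.scheme.Step (some H) P PH)
      (st' : h.scheme.Step none PH W) (d : h.scheme.Order W) :
      ∃ ψ, 𝓛.Chain (h.expandOrder (.cons none st (.cons (some H) sth d)))
        (h.expandOrder (.cons (some H) hst (.cons none st' d))) ψ ∧
        (α_ _ _ _).inv ≫ ((𝓛.glue h).swap hne st sth hst st').hom ▷ (𝓛.glue h).run d ≫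
          (α_ _ _ _).hom ≍ ψ := by
    -- If `H` lies to the left of `F#G`, the exchange is the inverse of the interchanger treated in
    -- `exists_chain_swap_none'`.
    rcases left_or_left hne st hst with hl | hl
    · exact 𝓛.exists_chain_swap_none h hne st sth hst st' d hl
    · exact 𝓛.exists_chain_swap_symm h hne.symm hst st' st sth d
        (𝓛.exists_chain_swap_none' h hne.symm hst st' st sth d hl)
  rcases H₁ with _ | H₁ <;> rcases H₂ with _ | H₂
  · exact (hne rfl).elim
  · exact key hne f fg g gf d
  · exact 𝓛.exists_chain_swap_symm h hne.symm g gf f fg d (key hne.symm g gf f fg d)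
  -- For two faces other than `F#G` the interchanger is the same in both schemes; only the composite
  -- of the remaining faces is rewritten.
  · have hne' : H₁.1 ≠ H₂.1 := fun e => hne (congrArg some (Subtype.ext e))
    exact ⟨_, .swap (𝒢 := 𝒢) hne' f fg g gf (h.expandOrder d),
      swap_whisker_heq (𝓛.run_expandOrder h d).symm _⟩

variable {𝓛} in
/-- The comparison 3-cells of the glued labelling are comparison 3-cells of the given one. -/
theorem Chain.exists_expandOrder {P : Quiver.Path h.scheme.s h.scheme.t} {d e : h.scheme.Order P}
    {φ : (𝓛.glue h).run d ⟶ (𝓛.glue h).run e} (hφ : (𝓛.glue h).Chain d e φ) :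
    ∃ ψ, 𝓛.Chain (h.expandOrder d) (h.expandOrder e) ψ ∧ φ ≍ ψ := by
  induction hφ with
  | refl d => exact ⟨_, .refl _, by rw [𝓛.run_expandOrder h d]; rfl⟩
  | trans _ _ ih ih' =>
    obtain ⟨ψ, hψ, e⟩ := ih
    obtain ⟨ψ', hψ', e'⟩ := ih'
    exact ⟨_, hψ.trans hψ', comp_heq_comp (𝓛.run_expandOrder h _).symm
      (𝓛.run_expandOrder h _).symm (𝓛.run_expandOrder h _).symm e e'⟩
  | @cons H P P' st d e φ _ ih =>
    obtain ⟨ψ, hψ, e⟩ := ih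
    have e' := whiskerLeft_heq ((𝓛.glue h).stepCell st) (𝓛.run_expandOrder h _).symm
      (𝓛.run_expandOrder h _).symm e
    cases H with
    -- One whiskering by the step across `F#G` becomes two, by the steps across `G` and `F`.
    | none => exact ⟨_, (hψ.cons _).cons _, e'.trans
        (comp_whiskerLeft_heq _ _ (𝓛.glue_stepCell_none h st _ _) _)⟩
    | some H => exact ⟨_, hψ.cons (F := H.1) st, e'⟩
  | swap hne f fg g gf d => exact 𝓛.exists_chain_swap h hne f fg g gf d

/-- On morphisms, a comparison 3-cell of the glued labelling is a chain for `𝓛` between the expanded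
orders, and uniqueness of chains identifies it with the comparison 3-cell of `𝓛`. -/
theorem S_comp_functor : h.S ⋙ 𝓛.functor = (𝓛.glue h).functor := by
  have hobj (X : h.scheme.LinearExtension) :
      𝓛.run (h.expand X).order = (𝓛.glue h).run X.order := by
    rw [h.expand_order]
    exact 𝓛.run_expandOrder h _
  refine Functor.hext (fun X => hobj X.as) fun X Y f => ?_
  obtain ⟨ψ, hψ, e⟩ := ((𝓛.glue h).compare_chain X.as Y.as).exists_expandOrder h
  refine HEq.trans ?_ e.symm
  change 𝓛.compare (h.expand X.as) (h.expand Y.as) ≍ ψ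
  have hc := 𝓛.compare_chain (h.expand X.as) (h.expand Y.as)
  -- The type of the comparison 3-cell mentions the chosen orders. It is generalized to an arbitrary
  -- chain so that these can be rewritten as expanded orders.
  revert hc
  generalize 𝓛.compare (h.expand X.as) (h.expand Y.as) = χ
  revert χ
  rw [h.expand_order, h.expand_order]
  exact fun χ hχ => heq_of_eq (hχ.unique hψ)

theorem gluedStar_naturality {α' : along 𝓛.diagram h.top ⟶ along 𝓛.diagram h.bottom}
    (Θ : 𝓛.pasting h ⟶ α') {X Y : h.scheme.C} (f : X ⟶ Y) :
    (𝓛.glue h).functor.map f ≫ 𝓛.gluedStar h Θ Y =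
      𝓛.gluedStar h Θ X ≫ (𝓛.glueWith h α').functor.map f :=
  (𝓛.glue h).star_naturality (𝓛.gluedCell₂ h Θ) f

end Labelling
end GrayPasting

theorem mainTheorem3 {V : Type*} [Quiver V] (𝒢 : GrayPasting.PastingScheme V)
    {K : Type*} [GrayPasting.GrayCategory K] (𝓛 : GrayPasting.Labelling 𝒢 K)
    (F G : 𝒢.Face) (h : GrayPasting.PastingScheme.Glueable F G) :
    h.S.IsEquivalence ∧
    ∃ e : h.S ⋙ 𝓛.functor = (𝓛.glue h).functor,
    ∀ J : 𝒢.C ⥤ h.scheme.C, Nonempty (𝟭 h.scheme.C ≅ h.S ⋙ J) → Nonempty (J ⋙ h.S ≅ 𝟭 𝒢.C) →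
    ∀ (α' : GrayPasting.along 𝓛.diagram h.top ⟶ GrayPasting.along 𝓛.diagram h.bottom)
      (Θ : 𝓛.pasting h ⟶ α'),
      ∃! Ξ : 𝓛.functor ⟶ J ⋙ (𝓛.glueWith h α').functor,
        ∀ X : 𝒢.C, Ξ.app X =
          𝓛.functor.map (Codiscrete.iso X (h.S.obj (J.obj X))).hom ≫
            (eqToHom e).app (J.obj X) ≫ 𝓛.gluedStar h Θ (J.obj X) := by
  refine ⟨h.S_isEquivalence, 𝓛.S_comp_functor h, fun J _ _ α' Θ => ?_⟩
  -- The components are prescribed, so existence amounts to naturality, and uniqueness is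
  -- extensionality of natural transformations.
  refine ⟨⟨fun X => 𝓛.functor.map (Codiscrete.iso X (h.S.obj (J.obj X))).hom ≫
    (eqToHom (𝓛.S_comp_functor h)).app (J.obj X) ≫ 𝓛.gluedStar h Θ (J.obj X), ?_⟩,
    fun _ => rfl, fun Ξ hΞ => NatTrans.ext (funext hΞ)⟩
  intro X Y f
  have e₁ : 𝓛.functor.map f ≫ 𝓛.functor.map (Codiscrete.iso Y (h.S.obj (J.obj Y))).hom =
      𝓛.functor.map (Codiscrete.iso X (h.S.obj (J.obj X))).hom ≫
        (h.S ⋙ 𝓛.functor).map (J.map f) := by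
    -- Both sides become images under `𝓛` of morphisms from `X` to `S_FG J Y`, and there is only one
    -- such morphism.
    rw [← Functor.map_comp, Functor.comp_map, ← Functor.map_comp]
    rfl
  have e₂ := (eqToHom (𝓛.S_comp_functor h)).naturality (J.map f)
  have e₃ := 𝓛.gluedStar_naturality h Θ (J.map f)
  -- The three squares side by side: the isomorphism to `S_FG J`, the equality of functors, and the
  -- whiskered 3-cell.
  exact (GrayPasting.square_comp e₁.symm
    (GrayPasting.square_comp e₂.symm e₃.symm)).symm
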